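/- Let $K$ be a nonarchimedean local field (of any characteristic), with valuation ring $\mathcal O_K$, maximal ideal $\wp_K$ and residue field of size $q_K$. Let $K^{\rm sep}$ be a separable closure and $G_K=\mathrm{Gal}(K^{\rm sep}/K)$. For a finite group $\Gamma$ let $S_{K,\Gamma}$ be the set of continuous homomorphisms $G_K\to\Gamma$, with $\Gamma$ discrete. For $L$ equal to $K$ or to a finite extension of $K$ inside $K^{\rm sep}$, and $\phi\colon G_L\to S_2$ continuous, let $c_{S_2}(\phi)$ be the Artin conductor (exponent) of $\phi$ composed with the permutation representation $S_2\to \mathrm{GL}_2(\mathbb C)$. Let $S_2\wr S_2=S_2^{\{0,1\}}\rtimes S_2$, acting on $\{0,1\}\times\{0,1\}$ (two blocks of two points). For $\rho\colon G_K\to S_2\wr S_2$ let $\bar\rho\colon G_K\to S_2$ be the induced action on the two blocks; for a block $j$ let $L_j$ be the fixed field of the stabilizer of $j$ in $G_K$, and let $\rho_j\colon G_{L_j}\to S_2$ be the action on the two points of block $j$. The wreath counting function is $$c(\rho)=c_{S_2}(\bar\rho)+\sum_i f_i\,c_{S_2}(\rho_i),$$ where $i$ runs over the least elements of the $G_K$-orbits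 of blocks, and $f_i$ is the number of orbits of the inertia group $I_K$ into which the $G_K$-orbit of $i$ breaks up. Then: 1. $D_4$ (the dihedral group of order $8$) is isomorphic to $S_2\wr S_2$, and for any isomorphism used to transport $c$ to $S_{K,D_4}$, the following sum converges and $$M(K,D_4,c)=\sum_{\rho\in S_{K,D_4}}\frac1{q_K^{c(\rho)}}=8+\frac{16}{q_K}+\frac{16}{q_K^2}.$$ 2. For every $\rho\colon G_K\to S_2\wr S_2$, $c(\rho)$ is a nonnegative integer. If moreover $\rho$ is transitive on the four points (for instance surjective), then for every block $j$ and every point $x$ of block $j$, with $L=L_j$ and $M$ the fixed field of the stabilizer of $x$ in $G_L$, we have $[L:K]=[M:L]=2$ and $$\wp_K^{c(\rho)}=\mathrm{Disc}(L|K)\cdot N_{L|K}\bigl(\mathrm{Disc}(M|L)\bigr),$$ so that $\rho$ is counted with the weight $q_K^{-c(\rho)}=|\mathrm{Disc}(L|K)\,N_{L|K}(\mathrm{Disc}(M|L))|^{-1}$. -/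

import Mathlib

open scoped ValuativeRel

noncomputable section

section GaloisRepresentations

/-- The set of continuous homomorphisms from `Gal(Ω/F)` (with the Krull topology) to `Γ` with the
discrete topology. When `Ω` is a separable closure of `F`, this is the set `S_{F,Γ}` of
`Γ`-representations of the absolute Galois group of `F`. -/
@[ext]
structure GalRep (F Ω Γ : Type*) [Field F] [Field Ω] [Algebra F Ω] [Group Γ] where
  toHom : Gal(Ω/F) →* Γ
  continuous_toHom : @Continuous _ _ _ (⊥ : TopologicalSpace Γ) toHom

namespace GalRep

variable {F Ω Γ Γ' X : Type*} [Field F] [Field Ω] [Algebra F Ω] [Group Γ] [Group Γ']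
  [MulAction Γ X]

/-- Composition of a representation with a homomorphism `Γ → Γ'`. -/
def comp (f : Γ →* Γ') (ρ : GalRep F Ω Γ) : GalRep F Ω Γ' where
  toHom := f.comp ρ.toHom
  continuous_toHom := by
    let _ : TopologicalSpace Γ := ⊥
    let _ : TopologicalSpace Γ' := ⊥
    have : DiscreteTopology Γ := ⟨rfl⟩
    exact (continuous_of_discreteTopology (f := f)).comp ρ.continuous_toHom

theorem isOpen_preimage (ρ : GalRep F Ω Γ) (s : Set Γ) : IsOpen (ρ.toHom ⁻¹' s) := by
  let _ : TopologicalSpace Γ := ⊥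
  have : DiscreteTopology Γ := ⟨rfl⟩
  exact (isOpen_discrete s).preimage ρ.continuous_toHom

theorem continuous_of_isOpen_ker (f : Gal(Ω/F) →* Γ) (h : IsOpen (f.ker : Set Gal(Ω/F))) :
    @Continuous _ _ _ (⊥ : TopologicalSpace Γ) f := by
  let _ : TopologicalSpace Γ := ⊥
  have : DiscreteTopology Γ := ⟨rfl⟩
  refine continuous_of_continuousAt_one f ?_
  rw [ContinuousAt, map_one, nhds_discrete Γ, Filter.tendsto_pure]
  filter_upwards [h.mem_nhds (one_mem f.ker)] with x hx using hx

/-- The fixed field of the kernel of `ρ`. -/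
def kerField (ρ : GalRep F Ω Γ) : IntermediateField F Ω :=
  IntermediateField.fixedField ρ.toHom.ker

instance normal_kerField [Normal F Ω] (ρ : GalRep F Ω Γ) : Normal F ρ.kerField := by
  apply IntermediateField.normal_iff_forall_map_le'.mpr
  rintro σ x ⟨a, ha, rfl⟩ τ
  exact (AlgEquiv.symm_apply_eq σ).mp
    (ha ⟨σ⁻¹ * τ * σ, Subgroup.Normal.conj_mem' inferInstance τ.1 τ.2 σ⟩)

/-- The stabilizer in `Gal(Ω/F)` of a point `x`, for the action through `ρ`. -/
def stab (ρ : GalRep F Ω Γ) (x : X) : Subgroup Gal(Ω/F) :=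
  (MulAction.stabilizer Γ x).comap ρ.toHom

/-- The fixed field of the stabilizer of `x`. -/
def pointField (ρ : GalRep F Ω Γ) (x : X) : IntermediateField F Ω :=
  IntermediateField.fixedField (ρ.stab x)

theorem restrictScalars_mem_stab [IsGalois F Ω] (ρ : GalRep F Ω Γ) (x : X)
    (σ : Gal(Ω/ρ.pointField x)) : σ.restrictScalars F ∈ ρ.stab x := by
  have hopen : IsOpen (ρ.stab x : Set Gal(Ω/F)) := ρ.isOpen_preimage (MulAction.stabilizer Γ x : Set Γ)
  have h := InfiniteGalois.fixingSubgroup_fixedField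
    (⟨ρ.stab x, Subgroup.isClosed_of_isOpen _ hopen⟩ : ClosedSubgroup Gal(Ω/F))
  change (ρ.pointField x).fixingSubgroup = ρ.stab x at h
  rw [← h]
  intro y
  exact σ.commutes y

theorem continuous_restrictScalars [Algebra.IsIntegral F Ω] (L : IntermediateField F Ω) :
    Continuous (AlgEquiv.restrictScalarsHom F : Gal(Ω/L) →* Gal(Ω/F)) := by
  refine continuous_of_continuousAt_one _ ?_
  rw [ContinuousAt, map_one]
  intro s hs
  obtain ⟨E, hE, hEs⟩ := (krullTopology_mem_nhds_one_iff F Ω s).mp hs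
  obtain ⟨t, rfl⟩ :=
    IntermediateField.essFiniteType_iff.mp (inferInstance : Algebra.EssFiniteType F E)
  have hfin : FiniteDimensional L (IntermediateField.adjoin L (t : Set Ω)) :=
    IntermediateField.finiteDimensional_adjoin fun x _ =>
      (Algebra.IsIntegral.isIntegral (R := F) x).tower_top
  refine (krullTopology_mem_nhds_one_iff L Ω _).mpr ⟨_, hfin, fun σ hσ => hEs ?_⟩
  rintro ⟨y, hy⟩
  refine (IntermediateField.forall_mem_adjoin_smul_eq_self_iff F (S := (t : Set Ω))
    (σ.restrictScalars F)).mpr (fun x hx => ?_) y hy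
  exact hσ ⟨x, IntermediateField.subset_adjoin L _ hx⟩

end GalRep

end GaloisRepresentations

section LocalInvariants

variable (R F E : Type*) [CommRing R] [Field F] [Field E] [Algebra R F] [Algebra R E]
  [Algebra F E] [IsScalarTower R F E]

/-- The ring of integers of `E`: the integral closure of the base valuation ring `R`. -/
abbrev intRing : Type _ := integralClosure R E

/-- The maximal ideal of `intRing R E`, expressed as the Jacobson radical; in all the uses below
`intRing R E` is a local ring. -/
def primeIdeal : Ideal (intRing R E) := Ideal.jacobson ⊥

/-- The `i`-th ramification group of `E/F` in the lower numbering: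
those `σ` for which `σ x - x ∈ 𝔭_E ^ (i + 1)` for all integers `x` of `E`. -/
def ramificationGroup (i : ℕ) : Subgroup Gal(E/F) where
  carrier := {σ | ∀ x : intRing R E, ∃ y ∈ primeIdeal R E ^ (i + 1), (y : E) = σ x - x}
  one_mem' x := ⟨0, zero_mem _, by simp⟩
  mul_mem' {σ τ} hσ hτ x := by
    obtain ⟨y, hy, hy'⟩ := hτ x
    obtain ⟨z, hz, hz'⟩ := hσ x
    obtain ⟨w, hw, hw'⟩ := hσ y
    refine ⟨w + y + z, add_mem (add_mem hw hy) hz, ?_⟩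
    simp [hw', hz', hy']
  inv_mem' {σ} hσ x := by
    have hx : IsIntegral R (σ⁻¹ (x : E)) := x.2.map (σ⁻¹.restrictScalars R)
    obtain ⟨y, hy, hy'⟩ := hσ ⟨_, hx⟩
    refine ⟨-y, neg_mem hy, ?_⟩
    simp [hy']

/-- The inertia subgroup of `Gal(E/F)`. -/
def inertiaGroup : Subgroup Gal(E/F) := ramificationGroup R F E 0

/-- The discriminant of `E/F`: the ideal of the ring of integers of `F` generated by the
discriminants of all `F`-bases of `E` that consist of integers. -/
def discIdeal : Ideal (intRing R F) :=
  Ideal.span {d | ∃ b : Module.Basis (Fin (Module.finrank F E)) F E,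
    (∀ i, IsIntegral R (b i)) ∧ (d : F) = Algebra.discr F b}

variable {E} in
/-- The ideal norm `N_{E|F}`: the ideal generated by the norms of the elements. -/
def normIdeal (I : Ideal (intRing R E)) : Ideal (intRing R F) :=
  Ideal.span {a | ∃ x ∈ I, (a : F) = Algebra.norm F (x : E)}

end LocalInvariants

section Conductor

instance isScalarTower_intermediateField {R K Ω : Type*} [CommRing R] [Field K] [Field Ω]
    [Algebra R K] [Algebra R Ω] [Algebra K Ω] [IsScalarTower R K Ω] (L : IntermediateField K Ω) :
    IsScalarTower R L Ω :=
  IsScalarTower.of_algebraMap_eq fun _ => rfl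

variable (R : Type*) {F Ω Γ V : Type*} [CommRing R] [Field F] [Field Ω] [Algebra R F] [Algebra R Ω]
  [Algebra F Ω] [IsScalarTower R F Ω] [Normal F Ω] [Group Γ] [AddCommGroup V] [Module ℂ V]

/-- The image in `Γ` of the `i`-th ramification group of the extension of `F` cut out by `ρ`. -/
def GalRep.ramificationImage (ρ : GalRep F Ω Γ) (i : ℕ) : Subgroup Γ :=
  ((ramificationGroup R F ρ.kerField i).comap
    (AlgEquiv.restrictNormalHom ρ.kerField)).map ρ.toHom

/-- The Artin conductor (exponent) of `ρ` composed with the complex representation `π` of `Γ`: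
`∑_{i ≥ 0} |G_i| / |G_0| * codim V ^ {G_i}`, a sum with finitely many nonzero terms. -/
def artinConductor (π : Representation ℂ Γ V) (ρ : GalRep F Ω Γ) : ℚ :=
  ∑ᶠ i : ℕ, (Nat.card (ρ.ramificationImage R i) : ℚ) / Nat.card (ρ.ramificationImage R 0) *
    ((Module.finrank ℂ V : ℚ) -
      Module.finrank ℂ (Representation.invariants (π.comp (ρ.ramificationImage R i).subtype)))

/-- The counting function attached to the standard representation of `S_n` on `ℂ ^ n`. -/
def symmetricCount (n : ℕ) (ρ : GalRep F Ω (Equiv.Perm (Fin n))) : ℚ :=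
  artinConductor R (Representation.ofMulAction ℂ (Equiv.Perm (Fin n)) (Fin n)) ρ

end Conductor

section Wreath

/-- The wreath product `A ≀ B`, where `B` acts on `𝓑`. An element `(a, b)` acts on `𝓑 × 𝓐`
by first applying `b` and then `a j` on the `j`-th copy of `𝓐`. -/
abbrev PermWreath (A B 𝓑 : Type*) [Group A] [Group B] [MulAction B 𝓑] : Type _ :=
  (𝓑 → A) ⋊[mulAutArrow] B

variable {K Ω A B 𝓐 𝓑 : Type*} [Field K] [Field Ω] [Algebra K Ω] [Group A] [Group B]
  [MulAction A 𝓐] [MulAction B 𝓑]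

/-- The natural action of `A ≀ B` on the disjoint union of copies of `𝓐` indexed by `𝓑`. -/
instance PermWreath.mulAction : MulAction (PermWreath A B 𝓑) (𝓑 × 𝓐) where
  smul g p := (g.right • p.1, g.left (g.right • p.1) • p.2)
  one_smul p := by
    change ((1 : B) • p.1, (1 : A) • p.2) = p
    simp
  mul_smul g h p := by
    change ((g.right * h.right) • p.1,
      (g.left ((g.right * h.right) • p.1) * h.left (g.right⁻¹ • (g.right * h.right) • p.1)) • p.2) =
      (g.right • h.right • p.1, g.left (g.right • h.right • p.1) • h.left (h.right • p.1) • p.2)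
    simp [mul_smul]

namespace GalRep

/-- The quotient `ρ̄ : G_K → B` of `ρ : G_K → A ≀ B`. -/
def quot (ρ : GalRep K Ω (PermWreath A B 𝓑)) : GalRep K Ω B :=
  ρ.comp SemidirectProduct.rightHom

variable [IsGalois K Ω]

/-- The action `ρ_j : G_{L_j} → A` on the `j`-th copy of `𝓐`, where `L_j` is the fixed field of the
stabilizer of `j`. -/
def block (ρ : GalRep K Ω (PermWreath A B 𝓑)) (j : 𝓑) : GalRep (ρ.quot.pointField j) Ω A where
  toHom :=
    { toFun := fun σ => (ρ.toHom (σ.restrictScalars K)).left j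
      map_one' := by
        change (ρ.toHom 1).left j = 1
        simp
      map_mul' := fun σ τ => by
        have hσ : (ρ.toHom (σ.restrictScalars K)).right • j = j :=
          ρ.quot.restrictScalars_mem_stab j σ
        change (ρ.toHom (σ.restrictScalars K * τ.restrictScalars K)).left j = _
        rw [map_mul]
        change _ * (ρ.toHom (τ.restrictScalars K)).left
          ((ρ.toHom (σ.restrictScalars K)).right⁻¹ • j) = _
        rw [inv_smul_eq_iff.mpr hσ.symm] }
  continuous_toHom := by
    let _ : TopologicalSpace A := ⊥
    have : DiscreteTopology A := ⟨rfl⟩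
    refine continuous_discrete_rng.mpr fun a => ?_
    exact (ρ.isOpen_preimage {g | g.left j = a}).preimage
      (continuous_restrictScalars (ρ.quot.pointField j))

variable (R : Type*) [CommRing R] [Algebra R K] [Algebra R Ω] [IsScalarTower R K Ω]

/-- The number `f_j` of orbits under inertia into which the `G_K`-orbit of `j` breaks up. -/
def inertiaOrbits {Γ X : Type*} [Group Γ] [MulAction Γ X] (ρ : GalRep K Ω Γ) (j : X) : ℕ :=
  (Set.range fun σ : Gal(Ω/K) =>
    MulAction.orbit ((inertiaGroup R K Ω).map ρ.toHom) (ρ.toHom σ • j)).ncard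

end GalRep

open Classical in
/-- The wreath counting function `c(ρ) = c_B(ρ̄) + ∑ f_i c_A(ρ_i)`, where `i` runs over
representatives (here: the least elements) of the `G_K`-orbits on `𝓑`. -/
def wreathCount (R : Type*) [CommRing R] [Algebra R K] [Algebra R Ω] [IsScalarTower R K Ω]
    [IsGalois K Ω] [Fintype 𝓑] [LinearOrder 𝓑] (cB : GalRep K Ω B → ℚ)
    (cA : ∀ L : IntermediateField K Ω, GalRep L Ω A → ℚ)
    (ρ : GalRep K Ω (PermWreath A B 𝓑)) : ℚ :=
  cB ρ.quot + ∑ i : 𝓑 with ∀ σ, i ≤ ρ.quot.toHom σ • i,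
    (ρ.quot.inertiaOrbits R i : ℚ) * cA (ρ.quot.pointField i) (ρ.block i)

end Wreath

section DihedralFour

/-- The wreath product `S₂ ≀ S₂`. -/
abbrev S2WrS2 : Type := PermWreath (Equiv.Perm (Fin 2)) (Equiv.Perm (Fin 2)) (Fin 2)

variable (K : Type*) [Field K] [ValuativeRel K]

/-- The wreath counting function for `S₂ ≀ S₂`, built from the counting functions attached to the
standard representation of `S₂`. -/
def countS2WrS2 (ρ : GalRep K (SeparableClosure K) S2WrS2) : ℚ :=
  wreathCount 𝒪[K] (symmetricCount 𝒪[K] 2) (fun _ => symmetricCount 𝒪[K] 2) ρ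

end DihedralFour

end

/-! Write x = 1/q. A homomorphism ρ to `S₂ ≀ S₂` is sorted by its action β on the two blocks. If β
is trivial, ρ is a pair of quadratic characters of G_K and their conductors add up. If β is
nontrivial with quadratic field L, a Shapiro-type argument (`bijective_block_zero`) shows that ρ
amounts to a quadratic character of G_L, its action on block 0, and one free element of S₂. Then
c(ρ) is twice the conductor of that character if L is unramified, since inertia has two orbits on
the blocks, and n plus that conductor if L is ramified of exponent n.

Everything thus reduces to Serre's mass formula for quadratic characters, over K and over L: the
trivial and the unramified character contribute 1 each, and the ramified ones contribute ∑ x^n = 2x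
(`tsum_encard_isRam`). The residue field of L has q² elements in the unramified case and q in the
ramified case, so the total is (2 + 2x)² + 2(2 + 2x²) + 2x · 2(2 + 2x) = 8 + 16x + 16x².

The mass formula is proved uniformly in the characteristic by counting Eisenstein polynomials X² +
aX + b (`ncard_isRam_of_family`). For a given exponent n the trace can be normalised to a fixed a, a
power of ϖ if n is even and 0 if n is odd. By Krasner's lemma the character depends only on b modulo
valuation v(ϖ)^(n+1), and the b of one character form an orbit under the changes of generator that
preserve a, whose size can be computed. This gives 2(q-1)q^s characters of exponent 2(s+1) as long
as v(2) ≤ v(ϖ)^(s+1), and 2q^e of exponent 2e+1 if v(2) = v(ϖ)^e. The masses form a geometric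
series.

All arithmetic takes place in one Galois invariant valuation v on the separable closure, whose unit
ball is the integral closure of the base ring. Conductors, discriminants and norms become statements
about v, and `Valuation.IsLocalOver` passes from K to its quadratic extensions. For the discriminant
formula, an integral generator α gives the discriminant (σα - α)², with the same exponent as the
conductor; the norm multiplies exponents by the residue degree, and the two blocks are conjugate. -/

open scoped NNReal

noncomputable section

/-! ### Counting by fibres -/

section Counting

/-- On `s` the map `g` factors through `f`, so the classes in `f '' s` are partitioned by their
value under `g`, with `k` classes for each value. It serves twice below: for classes of polynomials
giving one character, and for changes of generator giving one class. -/
theorem Set.ncard_image_eq_mul_of_fibers {α β γ : Type*} {s : Set α} {f : α → β} {g : α → γ}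
    {k : ℕ} (hfin : (f '' s).Finite) (hfg : ∀ a ∈ s, ∀ b ∈ s, f a = f b → g a = g b)
    (hk : ∀ a ∈ s, (f '' {b | b ∈ s ∧ g b = g a}).ncard = k) :
    (f '' s).ncard = k * (g '' s).ncard := by
  classical
  -- The factor map is made total with `none` outside the image, so that `γ` needs no default
  -- element.
  have hex : ∀ y : β, ∃ z : Option γ, ∀ a ∈ s, f a = y → z = some (g a) := by
    intro y
    by_cases h : ∃ a ∈ s, f a = y
    · obtain ⟨a, ha, rfl⟩ := h
      exact ⟨some (g a), fun b hb hba => by rw [hfg b hb a ha hba]⟩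
    · exact ⟨none, fun a ha hay => (h ⟨a, ha, hay⟩).elim⟩
  choose h hh using hex
  have himg : h '' (f '' s) = some '' (g '' s) := by
    ext z
    constructor
    · rintro ⟨_, ⟨a, ha, rfl⟩, rfl⟩
      exact ⟨g a, ⟨a, ha, rfl⟩, (hh _ a ha rfl).symm⟩
    · rintro ⟨_, ⟨a, ha, rfl⟩, rfl⟩
      exact ⟨f a, ⟨a, ha, rfl⟩, hh _ a ha rfl⟩
  have hcard : (g '' s).ncard = (hfin.toFinset.image h).card := by
    rw [← Set.ncard_image_of_injective (g '' s) (Option.some_injective γ), ← himg,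
      ← Set.ncard_coe_finset]
    simp
  rw [Set.ncard_eq_toFinset_card _ hfin, hcard, mul_comm,
    Finset.card_eq_sum_card_image h hfin.toFinset]
  refine Finset.sum_const_nat fun z hz => ?_
  obtain ⟨y, hy, rfl⟩ := Finset.mem_image.mp hz
  obtain ⟨a, ha, rfl⟩ := (Set.Finite.mem_toFinset hfin).mp hy
  rw [← hk a ha, ← Set.ncard_coe_finset]
  congr 1
  ext y
  simp only [Finset.coe_filter, Set.Finite.mem_toFinset, Set.mem_ofPred_eq, Set.mem_image]
  constructor
  · rintro ⟨⟨b, hb, rfl⟩, hy⟩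
    rw [hh _ b hb rfl, hh _ a ha rfl] at hy
    exact ⟨b, ⟨hb, Option.some_injective _ hy⟩, rfl⟩
  · rintro ⟨b, ⟨hb, hba⟩, rfl⟩
    exact ⟨⟨b, hb, rfl⟩, by rw [hh _ b hb rfl, hh _ a ha rfl, hba]⟩

theorem AddSubgroup.ncard_image_mk {G : Type*} [AddCommGroup G] (H K : AddSubgroup G) :
    ((QuotientAddGroup.mk : G → G ⧸ H) '' (K : Set G)).ncard = H.relIndex K := by
  have h := AddSubgroup.relIndex_ker K (QuotientAddGroup.mk' H)
  rw [QuotientAddGroup.ker_mk'] at h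
  rw [h, ← Nat.card_coe_set_eq]
  rfl

end Counting

/-! ### Discrete valuations with finite residue field -/

section DiscreteValuation

variable {F : Type*} [Field F] {w : Valuation F ℝ≥0} {ϖ : F}

/-- The elements of valuation at most `r`. -/
def Valuation.ball (w : Valuation F ℝ≥0) (r : ℝ≥0) : AddSubgroup F where
  carrier := {x | w x ≤ r}
  zero_mem' := by simp
  add_mem' ha hb := w.map_add_le ha hb
  neg_mem' {x} hx := by simpa using hx

@[simp]
theorem Valuation.mem_ball {r : ℝ≥0} {x : F} : x ∈ w.ball r ↔ w x ≤ r := Iff.rfl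

theorem Valuation.ball_mono {r s : ℝ≥0} (h : r ≤ s) : w.ball r ≤ w.ball s :=
  fun _ hx => le_trans hx h

theorem Valuation.mk_ball_eq {r : ℝ≥0} {x y : F} :
    (QuotientAddGroup.mk x : F ⧸ w.ball r) = QuotientAddGroup.mk y ↔ w (x - y) ≤ r := by
  rw [QuotientAddGroup.eq, Valuation.mem_ball, neg_add_eq_sub, Valuation.map_sub_swap]

/-- The cardinality of the residue field, if `ϖ` is a uniformizer. -/
def Valuation.residueCard (w : Valuation F ℝ≥0) (ϖ : F) : ℕ :=
  (w.ball (w ϖ)).relIndex (w.ball 1)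

/-- The valuation `w` is discrete with uniformizer `ϖ` and has finite residue field. -/
structure Valuation.IsLocal (w : Valuation F ℝ≥0) (ϖ : F) : Prop where
  ne_zero : ϖ ≠ 0
  lt_one : w ϖ < 1
  le_of_lt : ∀ x, w x < 1 → w x ≤ w ϖ
  card_ne_zero : w.residueCard ϖ ≠ 0

namespace Valuation.IsLocal

variable (h : w.IsLocal ϖ)

include h

theorem pos : 0 < w ϖ := by
  rw [pos_iff_ne_zero]
  simpa using h.ne_zero

/-- A value strictly between two consecutive powers of `w ϖ` would, after scaling by a power of `ϖ`,
lie strictly between `w ϖ` and `1`. -/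
theorem exists_zpow {x : F} (hx : x ≠ 0) : ∃ n : ℤ, w x = w ϖ ^ n := by
  have hx' : 0 < w x := by
    rw [pos_iff_ne_zero]
    simpa using hx
  obtain ⟨n, hn, hn'⟩ := exists_mem_Ico_zpow hx' (one_lt_inv₀ h.pos |>.mpr h.lt_one)
  refine ⟨-n, ?_⟩
  rw [inv_zpow, ← zpow_neg] at hn
  rw [inv_zpow, ← zpow_neg] at hn'
  refine le_antisymm ?_ hn
  by_contra! hlt
  have hp : 0 < w ϖ ^ (-(n + 1)) := zpow_pos h.pos _
  have h1 : w (x * ϖ ^ (n + 1)) < 1 := by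
    rw [map_mul, map_zpow₀]
    calc w x * w ϖ ^ (n + 1) < w ϖ ^ (-(n + 1)) * w ϖ ^ (n + 1) :=
          mul_lt_mul_of_pos_right hn' (zpow_pos h.pos _)
      _ = 1 := by rw [← zpow_add₀ h.pos.ne']; simp
  have h2 := h.le_of_lt _ h1
  rw [map_mul, map_zpow₀, zpow_add_one₀ h.pos.ne', ← mul_assoc] at h2
  have h3 : w x * w ϖ ^ n ≤ 1 := by
    by_contra! h4
    exact absurd h2 (not_le.mpr (lt_mul_of_one_lt_left h.pos h4))
  have h5 : w ϖ ^ (-n) * w ϖ ^ n < w x * w ϖ ^ n := mul_lt_mul_of_pos_right hlt (zpow_pos h.pos _)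
  rw [← zpow_add₀ h.pos.ne'] at h5
  simp only [neg_add_cancel, zpow_zero] at h5
  exact absurd h3 (not_le.mpr h5)

theorem exists_pow {x : F} (hx : x ≠ 0) (hx1 : w x ≤ 1) : ∃ n : ℕ, w x = w ϖ ^ n := by
  obtain ⟨n, hn⟩ := h.exists_zpow hx
  rcases le_or_gt 0 n with h0 | h0
  · lift n to ℕ using h0
    exact ⟨n, by simpa using hn⟩
  · exfalso
    rw [hn] at hx1
    exact absurd hx1 (not_le.mpr (one_lt_zpow_of_neg₀ h.pos h.lt_one h0))

theorem pow_le_pow_iff {m n : ℕ} : w ϖ ^ m ≤ w ϖ ^ n ↔ n ≤ m :=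
  pow_le_pow_iff_right_of_lt_one₀ h.pos h.lt_one

theorem pow_lt_pow_iff {m n : ℕ} : w ϖ ^ m < w ϖ ^ n ↔ n < m :=
  pow_lt_pow_iff_right_of_lt_one₀ h.pos h.lt_one

theorem pow_inj {m n : ℕ} : w ϖ ^ m = w ϖ ^ n ↔ m = n :=
  pow_right_inj₀ h.pos h.lt_one.ne

theorem lt_pow_iff {x : F} {n : ℕ} : w x < w ϖ ^ n ↔ w x ≤ w ϖ ^ (n + 1) := by
  constructor
  · intro hx
    have h1 : w (x / ϖ ^ n) < 1 := by
      rw [map_div₀, map_pow, div_lt_one₀ (pow_pos h.pos n)]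
      exact hx
    have h2 := h.le_of_lt _ h1
    rw [map_div₀, map_pow, div_le_iff₀ (pow_pos h.pos n)] at h2
    rwa [pow_succ']
  · intro hx
    exact hx.trans_lt (h.pow_lt_pow_iff.mpr n.lt_succ_self)

theorem lt_one_iff {x : F} : w x < 1 ↔ w x ≤ w ϖ := by
  simpa using h.lt_pow_iff (x := x) (n := 0)

/-- Multiplication by `ϖ ^ k` carries the unit ball and its maximal ideal to these two balls. -/
theorem relIndex_ball_succ (k : ℕ) :
    (w.ball (w ϖ ^ (k + 1))).relIndex (w.ball (w ϖ ^ k)) = w.residueCard ϖ := by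
  have hinj : Function.Injective (AddMonoidHom.mulLeft (ϖ ^ k)) := fun a b hab =>
    mul_left_cancel₀ (pow_ne_zero k h.ne_zero) hab
  have hmap : ∀ r, (w.ball r).map (AddMonoidHom.mulLeft (ϖ ^ k)) = w.ball (w ϖ ^ k * r) := by
    intro r
    ext x
    simp only [AddSubgroup.mem_map, mem_ball, AddMonoidHom.coe_mulLeft]
    constructor
    · rintro ⟨y, hy, rfl⟩
      rw [map_mul, map_pow]
      gcongr
    · intro hx
      refine ⟨x / ϖ ^ k, ?_, mul_div_cancel₀ _ (pow_ne_zero k h.ne_zero)⟩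
      rw [map_div₀, map_pow, div_le_iff₀ (pow_pos h.pos k)]
      rwa [mul_comm]
  have h1 := AddSubgroup.relIndex_map_map_of_injective (w.ball (w ϖ)) (w.ball 1) hinj
  rwa [hmap, hmap, mul_one, ← pow_succ] at h1

theorem relIndex_ball (k n : ℕ) :
    (w.ball (w ϖ ^ (k + n))).relIndex (w.ball (w ϖ ^ k)) = w.residueCard ϖ ^ n := by
  induction n with
  | zero => simp
  | succ n ih =>
    rw [pow_succ', ← ih, ← h.relIndex_ball_succ (k + n), ← add_assoc]
    refine (AddSubgroup.relIndex_mul_relIndex _ _ _ ?_ ?_).symm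
    · exact Valuation.ball_mono (h.pow_le_pow_iff.mpr (Nat.le_succ _))
    · exact Valuation.ball_mono (h.pow_le_pow_iff.mpr (Nat.le_add_right _ _))

theorem ncard_ball (k n : ℕ) :
    ((QuotientAddGroup.mk : F → F ⧸ w.ball (w ϖ ^ (k + n))) '' (w.ball (w ϖ ^ k) : Set F)).ncard =
      w.residueCard ϖ ^ n := by
  rw [AddSubgroup.ncard_image_mk, h.relIndex_ball]

theorem finite_image_ball (k n : ℕ) :
    ((QuotientAddGroup.mk : F → F ⧸ w.ball (w ϖ ^ n)) '' (w.ball (w ϖ ^ k) : Set F)).Finite := by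
  rcases le_total k n with hkn | hkn
  · obtain ⟨m, rfl⟩ := Nat.exists_eq_add_of_le hkn
    refine Set.finite_of_ncard_ne_zero ?_
    rw [h.ncard_ball]
    exact pow_ne_zero _ h.card_ne_zero
  · refine (Set.finite_singleton 0).subset ?_
    rintro _ ⟨x, hx, rfl⟩
    exact (QuotientAddGroup.eq_zero_iff x).mpr (le_trans hx (h.pow_le_pow_iff.mpr hkn))

theorem one_lt_card : 1 < w.residueCard ϖ := by
  refine lt_of_le_of_ne (Nat.one_le_iff_ne_zero.mpr h.card_ne_zero) fun h1 => ?_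
  have h2 := AddSubgroup.relIndex_eq_one.mp h1.symm (show (1 : F) ∈ w.ball 1 by simp)
  rw [mem_ball, map_one] at h2
  exact absurd h.lt_one (not_lt.mpr h2)

theorem ncard_sphere (k n : ℕ) :
    ((QuotientAddGroup.mk : F → F ⧸ w.ball (w ϖ ^ (k + (n + 1)))) '' {x | w x = w ϖ ^ k}).ncard =
      (w.residueCard ϖ - 1) * w.residueCard ϖ ^ n := by
  -- The sphere is a ball minus the next smaller one, and both are unions of classes.
  have hset : (QuotientAddGroup.mk : F → F ⧸ w.ball (w ϖ ^ (k + (n + 1)))) '' {x | w x = w ϖ ^ k} =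
      (QuotientAddGroup.mk : F → F ⧸ w.ball (w ϖ ^ (k + (n + 1)))) '' (w.ball (w ϖ ^ k) : Set F) \
      (QuotientAddGroup.mk : F → F ⧸ w.ball (w ϖ ^ (k + (n + 1)))) ''
        (w.ball (w ϖ ^ (k + 1)) : Set F) := by
    ext z
    constructor
    · rintro ⟨x, hx, rfl⟩
      refine ⟨⟨x, le_of_eq hx, rfl⟩, ?_⟩
      rintro ⟨y, hy, hxy⟩
      rw [mk_ball_eq] at hxy
      have h1 : w x ≤ w ϖ ^ (k + 1) := by
        have h2 : w (y - (y - x)) ≤ w ϖ ^ (k + 1) :=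
          w.map_sub_le hy (hxy.trans (h.pow_le_pow_iff.mpr (by lia)))
        simpa using h2
      rw [← h.lt_pow_iff] at h1
      exact h1.ne hx
    · rintro ⟨⟨x, hx, rfl⟩, hnot⟩
      refine ⟨x, ?_, rfl⟩
      refine le_antisymm hx (not_lt.mp fun hlt => hnot ⟨x, h.lt_pow_iff.mp hlt, rfl⟩)
  rw [hset, Set.ncard_sdiff (Set.image_mono (Valuation.ball_mono
    (h.pow_le_pow_iff.mpr (Nat.le_succ k)))) (h.finite_image_ball _ _), h.ncard_ball]
  have h1 := h.ncard_ball (k + 1) n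
  rw [show k + 1 + n = k + (n + 1) by ring] at h1
  rw [h1, pow_succ', Nat.sub_mul, one_mul]

/-- A self-map of the valuation ring that is injective on residue classes is surjective on them. -/
theorem exists_of_injective_residue {f : F → F} (hf : ∀ x, w x ≤ 1 → w (f x) ≤ 1)
    (hinj : ∀ x y, w x ≤ 1 → w y ≤ 1 → w (f x - f y) < 1 → w (x - y) < 1) {y : F} (hy : w y ≤ 1) :
    ∃ x, w x ≤ 1 ∧ w (f x - y) < 1 := by
  let π : F → F ⧸ w.ball (w ϖ) := QuotientAddGroup.mk
  have hfin : (π '' (w.ball 1 : Set F)).Finite := by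
    have := h.finite_image_ball 0 1
    rwa [pow_zero, pow_one] at this
  have hmaps : ∀ z ∈ π '' (w.ball 1 : Set F), π (f z.out) ∈ π '' (w.ball 1 : Set F) ∧
      w z.out ≤ 1 := by
    rintro _ ⟨x, hx, rfl⟩
    have h1 : w ((π x).out - x) ≤ w ϖ := mk_ball_eq.mp (Quotient.out_eq (π x))
    have h2 : w (π x).out ≤ 1 := by
      have := w.map_add_le (h1.trans h.lt_one.le) hx
      simpa using this
    exact ⟨⟨_, hf _ h2, rfl⟩, h2⟩
  have hcoe := hfin.coe_toFinset
  rw [← hcoe] at hmaps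
  have hsurj := Finset.surjOn_of_injOn_of_card_le (s := hfin.toFinset) (t := hfin.toFinset)
    (fun z => π (f z.out)) (fun z hz => (hmaps z hz).1) (fun z hz z' hz' hzz => by
      have h1 : w (f z.out - f z'.out) ≤ w ϖ := mk_ball_eq.mp hzz
      have h2 := hinj _ _ (hmaps z hz).2 (hmaps z' hz').2 (h1.trans_lt h.lt_one)
      have h3 : π z.out = π z'.out := mk_ball_eq.mpr (h.lt_one_iff.mp h2)
      rwa [show π z.out = z from Quotient.out_eq z,
        show π z'.out = z' from Quotient.out_eq z'] at h3) le_rfl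
  obtain ⟨z, hz, hzy⟩ := hsurj (hcoe.symm ▸ ⟨y, hy, rfl⟩ : π y ∈ _)
  exact ⟨z.out, (hmaps z hz).2, (mk_ball_eq.mp hzy).trans_lt h.lt_one⟩

/-- A self-map of the residue field that is surjective on residue classes is injective on them. -/
theorem injective_residue_of_exists {f : F → F} (hf : ∀ x, w x ≤ 1 → w (f x) ≤ 1)
    (hwell : ∀ x y, w x ≤ 1 → w y ≤ 1 → w (x - y) < 1 → w (f x - f y) < 1)
    (hsurj : ∀ y, w y ≤ 1 → ∃ x, w x ≤ 1 ∧ w (f x - y) < 1) {x y : F} (hx : w x ≤ 1)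
    (hy : w y ≤ 1) (hxy : w (f x - f y) < 1) : w (x - y) < 1 := by
  let π : F → F ⧸ w.ball (w ϖ) := QuotientAddGroup.mk
  have hπ : ∀ x y, π x = π y ↔ w (x - y) < 1 := fun x y => by
    rw [mk_ball_eq, h.lt_one_iff]
  have hfin : (π '' (w.ball 1 : Set F)).Finite := by
    have := h.finite_image_ball 0 1
    rwa [pow_zero, pow_one] at this
  have hout : ∀ x, w x ≤ 1 → w (π x).out ≤ 1 ∧ w ((π x).out - x) < 1 := by
    intro x hx
    have h1 : w ((π x).out - x) < 1 := (hπ _ _).mp (Quotient.out_eq (π x))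
    exact ⟨by simpa using w.map_add_le h1.le hx, h1⟩
  have key : ∀ x, w x ≤ 1 → π (f (π x).out) = π (f x) := fun x hx =>
    (hπ _ _).mpr (hwell _ _ (hout x hx).1 hx (hout x hx).2)
  have hinj := Finset.injOn_of_surjOn_of_card_le (s := hfin.toFinset) (t := hfin.toFinset)
    (fun z => π (f z.out))
    (by rw [hfin.coe_toFinset]; rintro _ ⟨x, hx, rfl⟩; exact ⟨f x, hf x hx, (key x hx).symm⟩)
    (by
      rw [hfin.coe_toFinset]
      rintro _ ⟨y, hy, rfl⟩
      obtain ⟨x, hx, hxy⟩ := hsurj y hy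
      exact ⟨π x, ⟨x, hx, rfl⟩, (key x hx).trans ((hπ _ _).mpr hxy)⟩) le_rfl
  rw [hfin.coe_toFinset] at hinj
  refine (hπ _ _).mp (hinj ⟨x, hx, rfl⟩ ⟨y, hy, rfl⟩ ?_)
  change π (f (π x).out) = π (f (π y).out)
  rw [key x hx, key y hy]
  exact (hπ _ _).mpr hxy

end Valuation.IsLocal

end DiscreteValuation

theorem Equiv.Perm.eq_of_ne_one_two {σ τ : Equiv.Perm (Fin 2)} (hσ : σ ≠ 1) (hτ : τ ≠ 1) :
    σ = τ := by
  decide +revert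

theorem Equiv.Perm.mul_eq_one_iff_two (σ τ : Equiv.Perm (Fin 2)) :
    σ * τ = 1 ↔ (σ = 1 ↔ τ = 1) := by
  decide +revert

/-! ### Quadratic characters and generators of quadratic extensions -/

section QuadraticCharacters

variable {F Ω : Type*} [Field F] [Field Ω] [Algebra F Ω]

namespace GalRep

/-- The element `α` generates the fixed field of the kernel of the quadratic character `φ`. -/
def IsGen (φ : GalRep F Ω (Equiv.Perm (Fin 2))) (α : Ω) : Prop :=
  ∀ σ, φ.toHom σ = 1 ↔ σ α = α

variable {φ ψ : GalRep F Ω (Equiv.Perm (Fin 2))} {α : Ω}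

theorem eq_of_forall_eq_one_iff (h : ∀ σ, φ.toHom σ = 1 ↔ ψ.toHom σ = 1) : φ = ψ := by
  ext1
  ext1 σ
  by_cases hσ : φ.toHom σ = 1
  · rw [hσ, (h σ).mp hσ]
  · exact Equiv.Perm.eq_of_ne_one_two hσ fun h' => hσ ((h σ).mpr h')

theorem map_mul_eq_one_iff (φ : GalRep F Ω (Equiv.Perm (Fin 2))) (σ τ : Gal(Ω/F)) :
    φ.toHom (σ * τ) = 1 ↔ (φ.toHom σ = 1 ↔ φ.toHom τ = 1) := by
  rw [map_mul, Equiv.Perm.mul_eq_one_iff_two]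

theorem map_inv_eq_one_iff (φ : GalRep F Ω (Equiv.Perm (Fin 2))) (σ : Gal(Ω/F)) :
    φ.toHom σ⁻¹ = 1 ↔ φ.toHom σ = 1 := by
  rw [map_inv, inv_eq_one]

/-- The element `x` lies in the fixed field of the kernel of `φ`. -/
def Fixes (φ : GalRep F Ω (Equiv.Perm (Fin 2))) (x : Ω) : Prop :=
  ∀ τ, φ.toHom τ = 1 → τ x = x

theorem IsGen.fixes (h : φ.IsGen α) : φ.Fixes α := fun τ hτ => (h τ).mp hτ

theorem Fixes.apply_eq {x : Ω} (hx : φ.Fixes x) {σ τ : Gal(Ω/F)} (hσ : φ.toHom σ ≠ 1)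
    (hτ : φ.toHom τ ≠ 1) : τ x = σ x := by
  have h1 := hx (σ⁻¹ * τ) (by rw [map_mul_eq_one_iff, map_inv_eq_one_iff]; simp [hσ, hτ])
  rw [AlgEquiv.mul_apply] at h1
  calc τ x = σ (σ⁻¹ (τ x)) := by rw [← AlgEquiv.mul_apply]; simp
    _ = σ x := by rw [h1]

theorem Fixes.apply_apply {x : Ω} (hx : φ.Fixes x) {σ τ : Gal(Ω/F)} (hσ : φ.toHom σ ≠ 1)
    (hτ : φ.toHom τ ≠ 1) : τ (σ x) = x :=
  hx (τ * σ) (by rw [map_mul_eq_one_iff]; simp [hσ, hτ])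

theorem Fixes.apply_apply' {x : Ω} (hx : φ.Fixes x) {σ τ : Gal(Ω/F)} (hσ : φ.toHom σ ≠ 1)
    (hτ : φ.toHom τ = 1) : τ (σ x) = σ x :=
  hx.apply_eq hσ (τ := τ * σ) (by rw [Ne, map_mul_eq_one_iff]; simp [hσ, hτ])

theorem Fixes.isGen {x : Ω} (hx : φ.Fixes x) {σ : Gal(Ω/F)} (hσ : φ.toHom σ ≠ 1)
    (hne : σ x ≠ x) : φ.IsGen x := fun τ =>
  ⟨hx τ, fun h => by_contra fun hτ => hne ((hx.apply_eq hσ hτ).symm.trans h)⟩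

theorem fixes_algebraMap (φ : GalRep F Ω (Equiv.Perm (Fin 2))) (a : F) :
    φ.Fixes (algebraMap F Ω a) := fun τ _ => τ.commutes a

theorem Fixes.sub {x y : Ω} (hx : φ.Fixes x) (hy : φ.Fixes y) : φ.Fixes (x - y) :=
  fun τ hτ => by rw [map_sub, hx τ hτ, hy τ hτ]

theorem Fixes.div {x y : Ω} (hx : φ.Fixes x) (hy : φ.Fixes y) : φ.Fixes (x / y) :=
  fun τ hτ => by rw [map_div₀, hx τ hτ, hy τ hτ]

variable [IsGalois F Ω]

theorem exists_algebraMap_eq {x : Ω} (h : ∀ σ : Gal(Ω/F), σ x = x) :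
    ∃ a : F, algebraMap F Ω a = x :=
  (InfiniteGalois.mem_range_algebraMap_iff_fixed x).mpr h

/-- The coefficients are the negated trace and the norm of `x`, which the whole Galois group fixes.
Nothing requires `x` to lie outside `F`. -/
theorem Fixes.exists_quadratic {x : Ω} (hx : φ.Fixes x) {σ : Gal(Ω/F)} (hσ : φ.toHom σ ≠ 1) :
    ∃ a b : F, x ^ 2 + algebraMap F Ω a * x + algebraMap F Ω b = 0 ∧
      σ x = -algebraMap F Ω a - x := by
  have h1 : ∃ a : F, algebraMap F Ω a = -(x + σ x) := exists_algebraMap_eq fun τ => by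
    by_cases hτ : φ.toHom τ = 1
    · rw [map_neg, map_add, hx τ hτ, hx.apply_apply' hσ hτ]
    · rw [map_neg, map_add, hx.apply_eq hσ hτ, hx.apply_apply hσ hτ, add_comm]
  have h2 : ∃ b : F, algebraMap F Ω b = x * σ x := exists_algebraMap_eq fun τ => by
    by_cases hτ : φ.toHom τ = 1
    · rw [map_mul, hx τ hτ, hx.apply_apply' hσ hτ]
    · rw [map_mul, hx.apply_eq hσ hτ, hx.apply_apply hσ hτ, mul_comm]
  obtain ⟨a, ha⟩ := h1
  obtain ⟨b, hb⟩ := h2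
  exact ⟨a, b, by rw [ha, hb]; ring, by rw [ha]; ring⟩

/-- Cramer's rule: `d` is the quotient of `x - σ x` by `α - σ α`. Both change sign under the
elements outside the kernel, so the quotient lies in `F`. -/
theorem IsGen.exists_coord (hα : φ.IsGen α) {σ : Gal(Ω/F)} (hσ : φ.toHom σ ≠ 1) {x : Ω}
    (hx : φ.Fixes x) : ∃ c d : F, x = algebraMap F Ω c + algebraMap F Ω d * α := by
  have hα' := hα.fixes
  have hne : α - σ α ≠ 0 := fun h => hσ ((hα σ).mpr (sub_eq_zero.mp h).symm)
  have h1 : ∃ d : F, algebraMap F Ω d = (x - σ x) / (α - σ α) := exists_algebraMap_eq fun τ => by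
    by_cases hτ : φ.toHom τ = 1
    · rw [map_div₀, map_sub, map_sub, hx τ hτ, hα' τ hτ, hx.apply_apply' hσ hτ,
        hα'.apply_apply' hσ hτ]
    · rw [map_div₀, map_sub, map_sub, hx.apply_eq hσ hτ, hα'.apply_eq hσ hτ,
        hx.apply_apply hσ hτ, hα'.apply_apply hσ hτ, ← neg_sub, ← neg_sub α, neg_div_neg_eq]
  obtain ⟨d, hd⟩ := h1
  have hd' : x - σ x = algebraMap F Ω d * (α - σ α) := by rw [hd, div_mul_cancel₀ _ hne]
  have h2 : ∃ c : F, algebraMap F Ω c = x - algebraMap F Ω d * α :=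
    exists_algebraMap_eq fun τ => by
      by_cases hτ : φ.toHom τ = 1
      · rw [map_sub, map_mul, hx τ hτ, hα' τ hτ, AlgEquiv.commutes]
      · rw [map_sub, map_mul, hx.apply_eq hσ hτ, hα'.apply_eq hσ hτ, AlgEquiv.commutes]
        linear_combination -hd'
  obtain ⟨c, hc⟩ := h2
  exact ⟨c, d, by rw [hc]; ring⟩

theorem exists_isGen {σ : Gal(Ω/F)} (hσ : φ.toHom σ ≠ 1) : ∃ α, φ.IsGen α := by
  have hopen : IsOpen (φ.toHom.ker : Set Gal(Ω/F)) := φ.isOpen_preimage {1}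
  have h := InfiniteGalois.fixingSubgroup_fixedField
    (⟨φ.toHom.ker, Subgroup.isClosed_of_isOpen _ hopen⟩ : ClosedSubgroup Gal(Ω/F))
  change (IntermediateField.fixedField φ.toHom.ker).fixingSubgroup = φ.toHom.ker at h
  have hσ' : σ ∉ (IntermediateField.fixedField φ.toHom.ker).fixingSubgroup := by
    rw [h]
    exact hσ
  rw [IntermediateField.mem_fixingSubgroup_iff] at hσ'
  push Not at hσ'
  obtain ⟨x, hx, hne⟩ := hσ'
  exact ⟨x, Fixes.isGen (fun τ hτ => hx ⟨τ, hτ⟩) hσ hne⟩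

omit [IsGalois F Ω] in
theorem root_apply {a b : F} {x : Ω}
    (h : x ^ 2 + algebraMap F Ω a * x + algebraMap F Ω b = 0) (σ : Gal(Ω/F)) :
    σ x = x ∨ σ x = -algebraMap F Ω a - x := by
  have h1 := congrArg σ h
  rw [map_add, map_add, map_pow, map_mul, AlgEquiv.commutes, AlgEquiv.commutes, map_zero] at h1
  have h2 : (σ x - x) * (σ x - (-algebraMap F Ω a - x)) = 0 := by linear_combination h1 - h
  rcases mul_eq_zero.mp h2 with h3 | h3
  · exact Or.inl (sub_eq_zero.mp h3)
  · exact Or.inr (sub_eq_zero.mp h3)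

open Classical in
/-- A separable quadratic polynomial gives rise to a quadratic character. -/
theorem exists_isGen_of_root {a b : F} {x : Ω}
    (h : x ^ 2 + algebraMap F Ω a * x + algebraMap F Ω b = 0)
    (hne : 2 * x + algebraMap F Ω a ≠ 0) : ∃ φ : GalRep F Ω (Equiv.Perm (Fin 2)), φ.IsGen x := by
  have hconj : -algebraMap F Ω a - x ≠ x := fun h' => hne (by linear_combination -h')
  let f : Gal(Ω/F) →* Equiv.Perm (Fin 2) :=
    { toFun := fun σ => if σ x = x then 1 else Equiv.swap 0 1
      map_one' := by simp
      map_mul' := fun σ τ => by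
        have hs : Equiv.swap (0 : Fin 2) 1 * Equiv.swap 0 1 = 1 := by decide
        rcases root_apply h τ with hτ | hτ <;> rcases root_apply h σ with hσ | hσ <;>
          simp [hτ, hσ, hconj, hs] }
  have hf : ∀ σ, f σ = 1 ↔ σ x = x := by
    intro σ
    have h01 : Equiv.swap (0 : Fin 2) 1 ≠ 1 := by decide
    change (if σ x = x then (1 : Equiv.Perm (Fin 2)) else Equiv.swap 0 1) = 1 ↔ _
    by_cases hσ : σ x = x <;> simp [hσ, h01]
  refine ⟨⟨f, continuous_of_isOpen_ker f ?_⟩, hf⟩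
  have : (f.ker : Set Gal(Ω/F)) = MulAction.stabilizer Gal(Ω/F) x := by
    ext σ
    exact hf σ
  rw [this]
  exact stabilizer_isOpen_of_isIntegral x

omit [IsGalois F Ω] in
open Polynomial in
theorem exists_root [IsSepClosed Ω] {a b : F} (hne : a ^ 2 - 4 * b ≠ 0) :
    ∃ x : Ω, x ^ 2 + algebraMap F Ω a * x + algebraMap F Ω b = 0 := by
  set A := algebraMap F Ω a
  set B := algebraMap F Ω b
  have hne' : A ^ 2 - 4 * B ≠ 0 := by
    have h1 : algebraMap F Ω (a ^ 2 - 4 * b) ≠ 0 := (_root_.map_ne_zero _).mpr hne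
    rwa [map_sub, map_mul, map_pow, map_ofNat] at h1
  let p : Polynomial Ω := C 1 * X ^ 2 + C A * X + C B
  have hdeg : p.degree = 2 := Polynomial.degree_quadratic one_ne_zero
  have hsep : p.Separable := by
    have hinv : C (A ^ 2 - 4 * B)⁻¹ * (C A ^ 2 - 4 * C B) = 1 := by
      have h4 : (4 : Polynomial Ω) = C 4 := (map_ofNat C 4).symm
      rw [h4, ← C_pow, ← C_mul, ← C_sub, ← C_mul, inv_mul_cancel₀ hne', C_1]
    have hder : derivative p = 2 * X + C A := by
      simp [p]
      exact one_add_one_eq_two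
    -- The Bézout relation (2X + A)² - 4p = A² - 4B, divided by the discriminant. It is valid in
    -- every characteristic.
    refine ⟨-4 * C (A ^ 2 - 4 * B)⁻¹, C (A ^ 2 - 4 * B)⁻¹ * (2 * X + C A), ?_⟩
    rw [hder]
    simp only [p, C_1]
    linear_combination hinv
  obtain ⟨x, hx⟩ := IsSepClosed.exists_root p (by rw [hdeg]; decide) hsep
  refine ⟨x, ?_⟩
  simpa [p] using hx

end GalRep

end QuadraticCharacters

/-! ### Unramified and ramified quadratic characters -/

section Classification

variable {F Ω : Type*} [Field F] [Field Ω] [Algebra F Ω]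

/-- The valuation `v` of `Ω` is Galois invariant over `F`, and its restriction to `F` is discrete
with uniformizer `ϖ` and has finite residue field. -/
structure Valuation.IsLocalOver (v : Valuation Ω ℝ≥0) (ϖ : F) : Prop where
  map_gal : ∀ (σ : Gal(Ω/F)) x, v (σ x) = v x
  isLocal : (v.comap (algebraMap F Ω)).IsLocal ϖ

namespace GalRep

/-- The quadratic character `φ` is nontrivial and unramified. -/
def IsUnram (v : Valuation Ω ℝ≥0) (φ : GalRep F Ω (Equiv.Perm (Fin 2))) : Prop :=
  (∃ σ, φ.toHom σ ≠ 1) ∧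
    ∃ α, φ.IsGen α ∧ v α ≤ 1 ∧ ∀ σ, φ.toHom σ ≠ 1 → v (σ α - α) = 1

/-- The quadratic character `φ` is nontrivial and ramified of exponent `n`. -/
def IsRam (v : Valuation Ω ℝ≥0) (ϖ : F) (φ : GalRep F Ω (Equiv.Perm (Fin 2))) (n : ℕ) : Prop :=
  (∃ σ, φ.toHom σ ≠ 1) ∧
    ∃ α, φ.IsGen α ∧ v α ^ 2 = v (algebraMap F Ω ϖ) ∧
      ∀ σ, φ.toHom σ ≠ 1 → v (σ α - α) = v α ^ n

end GalRep

namespace Valuation.IsLocalOver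

open GalRep

variable {v : Valuation Ω ℝ≥0} {ϖ : F} (H : v.IsLocalOver ϖ)
  {φ ψ : GalRep F Ω (Equiv.Perm (Fin 2))} {α : Ω}

include H

theorem pos : 0 < v (algebraMap F Ω ϖ) := H.isLocal.pos

theorem lt_one : v (algebraMap F Ω ϖ) < 1 := H.isLocal.lt_one

/-- Values of elements of `F` are integral powers of `v ϖ`, so a square has even exponent. -/
theorem sq_ne {a : F} : v (algebraMap F Ω a) ^ 2 ≠ v (algebraMap F Ω ϖ) := by
  intro h
  have ha : a ≠ 0 := by
    rintro rfl
    exact H.pos.ne (by simpa using h)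
  obtain ⟨k, hk⟩ := H.isLocal.exists_zpow ha
  simp only [Valuation.comap_apply] at hk
  rw [hk, ← zpow_natCast, ← zpow_mul] at h
  have h1 := zpow_right_injective₀ H.pos H.lt_one.ne (h.trans (zpow_one _).symm)
  push_cast at h1
  lia

theorem sq_mul_ne {a b : F} (hb : b ≠ 0) {π : Ω} (hπ : v π ^ 2 = v (algebraMap F Ω ϖ)) :
    v (algebraMap F Ω a) ≠ v (algebraMap F Ω b * π) := by
  intro h
  apply H.sq_ne (a := a / b)
  rw [map_div₀, map_div₀, h, map_mul, mul_div_cancel_left₀ _ (by simpa using hb), hπ]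

/-- Since σx - x = d(σα - α) and σα - α is a unit, `d` is at most as large as `x`, and then so is
`c`. In particular `1, α` is an integral basis. -/
theorem coord_le_of_unram (hα : v α ≤ 1) {σ : Gal(Ω/F)} (hσ : v (σ α - α) = 1) {c d : F} :
    v (algebraMap F Ω c) ≤ v (algebraMap F Ω c + algebraMap F Ω d * α) ∧
      v (algebraMap F Ω d) ≤ v (algebraMap F Ω c + algebraMap F Ω d * α) := by
  set x := algebraMap F Ω c + algebraMap F Ω d * α with hx
  have h1 : v (algebraMap F Ω d) ≤ v x := by
    have h2 : σ x - x = algebraMap F Ω d * (σ α - α) := by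
      rw [hx, map_add, map_mul, AlgEquiv.commutes, AlgEquiv.commutes]
      ring
    have h3 : v (σ x - x) ≤ v x := v.map_sub_le (H.map_gal σ x).le le_rfl
    rwa [h2, map_mul, hσ, mul_one] at h3
  refine ⟨?_, h1⟩
  have h4 : algebraMap F Ω c = x - algebraMap F Ω d * α := by rw [hx]; ring
  rw [h4]
  refine v.map_sub_le le_rfl ?_
  rw [map_mul]
  exact (mul_le_of_le_one_right' hα).trans h1

/-- The two summands have values of opposite parity in terms of `v α`, so they cannot cancel. -/
theorem coord_le_of_ram (hα : v α ^ 2 = v (algebraMap F Ω ϖ)) (c d : F) :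
    v (algebraMap F Ω c) ≤ v (algebraMap F Ω c + algebraMap F Ω d * α) ∧
      v (algebraMap F Ω d * α) ≤ v (algebraMap F Ω c + algebraMap F Ω d * α) := by
  by_cases hd : d = 0
  · simp [hd]
  · rcases lt_or_gt_of_ne (H.sq_mul_ne (a := c) hd hα) with h | h
    · rw [v.map_add_eq_of_lt_right h]
      exact ⟨h.le, le_rfl⟩
    · rw [v.map_add_eq_of_lt_left h]
      exact ⟨le_rfl, h.le⟩

/-- The smallest value of `F` above 1 is the inverse of `v ϖ`, which multiplication by `α`, of value
only the square root of `v ϖ`, does not bring down to 1. -/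
theorem le_one_of_mul_le_one (hα : v α ^ 2 = v (algebraMap F Ω ϖ)) {d : F}
    (hd : v (algebraMap F Ω d * α) ≤ 1) : v (algebraMap F Ω d) ≤ 1 := by
  by_contra! h
  have hd0 : d ≠ 0 := by
    rintro rfl
    simp at h
  have h1 : v (algebraMap F Ω d⁻¹) ≤ v (algebraMap F Ω ϖ) := by
    refine H.isLocal.le_of_lt _ ?_
    rw [Valuation.comap_apply, map_inv₀, map_inv₀]
    exact inv_lt_one_of_one_lt₀ h
  rw [map_inv₀, map_inv₀, inv_le_iff_one_le_mul₀ (zero_lt_one.trans h), ← hα, mul_comm] at h1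
  have h2 : (v (algebraMap F Ω d * α)) ^ 2 ≤ 1 := pow_le_one' hd 2
  rw [map_mul, mul_pow, pow_two (v (algebraMap F Ω d)), mul_assoc] at h2
  have h3 := lt_mul_of_one_lt_left (zero_lt_one.trans_le h1) h
  exact absurd h2 (not_le.mpr (h1.trans_lt h3))

/-- If the Galois action on the residue field of a quadratic extension is trivial, then the
residue field does not grow. -/
theorem exists_residue [IsGalois F Ω] {σ : Gal(Ω/F)} (hσ : φ.toHom σ ≠ 1) {x : Ω}
    (hx : φ.Fixes x) (hx1 : v x ≤ 1) (hlt : v (σ x - x) < 1) :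
    ∃ a : F, v (x - algebraMap F Ω a) < 1 := by
  obtain ⟨t, n, htn, hσx⟩ := hx.exists_quadratic hσ
  have hd : σ x - x = -algebraMap F Ω t - 2 * x := by rw [hσx]; ring
  have h21 : v (2 : Ω) ≤ 1 := by
    have := H.isLocal
    rw [← one_add_one_eq_two]
    exact v.map_add_le (by simp) (by simp)
  -- In residue characteristic two the trace of `x` is small, so x² is congruent to `-n`; squaring
  -- is injective, hence surjective, on the finite residue field, and a square root of `-n` in `F`
  -- approximates `x`. Otherwise half of the trace does.
  rcases h21.lt_or_eq with h2 | h2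
  · have ht : v (algebraMap F Ω t) < 1 := by
      have : algebraMap F Ω t = -(σ x - x) - 2 * x := by rw [hd]; ring
      rw [this]
      refine v.map_sub_lt (by rwa [Valuation.map_neg]) ?_
      rw [map_mul]
      exact (mul_le_of_le_one_right' hx1).trans_lt h2
    have hn : v (algebraMap F Ω n) ≤ 1 := by
      have : algebraMap F Ω n = -(x ^ 2) - algebraMap F Ω t * x := by linear_combination htn
      rw [this]
      refine v.map_sub_le ?_ ?_
      · rw [Valuation.map_neg, map_pow]
        exact pow_le_one' hx1 2
      · rw [map_mul]
        exact mul_le_one' ht.le hx1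
    have key : ∀ y z : Ω, v y ≤ 1 → v z ≤ 1 → v (y ^ 2 - z ^ 2) < 1 → v (y - z) < 1 := by
      intro y z hy hz hyz
      have h3 : (y - z) ^ 2 = (y ^ 2 - z ^ 2) - 2 * (z * (y - z)) := by ring
      have h4 : v ((y - z) ^ 2) < 1 := by
        rw [h3]
        refine v.map_sub_lt hyz ?_
        rw [map_mul]
        refine (mul_le_of_le_one_right' ?_).trans_lt h2
        rw [map_mul]
        exact mul_le_one' hz (v.map_sub_le hy hz)
      rw [map_pow] at h4
      exact lt_of_not_ge fun h5 => absurd h4 (not_lt.mpr (one_le_pow₀ h5))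
    obtain ⟨a, ha1, ha⟩ := H.isLocal.exists_of_injective_residue (f := fun a => a ^ 2)
      (fun a ha => by rw [map_pow]; exact pow_le_one' ha 2)
      (fun a b ha hb hab => by
        simp only [Valuation.comap_apply, _root_.map_sub, map_pow] at ha hb hab ⊢
        exact key _ _ ha hb hab) (y := -n) (by simpa using hn)
    refine ⟨a, key _ _ hx1 ha1 ?_⟩
    simp only [Valuation.comap_apply, _root_.map_sub, map_pow, _root_.map_neg] at ha
    have h5 : x ^ 2 - algebraMap F Ω a ^ 2 =
        -(algebraMap F Ω t * x) - (algebraMap F Ω a ^ 2 - -algebraMap F Ω n) := by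
      linear_combination htn
    rw [h5]
    refine v.map_sub_lt ?_ ha
    rw [Valuation.map_neg, map_mul]
    exact (mul_le_of_le_one_right' hx1).trans_lt ht
  · have h20 : (2 : Ω) ≠ 0 := fun h0 => by simp [h0] at h2
    refine ⟨-t / 2, ?_⟩
    have h3 : x - algebraMap F Ω (-t / 2) = -(σ x - x) / 2 := by
      rw [hd, map_div₀, _root_.map_neg, map_ofNat]
      field_simp
      ring
    rw [h3, map_div₀, Valuation.map_neg, h2, div_one]
    exact hlt

/-- If every integer is moved by less than 1, the residue field does not grow by `exists_residue`.
If the value group did not grow either, a generator could be approximated by `F` arbitrarily well,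
which is impossible because v(σα - α) bounds all distances from `α` to `F` below. So the value group
grows, which yields a uniformizer whose square has the value of `ϖ`. -/
theorem isUnram_or_isRam [IsGalois F Ω] {σ : Gal(Ω/F)} (hσ : φ.toHom σ ≠ 1) :
    φ.IsUnram v ∨ ∃ n, φ.IsRam v ϖ n := by
  by_cases hun : ∃ x, φ.Fixes x ∧ v x ≤ 1 ∧ 1 ≤ v (σ x - x)
  · obtain ⟨x, hx, hx1, hx2⟩ := hun
    have hx3 : v (σ x - x) = 1 := le_antisymm (v.map_sub_le (H.map_gal σ x ▸ hx1) hx1) hx2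
    refine Or.inl ⟨⟨σ, hσ⟩, x, hx.isGen hσ ?_, hx1, fun τ hτ => by rwa [hx.apply_eq hσ hτ]⟩
    intro h0
    simp [h0] at hx3
  right
  push Not at hun
  have hval : ∃ x, φ.Fixes x ∧ x ≠ 0 ∧ ∀ a : F, v x ≠ v (algebraMap F Ω a) := by
    by_contra! hall
    obtain ⟨α, hα⟩ := exists_isGen hσ
    have hne : σ α - α ≠ 0 := fun h => hσ ((hα σ).mpr (sub_eq_zero.mp h))
    have hfix : ∀ a : F, φ.Fixes (α - algebraMap F Ω a) := fun a =>
      hα.fixes.sub (φ.fixes_algebraMap a)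
    have hlow : ∀ a : F, v (σ α - α) ≤ v (α - algebraMap F Ω a) := by
      intro a
      have h1 : σ α - α = σ (α - algebraMap F Ω a) - (α - algebraMap F Ω a) := by
        rw [_root_.map_sub, AlgEquiv.commutes]
        ring
      rw [h1]
      exact v.map_sub_le (H.map_gal _ _).le le_rfl
    have hpos : 0 < v (σ α - α) := by
      rw [pos_iff_ne_zero]
      simpa using hne
    -- Successive approximation: `α - a` divided by an element `c` of the same value is a unit, its
    -- residue comes from some `b` in `F`, and `a + c * b` is strictly closer to `α`.
    have hapx : ∀ n : ℕ, ∃ a : F, v (α - algebraMap F Ω a) ≤ v (algebraMap F Ω ϖ) ^ n * v α := by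
      intro n
      induction n with
      | zero => exact ⟨0, by simp⟩
      | succ n ih =>
        obtain ⟨a, ha⟩ := ih
        have hne0 : ∀ a : F, α - algebraMap F Ω a ≠ 0 := fun a h0 => by
          have := hlow a
          rw [h0, map_zero] at this
          exact absurd hpos (not_lt.mpr this)
        obtain ⟨c, hc⟩ := hall _ (hfix a) (hne0 a)
        have hc0 : algebraMap F Ω c ≠ 0 := by
          intro h0
          rw [h0, map_zero, Valuation.zero_iff] at hc
          exact hne0 a hc
        have hvc : 0 < v (algebraMap F Ω c) := by
          rw [pos_iff_ne_zero]
          simpa using hc0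
        have hy : φ.Fixes ((α - algebraMap F Ω a) / algebraMap F Ω c) :=
          (hfix a).div (φ.fixes_algebraMap c)
        have hy1 : v ((α - algebraMap F Ω a) / algebraMap F Ω c) ≤ 1 := by
          rw [map_div₀, hc, div_self hvc.ne']
        obtain ⟨b, hb⟩ := H.exists_residue hσ hy hy1 (hun _ hy hy1)
        obtain ⟨c', hc'⟩ := hall _ (hfix (a + c * b)) (hne0 _)
        have h1 : v (α - algebraMap F Ω (a + c * b)) < v (algebraMap F Ω c) := by
          have h2 : α - algebraMap F Ω (a + c * b) =
              ((α - algebraMap F Ω a) / algebraMap F Ω c - algebraMap F Ω b) *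
                algebraMap F Ω c := by
            rw [map_add, map_mul]
            field_simp
            ring
          rw [h2, map_mul]
          exact mul_lt_of_lt_one_left hvc hb
        refine ⟨a + c * b, ?_⟩
        have h3 : v (algebraMap F Ω (c' / c)) ≤ v (algebraMap F Ω ϖ) := by
          refine H.isLocal.le_of_lt _ ?_
          rw [Valuation.comap_apply, map_div₀, map_div₀, div_lt_one₀ hvc, ← hc']
          exact h1
        rw [map_div₀, map_div₀, div_le_iff₀ hvc] at h3
        rw [hc', pow_succ', mul_assoc]
        refine h3.trans ?_
        rw [← hc]
        gcongr
    obtain ⟨n, hn⟩ : ∃ n : ℕ, v (algebraMap F Ω ϖ) ^ n * v α < v (σ α - α) := by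
      have h1 : Filter.Tendsto (fun n : ℕ => v (algebraMap F Ω ϖ) ^ n * v α) Filter.atTop
          (nhds (0 * v α)) :=
        (NNReal.tendsto_pow_atTop_nhds_zero_of_lt_one H.lt_one).mul_const _
      rw [zero_mul] at h1
      exact (h1.eventually_lt_const hpos).exists
    obtain ⟨a, ha⟩ := hapx n
    exact absurd (hlow a) (not_le.mpr (ha.trans_lt hn))
  obtain ⟨x, hx, hx0, hxa⟩ := hval
  obtain ⟨a, b, hab, hσx⟩ := hx.exists_quadratic hσ
  have hb : v x ^ 2 = v (algebraMap F Ω b) := by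
    have h1 : algebraMap F Ω b = x * σ x := by rw [hσx]; linear_combination hab
    rw [h1, map_mul, H.map_gal, pow_two]
  have hb0 : b ≠ 0 := by
    rintro rfl
    simp [hx0] at hb
  obtain ⟨k, hk⟩ := H.isLocal.exists_zpow hb0
  rw [Valuation.comap_apply, Valuation.comap_apply, ← hb] at hk
  obtain ⟨m, rfl | rfl⟩ := Int.even_or_odd' k
  · exfalso
    apply hxa (ϖ ^ m)
    rw [mul_comm, zpow_mul, zpow_ofNat] at hk
    rw [map_zpow₀, map_zpow₀]
    exact (pow_left_inj₀ zero_le zero_le two_ne_zero).mp hk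
  -- Here v(x)² is an odd power, with exponent 2m+1, of v(ϖ); dividing by ϖ^m leaves the exponent 1.
  · set π := x / algebraMap F Ω ϖ ^ m with hπ
    have hπfix : φ.Fixes π := hx.div (by
      rw [← map_zpow₀]
      exact φ.fixes_algebraMap _)
    have hπ2 : v π ^ 2 = v (algebraMap F Ω ϖ) := by
      rw [hπ, map_div₀, map_zpow₀, div_pow, hk, zpow_add₀ H.pos.ne', zpow_one, mul_comm 2,
        zpow_mul, zpow_ofNat, mul_div_cancel_left₀ _ (pow_ne_zero _ (zpow_ne_zero _ H.pos.ne'))]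
    have hπne : σ π ≠ π := by
      intro h0
      obtain ⟨a, ha⟩ := exists_algebraMap_eq (x := π) fun τ => by
        by_cases hτ : φ.toHom τ = 1
        · exact hπfix τ hτ
        · rw [hπfix.apply_eq hσ hτ, h0]
      rw [← ha] at hπ2
      exact H.sq_ne hπ2
    obtain ⟨a, b, hab, hσπ⟩ := hπfix.exists_quadratic hσ
    have hdisc : (σ π - π) ^ 2 = algebraMap F Ω (a ^ 2 - 4 * b) := by
      rw [hσπ, _root_.map_sub, map_mul, map_pow, map_ofNat]
      linear_combination 4 * hab
    have hπ1 : v π ≤ 1 := by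
      by_contra! h1
      have h2 : 1 < v π ^ 2 := one_lt_pow₀ h1 two_ne_zero
      rw [hπ2] at h2
      exact absurd h2 (not_lt.mpr H.lt_one.le)
    have hle : v (σ π - π) ≤ 1 := v.map_sub_le (by rwa [H.map_gal]) hπ1
    -- The exponent is read off from the discriminant, which lies in `F`: its value v(ϖ)^n is the
    -- square of v(π)^n.
    obtain ⟨n, hn⟩ := H.isLocal.exists_pow (x := a ^ 2 - 4 * b) (by
      intro h0
      rw [h0, map_zero, sq_eq_zero_iff, sub_eq_zero] at hdisc
      exact hπne hdisc) (by
      rw [Valuation.comap_apply, ← hdisc, map_pow]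
      exact pow_le_one' hle 2)
    refine ⟨n, ⟨σ, hσ⟩, π, hπfix.isGen hσ hπne, hπ2, fun τ hτ => ?_⟩
    rw [hπfix.apply_eq hσ hτ]
    rw [Valuation.comap_apply, Valuation.comap_apply, ← hdisc, map_pow, ← hπ2, ← pow_mul,
      mul_comm, pow_mul] at hn
    exact (pow_left_inj₀ zero_le zero_le two_ne_zero).mp hn

end Valuation.IsLocalOver

end Classification

/-! ### Integral closures and their prime ideals in terms of the valuation -/

section IntegersOfValuation

variable {R E Ω : Type*} [CommRing R] [Field E] [Field Ω] [Algebra R E] [Algebra R Ω]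
  [Algebra E Ω] [IsScalarTower R E Ω] {v : Valuation Ω ℝ≥0}

theorem isIntegral_iff_of_valuation (hR : ∀ x : Ω, IsIntegral R x ↔ v x ≤ 1) (x : E) :
    IsIntegral R x ↔ v (algebraMap E Ω x) ≤ 1 := by
  rw [← hR, isIntegral_algebraMap_iff (algebraMap E Ω).injective]

theorem intRing_le_one (hR : ∀ x : Ω, IsIntegral R x ↔ v x ≤ 1) (x : intRing R E) :
    v (algebraMap E Ω x) ≤ 1 :=
  (isIntegral_iff_of_valuation hR (x : E)).mp x.2

theorem intRing_dvd_iff (hR : ∀ x : Ω, IsIntegral R x ↔ v x ≤ 1) {x y : intRing R E} :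
    x ∣ y ↔ v (algebraMap E Ω y) ≤ v (algebraMap E Ω x) := by
  constructor
  · rintro ⟨z, rfl⟩
    rw [Subalgebra.coe_mul, map_mul, map_mul]
    exact mul_le_of_le_one_right' (intRing_le_one hR z)
  · intro h
    by_cases hx : x = 0
    · subst hx
      have hy : y = 0 := by simpa using h
      rw [hy]
    · have hx' : (x : E) ≠ 0 := by simpa using hx
      have hpos : 0 < v (algebraMap E Ω x) := by
        rw [pos_iff_ne_zero]
        simpa using hx'
      refine ⟨⟨(y : E) / x, (isIntegral_iff_of_valuation hR _).mpr ?_⟩, ?_⟩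
      · rw [map_div₀, map_div₀, div_le_one₀ hpos]
        exact h
      · ext
        simp [mul_div_cancel₀ _ hx']

theorem intRing_isUnit_iff (hR : ∀ x : Ω, IsIntegral R x ↔ v x ≤ 1) {x : intRing R E} :
    IsUnit x ↔ v (algebraMap E Ω x) = 1 := by
  rw [isUnit_iff_dvd_one, intRing_dvd_iff hR]
  simp only [OneMemClass.coe_one, map_one]
  exact ⟨fun h => le_antisymm (intRing_le_one hR x) h, fun h => h.ge⟩

/-- The Jacobson radical consists of the `x` for which all `x * y + 1` are units. This fails for a
unit `x` with `y` its negative inverse, and holds if `v x < 1` by the ultrametric inequality. -/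
theorem mem_primeIdeal_iff (hR : ∀ x : Ω, IsIntegral R x ↔ v x ≤ 1) {x : intRing R E} :
    x ∈ primeIdeal R E ↔ v (algebraMap E Ω x) < 1 := by
  rw [primeIdeal, Ideal.mem_jacobson_bot]
  constructor
  · intro h
    refine lt_of_le_of_ne (intRing_le_one hR x) fun h1 => ?_
    obtain ⟨y, hy⟩ := ((intRing_isUnit_iff hR).mpr h1).exists_right_inv
    have h2 := h (-y)
    rw [mul_neg, hy, neg_add_cancel] at h2
    exact not_isUnit_zero h2
  · intro h y
    rw [intRing_isUnit_iff hR]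
    simp only [Subalgebra.coe_add, Subalgebra.coe_mul, OneMemClass.coe_one, map_add, map_mul,
      map_one]
    have h1 : v (algebraMap E Ω x * algebraMap E Ω y) < v 1 := by
      rw [map_mul, map_one]
      exact (mul_le_of_le_one_right' (intRing_le_one hR y)).trans_lt h
    rw [Valuation.map_add_eq_of_lt_right v h1, map_one]

theorem mem_primeIdeal_pow_iff (hR : ∀ x : Ω, IsIntegral R x ↔ v x ≤ 1) {ϖ : E}
    (h1 : v (algebraMap E Ω ϖ) < 1)
    (h2 : ∀ x : E, v (algebraMap E Ω x) < 1 → v (algebraMap E Ω x) ≤ v (algebraMap E Ω ϖ))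
    (n : ℕ) {x : intRing R E} :
    x ∈ primeIdeal R E ^ n ↔ v (algebraMap E Ω x) ≤ v (algebraMap E Ω ϖ) ^ n := by
  let p : intRing R E := ⟨ϖ, (isIntegral_iff_of_valuation hR _).mpr h1.le⟩
  have hp : primeIdeal R E = Ideal.span {p} := by
    ext y
    rw [mem_primeIdeal_iff hR, Ideal.mem_span_singleton, intRing_dvd_iff hR]
    exact ⟨h2 _, fun h => h.trans_lt h1⟩
  rw [hp, Ideal.span_singleton_pow, Ideal.mem_span_singleton, intRing_dvd_iff hR]
  simp [p]

end IntegersOfValuation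

/-! ### The Artin conductor of a representation in S₂ -/

section Codimension

/-- The permutation representation of `S₂`. -/
abbrev permRep : Representation ℂ (Equiv.Perm (Fin 2)) (MonoidAlgebra ℂ (Fin 2)) :=
  Representation.ofMulAction ℂ (Equiv.Perm (Fin 2)) (Fin 2)

theorem finrank_permRep : Module.finrank ℂ (MonoidAlgebra ℂ (Fin 2)) = 2 := by
  let e : MonoidAlgebra ℂ (Fin 2) ≃ₗ[ℂ] (Fin 2 →₀ ℂ) :=
    { MonoidAlgebra.coeffEquiv with
      map_add' := fun _ _ => rfl
      map_smul' := fun _ _ => rfl }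
  rw [e.finrank_eq]
  simp

theorem finrank_invariants_bot :
    Module.finrank ℂ (Representation.invariants
      (permRep.comp (⊥ : Subgroup (Equiv.Perm (Fin 2))).subtype)) = 2 := by
  have h : Representation.invariants
      (permRep.comp (⊥ : Subgroup (Equiv.Perm (Fin 2))).subtype) = ⊤ := by
    rw [eq_top_iff]
    rintro x -
    rw [Representation.mem_invariants]
    rintro ⟨g, hg⟩
    rw [Subgroup.mem_bot] at hg
    subst hg
    simp
  rw [h, finrank_top, finrank_permRep]

theorem finrank_invariants_top :
    Module.finrank ℂ (Representation.invariants
      (permRep.comp (⊤ : Subgroup (Equiv.Perm (Fin 2))).subtype)) = 1 := by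
  have h : Representation.invariants
      (permRep.comp (⊤ : Subgroup (Equiv.Perm (Fin 2))).subtype) =
        Submodule.span ℂ
          {MonoidAlgebra.ofCoeff (Finsupp.equivFunOnFinite.symm (fun _ : Fin 2 => (1 : ℂ)))} := by
    ext x
    rw [Representation.mem_invariants, Submodule.mem_span_singleton]
    constructor
    · intro hx
      have h1 := congrArg (fun y => y.coeff 0) (hx ⟨Equiv.swap 0 1, trivial⟩)
      simp only [MonoidHom.comp_apply, Subgroup.subtype_apply, permRep,
        Representation.coeff_ofMulAction] at h1
      refine ⟨x.coeff 0, ?_⟩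
      ext i
      fin_cases i
      · simp
      · simpa using h1.symm
    · rintro ⟨c, rfl⟩ g
      ext i
      simp [permRep, Representation.coeff_ofMulAction]
  rw [h, finrank_span_singleton]
  intro h0
  have := congrArg (fun y => y.coeff 0) h0
  simp at this

theorem Subgroup.eq_bot_or_eq_top_perm_two (H : Subgroup (Equiv.Perm (Fin 2))) :
    ((∃ g ∈ H, g ≠ 1) ∧ H = ⊤) ∨ ((¬ ∃ g ∈ H, g ≠ 1) ∧ H = ⊥) := by
  by_cases h : ∃ g ∈ H, g ≠ 1
  · refine Or.inl ⟨h, ?_⟩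
    obtain ⟨g, hg, hg1⟩ := h
    rw [eq_top_iff]
    rintro x -
    by_cases hx : x = 1
    · rw [hx]
      exact one_mem H
    · rwa [Equiv.Perm.eq_of_ne_one_two hx hg1]
  · refine Or.inr ⟨h, ?_⟩
    push Not at h
    rw [eq_bot_iff]
    exact fun x hx => h x hx

/-- A nontrivial ramification image is all of S₂, and then so is the image of inertia: the index
ratio is 1 and the codimension is 2 - 1. The conductor therefore just counts the nontrivial lower
ramification images. -/
theorem symmetricCount_two_eq {R F Ω : Type*} [CommRing R] [Field F] [Field Ω] [Algebra R F]
    [Algebra R Ω] [Algebra F Ω] [IsScalarTower R F Ω] [Normal F Ω]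
    (φ : GalRep F Ω (Equiv.Perm (Fin 2))) (n : ℕ)
    (h : ∀ i, (∃ σ, φ.toHom σ ≠ 1 ∧
      AlgEquiv.restrictNormalHom φ.kerField σ ∈ ramificationGroup R F φ.kerField i) ↔ i < n) :
    symmetricCount R 2 φ = n := by
  have himg : ∀ i, (∃ g ∈ φ.ramificationImage R i, g ≠ 1) ↔ i < n := by
    intro i
    rw [← h i]
    constructor
    · rintro ⟨_, ⟨σ, hσ, rfl⟩, hne⟩
      exact ⟨σ, hne, hσ⟩
    · rintro ⟨σ, hne, hσ⟩
      exact ⟨_, ⟨σ, hσ, rfl⟩, hne⟩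
  have hterm : ∀ i, (Nat.card (φ.ramificationImage R i) : ℚ) /
      Nat.card (φ.ramificationImage R 0) * ((Module.finrank ℂ (MonoidAlgebra ℂ (Fin 2)) : ℚ) -
        Module.finrank ℂ (Representation.invariants
          (permRep.comp (φ.ramificationImage R i).subtype))) = if i < n then 1 else 0 := by
    intro i
    have hV : (Module.finrank ℂ (MonoidAlgebra ℂ (Fin 2)) : ℚ) = 2 := by
      rw [finrank_permRep]
      rfl
    split_ifs with hi
    · have h0 : φ.ramificationImage R 0 = ⊤ := by
        rcases Subgroup.eq_bot_or_eq_top_perm_two (φ.ramificationImage R 0) with ⟨-, h1⟩ | ⟨h1, -⟩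
        · exact h1
        · exact absurd ((himg 0).mpr (by lia)) h1
      have hi : φ.ramificationImage R i = ⊤ := by
        rcases Subgroup.eq_bot_or_eq_top_perm_two (φ.ramificationImage R i) with ⟨-, h1⟩ | ⟨h1, -⟩
        · exact h1
        · exact absurd ((himg i).mpr hi) h1
      rw [h0, hi, hV, finrank_invariants_top, div_self (by simp)]
      norm_num
    · have hi : φ.ramificationImage R i = ⊥ := by
        rcases Subgroup.eq_bot_or_eq_top_perm_two (φ.ramificationImage R i) with ⟨h1, -⟩ | ⟨-, h1⟩
        · exact absurd ((himg i).mp h1) hi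
        · exact h1
      rw [hi, hV, finrank_invariants_bot]
      simp
  rw [symmetricCount, artinConductor, finsum_congr hterm,
    finsum_eq_sum_of_support_subset _ (s := Finset.range n) (by intro i; simp),
    Finset.sum_congr rfl fun i hi => if_pos (Finset.mem_range.mp hi)]
  simp

end Codimension

/-! ### Fixed fields of quadratic characters -/

section FixedFields

variable {F Ω : Type*} [Field F] [Field Ω] [Algebra F Ω] {φ : GalRep F Ω (Equiv.Perm (Fin 2))}

theorem GalRep.mem_kerField_iff {x : Ω} : x ∈ φ.kerField ↔ φ.Fixes x :=
  ⟨fun h τ hτ => h ⟨τ, hτ⟩, fun h τ => h τ.1 τ.2⟩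

theorem Equiv.Perm.apply_eq_self_iff_two (σ : Equiv.Perm (Fin 2)) (j : Fin 2) :
    σ j = j ↔ σ = 1 := by
  decide +revert

theorem GalRep.mem_stab_iff {j : Fin 2} {σ : Gal(Ω/F)} : σ ∈ φ.stab j ↔ φ.toHom σ = 1 :=
  Equiv.Perm.apply_eq_self_iff_two _ j

theorem GalRep.mem_pointField_iff {j : Fin 2} {x : Ω} : x ∈ φ.pointField j ↔ φ.Fixes x :=
  ⟨fun h τ hτ => h ⟨τ, mem_stab_iff.mpr hτ⟩, fun h τ => h τ.1 (mem_stab_iff.mp τ.2)⟩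

end FixedFields

/-! ### Conductors of unramified and ramified characters -/

section Conductor

variable {R F Ω : Type*} [CommRing R] [Field F] [Field Ω] [Algebra R F] [Algebra R Ω]
  [Algebra F Ω] [IsScalarTower R F Ω] {v : Valuation Ω ℝ≥0}
  {ϖ : F} {φ : GalRep F Ω (Equiv.Perm (Fin 2))} {α : Ω}

namespace Valuation.IsLocalOver

open GalRep

theorem le_of_lt_of_unram (H : v.IsLocalOver ϖ) (hα : v α ≤ 1) {σ : Gal(Ω/F)}
    (hσ : v (σ α - α) = 1) {c d : F}
    (h : v (algebraMap F Ω c + algebraMap F Ω d * α) < 1) :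
    v (algebraMap F Ω c + algebraMap F Ω d * α) ≤ v (algebraMap F Ω ϖ) := by
  obtain ⟨hc, hd⟩ := H.coord_le_of_unram hα hσ (c := c) (d := d)
  refine v.map_add_le (H.isLocal.le_of_lt _ (hc.trans_lt h)) ?_
  rw [map_mul]
  exact (mul_le_of_le_one_right' hα).trans (H.isLocal.le_of_lt _ (hd.trans_lt h))

theorem lt_one_of_sq (H : v.IsLocalOver ϖ) (hα : v α ^ 2 = v (algebraMap F Ω ϖ)) : v α < 1 := by
  by_contra! h1
  have h2 : 1 ≤ v α ^ 2 := one_le_pow₀ h1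
  rw [hα] at h2
  exact absurd H.lt_one (not_lt.mpr h2)

theorem pos_of_sq (H : v.IsLocalOver ϖ) (hα : v α ^ 2 = v (algebraMap F Ω ϖ)) : 0 < v α := by
  rw [pos_iff_ne_zero]
  intro h0
  rw [h0] at hα
  exact H.pos.ne (by simpa using hα)

theorem le_of_sq (H : v.IsLocalOver ϖ) (hα : v α ^ 2 = v (algebraMap F Ω ϖ)) :
    v (algebraMap F Ω ϖ) ≤ v α := by
  rw [← hα, pow_two]
  exact mul_le_of_le_one_right' (H.lt_one_of_sq hα).le

theorem le_of_lt_of_ram (H : v.IsLocalOver ϖ) (hα : v α ^ 2 = v (algebraMap F Ω ϖ)) {c d : F}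
    (h : v (algebraMap F Ω c + algebraMap F Ω d * α) < 1) :
    v (algebraMap F Ω c + algebraMap F Ω d * α) ≤ v α := by
  obtain ⟨hc, hd⟩ := H.coord_le_of_ram hα c d
  refine v.map_add_le ((H.isLocal.le_of_lt _ (hc.trans_lt h)).trans (H.le_of_sq hα)) ?_
  rw [map_mul]
  exact mul_le_of_le_one_left' (H.le_one_of_mul_le_one hα (hd.trans_lt h).le)

variable [IsGalois F Ω]

theorem symmetricCount_trivial (R : Type*) [CommRing R] [Algebra R F] [Algebra R Ω]
    [IsScalarTower R F Ω] (hφ : ∀ σ, φ.toHom σ = 1) : symmetricCount R 2 φ = 0 := by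
  have := symmetricCount_two_eq (R := R) φ 0 fun i => by simp [hφ]
  simpa using this

theorem symmetricCount_unram (hR : ∀ x : Ω, IsIntegral R x ↔ v x ≤ 1) (hφ : φ.IsUnram v) :
    symmetricCount R 2 φ = 0 := by
  obtain ⟨-, α, hα, hα1, hun⟩ := hφ
  have := symmetricCount_two_eq (R := R) φ 0 fun i => by
    simp only [not_lt_zero, iff_false, not_exists, not_and]
    intro σ hσ hmem
    obtain ⟨y, hy, hyα⟩ := hmem ⟨⟨α, mem_kerField_iff.mpr hα.fixes⟩,
      (isIntegral_iff_of_valuation (Ω := Ω) hR _).mpr hα1⟩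
    have h1 := (mem_primeIdeal_iff hR).mp (Ideal.pow_le_self i.succ_ne_zero hy)
    have h2 := congrArg (algebraMap φ.kerField Ω) hyα
    rw [_root_.map_sub] at h2
    have h3 := AlgEquiv.restrictNormal_commutes σ φ.kerField
      ⟨α, mem_kerField_iff.mpr hα.fixes⟩
    have h4 : algebraMap φ.kerField Ω y = σ α - α := h2.trans (congrArg (· - α) h3)
    rw [h4, hun σ hσ] at h1
    exact lt_irrefl _ h1
  simpa using this

/-- As α is a uniformizer and an integral x = c + dα has integral `d`, the identity σx - x = d(σα -
α) shows that a σ with nontrivial image lies in the i-th ramification group exactly when v(α)^n ≤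
v(α)^(i+1), that is, when i < n. -/
theorem symmetricCount_ram (H : v.IsLocalOver ϖ) (hR : ∀ x : Ω, IsIntegral R x ↔ v x ≤ 1) {n : ℕ}
    (hφ : φ.IsRam v ϖ n) : symmetricCount R 2 φ = n := by
  obtain ⟨⟨σ₀, hσ₀⟩, α, hα, hα2, hram⟩ := hφ
  have hα1 := H.lt_one_of_sq hα2
  have hαE : α ∈ φ.kerField := mem_kerField_iff.mpr hα.fixes
  have hpow := fun i x => mem_primeIdeal_pow_iff (E := φ.kerField) hR (ϖ := ⟨α, hαE⟩) hα1
    (fun x hx => by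
      obtain ⟨c, d, hcd⟩ := hα.exists_coord hσ₀ (mem_kerField_iff.mp x.2)
      change v (x : Ω) < 1 at hx
      change v (x : Ω) ≤ v α
      rw [hcd] at hx ⊢
      exact H.le_of_lt_of_ram hα2 hx) i (x := x)
  refine symmetricCount_two_eq φ n fun i => ⟨?_, fun hi => ⟨σ₀, hσ₀, ?_⟩⟩
  · rintro ⟨σ, hσ, hmem⟩
    obtain ⟨y, hy, hyα⟩ := hmem ⟨⟨α, hαE⟩, (isIntegral_iff_of_valuation (Ω := Ω) hR _).mpr hα1.le⟩
    have h2 := congrArg (algebraMap φ.kerField Ω) hyα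
    rw [_root_.map_sub] at h2
    have h4 : algebraMap φ.kerField Ω y = σ α - α :=
      h2.trans (congrArg (· - α) (AlgEquiv.restrictNormal_commutes σ φ.kerField ⟨α, hαE⟩))
    rw [hpow, h4, hram σ hσ] at hy
    exact (pow_le_pow_iff_right_of_lt_one₀ (H.pos_of_sq hα2) hα1).mp hy
  · intro x
    have hx1 := intRing_le_one hR x
    obtain ⟨c, d, hcd⟩ := hα.exists_coord hσ₀ (mem_kerField_iff.mp (x : φ.kerField).2)
    have h3 : algebraMap φ.kerField Ω
        (AlgEquiv.restrictNormalHom φ.kerField σ₀ (x : φ.kerField) - (x : φ.kerField)) =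
          algebraMap F Ω d * (σ₀ α - α) := by
      rw [_root_.map_sub]
      have h4 := AlgEquiv.restrictNormal_commutes σ₀ φ.kerField (x : φ.kerField)
      change algebraMap φ.kerField Ω (AlgEquiv.restrictNormalHom φ.kerField σ₀ x) =
        σ₀ ((x : φ.kerField) : Ω) at h4
      change _ - ((x : φ.kerField) : Ω) = _
      rw [h4, hcd, map_add, map_mul, AlgEquiv.commutes, AlgEquiv.commutes]
      ring
    have hd : v (algebraMap F Ω d) ≤ 1 := by
      refine H.le_one_of_mul_le_one hα2 ((H.coord_le_of_ram hα2 c d).2.trans ?_)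
      rw [← hcd]
      exact hx1
    have h5 : v (algebraMap F Ω d * (σ₀ α - α)) ≤ v α ^ (i + 1) := by
      rw [map_mul, hram σ₀ hσ₀]
      refine (mul_le_of_le_one_left' hd).trans ?_
      exact (pow_le_pow_iff_right_of_lt_one₀ (H.pos_of_sq hα2) hα1).mpr hi
    refine ⟨⟨_, (isIntegral_iff_of_valuation (Ω := Ω) hR _).mpr ?_⟩, (hpow _ _).mpr ?_, rfl⟩
    · rw [h3]
      exact h5.trans (pow_le_one' hα1.le _)
    · change v (algebraMap φ.kerField Ω
        (AlgEquiv.restrictNormalHom φ.kerField σ₀ (x : φ.kerField) - (x : φ.kerField))) ≤ _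
      rw [h3]
      exact h5

end Valuation.IsLocalOver

end Conductor

/-! ### Discriminants of quadratic extensions -/

section Discriminant

variable {R F Ω : Type*} [CommRing R] [Field F] [Field Ω] [Algebra R F] [Algebra R Ω]
  [Algebra F Ω] [IsScalarTower R F Ω] [IsGalois F Ω] {v : Valuation Ω ℝ≥0}
  {ϖ : F} {φ : GalRep F Ω (Equiv.Perm (Fin 2))} {α : Ω} {E : IntermediateField F Ω}

open GalRep

namespace GalRep.IsGen

theorem exists_basis (hα : φ.IsGen α) {σ : Gal(Ω/F)} (hσ : φ.toHom σ ≠ 1)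
    (hE : ∀ x, x ∈ E ↔ φ.Fixes x) :
    ∃ B : Module.Basis (Fin 2) F E, (B 0 : Ω) = 1 ∧ (B 1 : Ω) = α := by
  let a : E := ⟨α, (hE α).mpr hα.fixes⟩
  have hli : LinearIndependent F ![(1 : E), a] := by
    rw [LinearIndependent.pair_iff]
    intro s t hst
    have h1 : algebraMap F Ω s + algebraMap F Ω t * α = 0 := by
      have := congrArg (algebraMap E Ω) hst
      simpa [Algebra.smul_def, a] using this
    have h2 := congrArg σ h1
    rw [map_add, map_mul, AlgEquiv.commutes, AlgEquiv.commutes, map_zero] at h2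
    have hne : σ α - α ≠ 0 := fun h => hσ ((hα σ).mpr (sub_eq_zero.mp h))
    have ht : t = 0 := by
      have h3 : algebraMap F Ω t * (σ α - α) = 0 := by linear_combination h2 - h1
      simpa [hne] using h3
    subst ht
    simpa using h1
  have hspan : ⊤ ≤ Submodule.span F (Set.range ![(1 : E), a]) := by
    rintro x -
    obtain ⟨c, d, hcd⟩ := hα.exists_coord hσ ((hE x).mp x.2)
    rw [Matrix.range_cons, Matrix.range_cons, Matrix.range_empty, Set.union_empty,
      Set.singleton_union, Submodule.mem_span_pair]
    refine ⟨c, d, ?_⟩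
    apply Subtype.ext
    rw [hcd]
    simp [Algebra.smul_def, a]
  refine ⟨Module.Basis.mk hli hspan, ?_, ?_⟩
  · simp
  · simp [a]

theorem finrank_eq_two (hα : φ.IsGen α) {σ : Gal(Ω/F)} (hσ : φ.toHom σ ≠ 1)
    (hE : ∀ x, x ∈ E ↔ φ.Fixes x) : Module.finrank F E = 2 := by
  obtain ⟨B, -, -⟩ := hα.exists_basis hσ hE
  rw [Module.finrank_eq_card_basis B, Fintype.card_fin]

end GalRep.IsGen

omit [IsGalois F Ω] in
theorem basis_repr_eq {B : Module.Basis (Fin 2) F E} (h0 : (B 0 : Ω) = 1) (h1 : (B 1 : Ω) = α)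
    {x : E} {c d : F} (hx : (x : Ω) = algebraMap F Ω c + algebraMap F Ω d * α) :
    B.repr x 0 = c ∧ B.repr x 1 = d := by
  have h2 : x = c • B 0 + d • B 1 := by
    apply Subtype.ext
    rw [hx]
    simp [Algebra.smul_def, h0, h1]
  rw [h2]
  simp

omit [IsGalois F Ω] in
theorem leftMulMatrix_quadratic {B : Module.Basis (Fin 2) F E} (h0 : (B 0 : Ω) = 1)
    (h1 : (B 1 : Ω) = α) {a b : F} (hab : α ^ 2 + algebraMap F Ω a * α + algebraMap F Ω b = 0)
    {x : E} {c d : F} (hx : (x : Ω) = algebraMap F Ω c + algebraMap F Ω d * α) :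
    Algebra.leftMulMatrix B x = !![c, -(d * b); d, c - d * a] := by
  have h2 := basis_repr_eq h0 h1 (x := x * B 0) (c := c) (d := d) (by simp [h0, hx])
  have h3 := basis_repr_eq h0 h1 (x := x * B 1) (c := -(d * b)) (d := c - d * a) (by
    simp only [MulMemClass.coe_mul, h1, hx, map_sub, map_neg, map_mul]
    linear_combination algebraMap F Ω d * hab)
  ext i j
  rw [Algebra.leftMulMatrix_eq_repr_mul]
  fin_cases i <;> fin_cases j <;> simp [h2.1, h2.2, h3.1, h3.2]

theorem GalRep.IsGen.trace_norm (hα : φ.IsGen α) {σ : Gal(Ω/F)} (hσ : φ.toHom σ ≠ 1)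
    (hE : ∀ x, x ∈ E ↔ φ.Fixes x) (x : E) :
    algebraMap F Ω (Algebra.trace F E x) = x + σ x ∧
      algebraMap F Ω (Algebra.norm F x) = x * σ x := by
  obtain ⟨B, h0, h1⟩ := hα.exists_basis hσ hE
  obtain ⟨a, b, hab, hσα⟩ := hα.fixes.exists_quadratic hσ
  obtain ⟨c, d, hcd⟩ := hα.exists_coord hσ ((hE x).mp x.2)
  have hM := leftMulMatrix_quadratic h0 h1 hab hcd
  rw [Algebra.trace_eq_matrix_trace B, Algebra.norm_eq_matrix_det B, hM, Matrix.trace_fin_two,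
    Matrix.det_fin_two, hcd]
  simp only [Matrix.of_apply, Matrix.cons_val', Matrix.cons_val_zero, Matrix.cons_val_one,
    Matrix.cons_val_fin_one, map_add, map_mul, map_sub, map_neg, AlgEquiv.commutes, hσα]
  constructor
  · ring
  · linear_combination (algebraMap F Ω d ^ 2) * hab

/-- The discriminant is the squared determinant of the matrix of conjugates; here it comes from the
trace x + σx. -/
theorem GalRep.IsGen.discr_eq (hα : φ.IsGen α) {σ : Gal(Ω/F)} (hσ : φ.toHom σ ≠ 1)
    (hE : ∀ x, x ∈ E ↔ φ.Fixes x) (b : Fin 2 → E) :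
    algebraMap F Ω (Algebra.discr F b) = ((b 0 : Ω) * σ (b 1) - b 1 * σ (b 0)) ^ 2 := by
  have ht := fun x => (hα.trace_norm hσ hE x).1
  rw [Algebra.discr_def, Matrix.det_fin_two]
  simp only [Algebra.traceMatrix_apply, Algebra.traceForm_apply, map_sub, map_mul, ht,
    MulMemClass.coe_mul]
  ring

/-- If the integers of a quadratic extension are generated by `α`, then so is its discriminant by
the square of the difference of the conjugates of `α`. -/
theorem GalRep.IsGen.discIdeal_eq (hR : ∀ x : Ω, IsIntegral R x ↔ v x ≤ 1) (hα : φ.IsGen α)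
    {σ : Gal(Ω/F)} (hσ : φ.toHom σ ≠ 1) (hE : ∀ x, x ∈ E ↔ φ.Fixes x) (hα1 : v α ≤ 1)
    (hα2 : v (σ α) ≤ 1)
    (hint : ∀ c d : F, v (algebraMap F Ω c + algebraMap F Ω d * α) ≤ 1 →
      v (algebraMap F Ω c) ≤ 1 ∧ v (algebraMap F Ω d) ≤ 1) :
    ∃ δ : intRing R F, v (algebraMap F Ω δ) = v (σ α - α) ^ 2 ∧
      discIdeal R F E = Ideal.span {δ} := by
  obtain ⟨B, h0, h1⟩ := hα.exists_basis hσ hE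
  have hfr := hα.finrank_eq_two hσ hE
  have hB : algebraMap F Ω (Algebra.discr F B) = (σ α - α) ^ 2 := by
    rw [hα.discr_eq hσ hE B, h0, h1, map_one]
    ring
  have hB1 : v (algebraMap F Ω (Algebra.discr F B)) = v (σ α - α) ^ 2 := by
    rw [hB, map_pow]
  have hle : v (σ α - α) ≤ 1 := v.map_sub_le hα2 hα1
  let δ : intRing R F := ⟨Algebra.discr F B, (isIntegral_iff_of_valuation hR _).mpr
    (by rw [hB1]; exact pow_le_one' hle 2)⟩
  refine ⟨δ, hB1, le_antisymm ?_ ?_⟩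
  · refine Ideal.span_le.mpr ?_
    rintro d ⟨b, hb, hd⟩
    rw [SetLike.mem_coe, Ideal.mem_span_singleton, intRing_dvd_iff hR, hd, hB1]
    have hd2 : Algebra.discr F b = Algebra.discr F (b.reindex (finCongr hfr)) := by
      rw [Module.Basis.coe_reindex, Algebra.discr_reindex]
    rw [hd2, hα.discr_eq hσ hE, map_pow]
    gcongr
    have hb' : ∀ i, ∃ c d : F, ((b.reindex (finCongr hfr) i : E) : Ω) =
        algebraMap F Ω c + algebraMap F Ω d * α ∧ v (algebraMap F Ω c) ≤ 1 ∧
          v (algebraMap F Ω d) ≤ 1 := by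
      intro i
      obtain ⟨c, d, hcd⟩ := hα.exists_coord hσ ((hE _).mp (b.reindex (finCongr hfr) i).2)
      refine ⟨c, d, hcd, hint c d ?_⟩
      rw [← hcd, Module.Basis.reindex_apply]
      exact (isIntegral_iff_of_valuation hR _).mp (hb _)
    obtain ⟨c₀, d₀, hcd₀, hc₀, hd₀⟩ := hb' 0
    obtain ⟨c₁, d₁, hcd₁, hc₁, hd₁⟩ := hb' 1
    -- Any integral basis differs from `1, α` by a matrix that is integral by `hint`; its
    -- determinant is the first factor.
    have hdet : ((b.reindex (finCongr hfr) 0 : E) : Ω) * σ (b.reindex (finCongr hfr) 1 : E) -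
        (b.reindex (finCongr hfr) 1 : E) * σ (b.reindex (finCongr hfr) 0 : E) =
        (algebraMap F Ω c₀ * algebraMap F Ω d₁ - algebraMap F Ω c₁ * algebraMap F Ω d₀) *
          (σ α - α) := by
      rw [hcd₀, hcd₁, map_add, map_add, map_mul, map_mul]
      simp only [AlgEquiv.commutes]
      ring
    rw [hdet, map_mul]
    refine mul_le_of_le_one_left' (v.map_sub_le ?_ ?_)
    · rw [map_mul]
      exact mul_le_one' hc₀ hd₁
    · rw [map_mul]
      exact mul_le_one' hc₁ hd₀
  · rw [Ideal.span_singleton_le_iff_mem]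
    refine Ideal.subset_span ⟨B.reindex (finCongr hfr.symm), fun i => ?_, ?_⟩
    · rw [Module.Basis.reindex_apply, isIntegral_iff_of_valuation hR]
      generalize (finCongr hfr.symm).symm i = k
      fin_cases k
      · simp [h0, IntermediateField.algebraMap_apply]
      · simpa [h1, IntermediateField.algebraMap_apply] using hα1
    · rw [Module.Basis.coe_reindex, Algebra.discr_reindex]

namespace Valuation.IsLocalOver

variable (H : v.IsLocalOver ϖ)

include H

omit [IsGalois F Ω] in
theorem primeIdeal_pow_eq_span (hR : ∀ x : Ω, IsIntegral R x ↔ v x ≤ 1) {n : ℕ} {δ : intRing R F}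
    (hδ : v (algebraMap F Ω δ) = v (algebraMap F Ω ϖ) ^ n) :
    primeIdeal R F ^ n = Ideal.span {δ} := by
  ext x
  rw [mem_primeIdeal_pow_iff hR H.lt_one H.isLocal.le_of_lt, Ideal.mem_span_singleton,
    intRing_dvd_iff hR, hδ]

theorem discIdeal_unram (hR : ∀ x : Ω, IsIntegral R x ↔ v x ≤ 1)
    (hE : ∀ x, x ∈ E ↔ φ.Fixes x) (hφ : φ.IsUnram v) :
    discIdeal R F E = primeIdeal R F ^ 0 := by
  obtain ⟨⟨σ, hσ⟩, α, hα, hα1, hun⟩ := hφ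
  obtain ⟨δ, hδ, hspan⟩ := hα.discIdeal_eq hR hσ hE hα1 (by rwa [H.map_gal]) fun c d hcd =>
    ⟨(H.coord_le_of_unram hα1 (hun σ hσ)).1.trans hcd,
      (H.coord_le_of_unram hα1 (hun σ hσ)).2.trans hcd⟩
  rw [hspan]
  refine (H.primeIdeal_pow_eq_span hR ?_).symm
  rw [hδ, hun σ hσ, one_pow, pow_zero]

/-- The discriminant has value v(σα - α)² = v(α)^(2n) = v(ϖ)^n, so its exponent is the conductor
found in `symmetricCount_ram`. -/
theorem discIdeal_ram (hR : ∀ x : Ω, IsIntegral R x ↔ v x ≤ 1)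
    (hE : ∀ x, x ∈ E ↔ φ.Fixes x) {n : ℕ} (hφ : φ.IsRam v ϖ n) :
    discIdeal R F E = primeIdeal R F ^ n := by
  obtain ⟨⟨σ, hσ⟩, α, hα, hα2, hram⟩ := hφ
  have hα1 := (H.lt_one_of_sq hα2).le
  obtain ⟨δ, hδ, hspan⟩ := hα.discIdeal_eq hR hσ hE hα1 (by rwa [H.map_gal]) fun c d hcd =>
    ⟨(H.coord_le_of_ram hα2 c d).1.trans hcd,
      H.le_one_of_mul_le_one hα2 ((H.coord_le_of_ram hα2 c d).2.trans hcd)⟩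
  rw [hspan]
  refine (H.primeIdeal_pow_eq_span hR ?_).symm
  rw [hδ, hram σ hσ, ← pow_mul, mul_comm, pow_mul, hα2]

end Valuation.IsLocalOver

end Discriminant

/-! ### Residue fields, uniformizers and norms in quadratic extensions -/

section QuadraticExtension

variable {R F Ω : Type*} [CommRing R] [Field F] [Field Ω] [Algebra R F] [Algebra R Ω]
  [Algebra F Ω] [IsScalarTower R F Ω] {v : Valuation Ω ℝ≥0}
  {ϖ : F} {φ : GalRep F Ω (Equiv.Perm (Fin 2))} {α : Ω} {E : IntermediateField F Ω}

open GalRep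

namespace Valuation.IsLocalOver

variable (H : v.IsLocalOver ϖ)

include H

theorem comap_ball_algebraMap {π : E} (h1 : v π < 1) (h2 : v (algebraMap F Ω ϖ) ≤ v π) :
    (((v.comap (algebraMap E Ω)).ball (v π)).comap (algebraMap F E).toAddMonoidHom) =
      (v.comap (algebraMap F Ω)).ball (v (algebraMap F Ω ϖ)) := by
  ext x
  change v (algebraMap F Ω x) ≤ v π ↔ v (algebraMap F Ω x) ≤ _
  exact ⟨fun h => H.isLocal.le_of_lt _ (h.trans_lt h1), fun h => h.trans h2⟩

theorem relIndex_map_algebraMap {π : E} (h1 : v π < 1) (h2 : v (algebraMap F Ω ϖ) ≤ v π) :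
    ((v.comap (algebraMap E Ω)).ball (v π)).relIndex
      (((v.comap (algebraMap F Ω)).ball 1).map (algebraMap F E).toAddMonoidHom) =
      (v.comap (algebraMap F Ω)).residueCard ϖ := by
  rw [← AddSubgroup.relIndex_comap, H.comap_ball_algebraMap h1 h2]
  rfl

/-- The hypothesis `hres` makes the integers of `E` the sum of those of `F` and the maximal ideal,
so the residue field is that of `F`. -/
theorem residueCard_eq {π : E} (h1 : v π < 1) (h2 : v (algebraMap F Ω ϖ) ≤ v π)
    (hres : ∀ x : E, v x ≤ 1 → ∃ a : F, v (algebraMap F Ω a) ≤ 1 ∧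
      v ((x : Ω) - algebraMap F Ω a) ≤ v π) :
    (v.comap (algebraMap E Ω)).residueCard π = (v.comap (algebraMap F Ω)).residueCard ϖ := by
  have hsup : (v.comap (algebraMap E Ω)).ball 1 =
      ((v.comap (algebraMap F Ω)).ball 1).map (algebraMap F E).toAddMonoidHom ⊔
        (v.comap (algebraMap E Ω)).ball (v π) := by
    refine le_antisymm (fun x hx => ?_) (sup_le ?_ (Valuation.ball_mono h1.le))
    · obtain ⟨a, ha, hxa⟩ := hres x hx
      rw [AddSubgroup.mem_sup]
      exact ⟨algebraMap F E a, ⟨a, ha, rfl⟩, x - algebraMap F E a, hxa, by ring⟩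
    · rintro _ ⟨a, ha, rfl⟩
      exact ha
  rw [← H.relIndex_map_algebraMap h1 h2, Valuation.residueCard, hsup]
  exact AddSubgroup.relIndex_sup_right _ _

/-- Between the maximal ideal and the integers of `E` lies the group `A` of integers congruent to an
element of `F`. Both steps have index q: the lower one is parametrised by the coordinate `c`, the
upper one by `d`. -/
theorem residueCard_eq_sq {π : E} (h1 : v π = v (algebraMap F Ω ϖ)) (hαE : α ∈ E) (hα : v α ≤ 1)
    (hcoord : ∀ x : E, ∃ c d : F, (x : Ω) = algebraMap F Ω c + algebraMap F Ω d * α)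
    (hint : ∀ c d : F, v (algebraMap F Ω c) ≤ v (algebraMap F Ω c + algebraMap F Ω d * α) ∧
      v (algebraMap F Ω d) ≤ v (algebraMap F Ω c + algebraMap F Ω d * α)) :
    (v.comap (algebraMap E Ω)).residueCard π = (v.comap (algebraMap F Ω)).residueCard ϖ ^ 2 := by
  have hlt : v π < 1 := h1 ▸ H.lt_one
  set Hπ := (v.comap (algebraMap E Ω)).ball (v π) with hHπ
  set A := ((v.comap (algebraMap F Ω)).ball 1).map (algebraMap F E).toAddMonoidHom ⊔ Hπ with hA
  let g : F →+ E := (AddMonoidHom.mulRight (⟨α, hαE⟩ : E)).comp (algebraMap F E).toAddMonoidHom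
  have hg : ∀ d, ((g d : E) : Ω) = algebraMap F Ω d * α := fun d => rfl
  have hsup : (v.comap (algebraMap E Ω)).ball 1 =
      ((v.comap (algebraMap F Ω)).ball 1).map g ⊔ A := by
    refine le_antisymm (fun x hx => ?_) (sup_le ?_ (sup_le ?_ (Valuation.ball_mono hlt.le)))
    · obtain ⟨c, d, hcd⟩ := hcoord x
      have hx' : v (algebraMap F Ω c + algebraMap F Ω d * α) ≤ 1 := by
        rw [← hcd]
        exact hx
      rw [AddSubgroup.mem_sup]
      refine ⟨g d, ⟨d, (hint c d).2.trans hx', rfl⟩, algebraMap F E c,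
        AddSubgroup.mem_sup_left ⟨c, (hint c d).1.trans hx', rfl⟩, ?_⟩
      apply Subtype.ext
      rw [hcd, add_comm]
      rfl
    · rintro _ ⟨d, hd, rfl⟩
      change v (algebraMap F Ω d * α) ≤ 1
      rw [map_mul]
      exact mul_le_one' hd hα
    · rintro _ ⟨a, ha, rfl⟩
      exact ha
  have hcomap : A.comap g = (v.comap (algebraMap F Ω)).ball (v (algebraMap F Ω ϖ)) := by
    ext d
    rw [AddSubgroup.mem_comap, hA, AddSubgroup.mem_sup]
    constructor
    · rintro ⟨_, ⟨a, ha, rfl⟩, y, hy, hyd⟩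
      have h2 : (y : Ω) = algebraMap F Ω (-a) + algebraMap F Ω d * α := by
        have h3 := congrArg (algebraMap E Ω) hyd
        rw [map_add] at h3
        change algebraMap F Ω a + (y : Ω) = algebraMap F Ω d * α at h3
        rw [_root_.map_neg]
        linear_combination h3
      have hy' : v (y : Ω) ≤ v π := hy
      rw [h2, h1] at hy'
      exact (hint _ _).2.trans hy'
    · intro hd
      refine ⟨0, zero_mem _, g d, ?_, zero_add _⟩
      change v (algebraMap F Ω d * α) ≤ v π
      rw [map_mul, h1]
      exact (mul_le_of_le_one_right' hα).trans hd
  have hq1 : Hπ.relIndex A = (v.comap (algebraMap F Ω)).residueCard ϖ := by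
    rw [← H.relIndex_map_algebraMap hlt h1.ge, hA]
    exact AddSubgroup.relIndex_sup_right _ _
  have hq2 : A.relIndex ((v.comap (algebraMap E Ω)).ball 1) =
      (v.comap (algebraMap F Ω)).residueCard ϖ := by
    rw [hsup, AddSubgroup.relIndex_sup_right, ← AddSubgroup.relIndex_comap, hcomap]
    rfl
  have hmul : Hπ.relIndex A * A.relIndex ((v.comap (algebraMap E Ω)).ball 1) =
      (v.comap (algebraMap E Ω)).residueCard π := by
    refine (AddSubgroup.relIndex_mul_relIndex _ _ _ le_sup_right ?_)
    rw [hsup]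
    exact le_sup_right
  rw [← hmul, hq1, hq2, pow_two]

theorem isLocalOver_of {π : E} (h0 : π ≠ 0) (h1 : v π < 1)
    (h2 : ∀ x : E, v (x : Ω) < 1 → v (x : Ω) ≤ v π)
    (h3 : (v.comap (algebraMap E Ω)).residueCard π ≠ 0) : v.IsLocalOver π where
  map_gal σ x := H.map_gal (σ.restrictScalars F) x
  isLocal := ⟨h0, h1, h2, h3⟩

theorem isLocalOver_trivial (hE : ∀ x ∈ E, ∃ a, algebraMap F Ω a = x) :
    v.IsLocalOver (algebraMap F E ϖ) ∧ (v.comap (algebraMap E Ω)).residueCard (algebraMap F E ϖ) =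
      (v.comap (algebraMap F Ω)).residueCard ϖ := by
  have hq : (v.comap (algebraMap E Ω)).residueCard (algebraMap F E ϖ) =
      (v.comap (algebraMap F Ω)).residueCard ϖ := by
    refine H.residueCard_eq H.lt_one le_rfl fun x hx => ?_
    obtain ⟨a, ha⟩ := hE x x.2
    exact ⟨a, ha ▸ hx, by simp [ha]⟩
  refine ⟨H.isLocalOver_of ?_ H.lt_one ?_ (hq ▸ H.isLocal.card_ne_zero), hq⟩
  · simpa using H.isLocal.ne_zero
  · intro x hx
    obtain ⟨a, ha⟩ := hE x x.2
    rw [← ha] at hx ⊢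
    exact H.isLocal.le_of_lt _ hx

variable [IsGalois F Ω]

theorem isLocalOver_unram (hE : ∀ x, x ∈ E ↔ φ.Fixes x) (hφ : φ.IsUnram v) :
    v.IsLocalOver (algebraMap F E ϖ) ∧ (v.comap (algebraMap E Ω)).residueCard (algebraMap F E ϖ) =
      (v.comap (algebraMap F Ω)).residueCard ϖ ^ 2 := by
  obtain ⟨⟨σ, hσ⟩, α, hα, hα1, hun⟩ := hφ
  have hcoord : ∀ x : E, ∃ c d : F, (x : Ω) = algebraMap F Ω c + algebraMap F Ω d * α :=
    fun x => hα.exists_coord hσ ((hE x).mp x.2)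
  have hq := H.residueCard_eq_sq (π := algebraMap F E ϖ) rfl ((hE α).mpr hα.fixes) hα1 hcoord
    fun c d => H.coord_le_of_unram hα1 (hun σ hσ)
  refine ⟨H.isLocalOver_of ?_ H.lt_one ?_ (hq ▸ pow_ne_zero _ H.isLocal.card_ne_zero), hq⟩
  · simpa using H.isLocal.ne_zero
  · intro x hx
    obtain ⟨c, d, hcd⟩ := hcoord x
    rw [hcd] at hx ⊢
    exact H.le_of_lt_of_unram hα1 (hun σ hσ) hx

theorem isLocalOver_ram (hE : ∀ x, x ∈ E ↔ φ.Fixes x) {n : ℕ} (hφ : φ.IsRam v ϖ n) :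
    ∃ π : E, v.IsLocalOver π ∧ v (π : Ω) ^ 2 = v (algebraMap F Ω ϖ) ∧
      (v.comap (algebraMap E Ω)).residueCard π = (v.comap (algebraMap F Ω)).residueCard ϖ := by
  obtain ⟨⟨σ, hσ⟩, α, hα, hα2, hram⟩ := hφ
  have hcoord : ∀ x : E, ∃ c d : F, (x : Ω) = algebraMap F Ω c + algebraMap F Ω d * α :=
    fun x => hα.exists_coord hσ ((hE x).mp x.2)
  let π : E := ⟨α, (hE α).mpr hα.fixes⟩
  have hq := H.residueCard_eq (π := π) (H.lt_one_of_sq hα2) (H.le_of_sq hα2) fun x hx => by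
    obtain ⟨c, d, hcd⟩ := hcoord x
    have hcl := H.coord_le_of_ram hα2 c d
    rw [← hcd] at hcl
    refine ⟨c, hcl.1.trans hx, ?_⟩
    rw [hcd, add_sub_cancel_left, map_mul]
    exact mul_le_of_le_one_left' (H.le_one_of_mul_le_one hα2 (hcl.2.trans hx))
  refine ⟨π, H.isLocalOver_of ?_ (H.lt_one_of_sq hα2) ?_ (hq ▸ H.isLocal.card_ne_zero), hα2, hq⟩
  · intro h0
    have : v α = 0 := by
      have := congrArg (algebraMap E Ω) h0
      rw [map_zero] at this
      change α = 0 at this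
      rw [this, map_zero]
    exact (H.pos_of_sq hα2).ne' this
  · intro x hx
    obtain ⟨c, d, hcd⟩ := hcoord x
    rw [hcd] at hx ⊢
    exact H.le_of_lt_of_ram hα2 hx

/-- The norm x · σx has value v(x)², so the norm ideal is generated by the norm of `π ^ n`. By `hf`,
the number `f` is the residue degree: 2 if `ϖ` stays a uniformizer, 1 if v(π)² = v(ϖ). -/
theorem normIdeal_primeIdeal_pow (hR : ∀ x : Ω, IsIntegral R x ↔ v x ≤ 1)
    (hE : ∀ x, x ∈ E ↔ φ.Fixes x) {σ : Gal(Ω/F)} (hσ : φ.toHom σ ≠ 1) {π : E}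
    (Hπ : v.IsLocalOver π) {f : ℕ} (hf : v (π : Ω) ^ 2 = v (algebraMap F Ω ϖ) ^ f) (n : ℕ) :
    normIdeal R F (primeIdeal R E ^ n) = primeIdeal R F ^ (f * n) := by
  obtain ⟨α, hα⟩ := exists_isGen hσ
  have hnorm : ∀ x : E, v (algebraMap F Ω (Algebra.norm F x)) = v (x : Ω) ^ 2 := by
    intro x
    rw [(hα.trace_norm hσ hE x).2, map_mul, H.map_gal, pow_two]
  have hπn : v (algebraMap F Ω (Algebra.norm F (π ^ n))) = v (algebraMap F Ω ϖ) ^ (f * n) := by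
    rw [hnorm, pow_mul, ← hf]
    simp only [SubmonoidClass.coe_pow, map_pow]
    rw [← pow_mul, ← pow_mul, mul_comm]
  let δ : intRing R F := ⟨Algebra.norm F (π ^ n), (isIntegral_iff_of_valuation hR _).mpr
    (by rw [hπn]; exact pow_le_one' H.lt_one.le _)⟩
  rw [H.primeIdeal_pow_eq_span hR (δ := δ) hπn]
  refine le_antisymm (Ideal.span_le.mpr ?_) ?_
  · rintro a ⟨x, hx, ha⟩
    rw [mem_primeIdeal_pow_iff hR Hπ.lt_one Hπ.isLocal.le_of_lt] at hx
    rw [SetLike.mem_coe, Ideal.mem_span_singleton, intRing_dvd_iff hR, ha, hnorm]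
    change _ ≤ v (algebraMap F Ω (Algebra.norm F (π ^ n)))
    rw [hnorm, SubmonoidClass.coe_pow, map_pow]
    gcongr
    exact hx
  · rw [Ideal.span_singleton_le_iff_mem]
    have hint : IsIntegral R (π ^ n) := (isIntegral_iff_of_valuation hR _).mpr (by
      rw [map_pow, map_pow]
      exact pow_le_one' Hπ.lt_one.le _)
    refine Ideal.subset_span ⟨⟨π ^ n, hint⟩, ?_, rfl⟩
    rw [mem_primeIdeal_pow_iff hR Hπ.lt_one Hπ.isLocal.le_of_lt]
    simp

end Valuation.IsLocalOver

end QuadraticExtension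

/-! ### Finite subrings of a field -/

section FiniteSubrings

/-- A finite domain is a field, and its n elements already exhaust the roots of X^n - X. Hence a
finite subring of a field is determined by its cardinality, which is what makes the unramified
extension unique. -/
theorem Subring.mem_iff_pow_card {k : Type*} [Field k] (S : Subring k) [Finite S] {x : k} :
    x ∈ S ↔ x ^ Nat.card S = x := by
  classical
  have := Fintype.ofFinite S
  let _ : Field S := Fintype.fieldOfDomain S
  have hcard : 1 < Fintype.card S := Fintype.one_lt_card
  have hpow : ∀ y ∈ S, y ^ Nat.card S = y := by
    intro y hy
    rw [Nat.card_eq_fintype_card]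
    have := FiniteField.pow_card (⟨y, hy⟩ : S)
    exact congrArg Subtype.val this
  refine ⟨hpow x, fun hx => ?_⟩
  have hp : (Polynomial.X ^ Nat.card S - Polynomial.X : Polynomial k) ≠ 0 := by
    rw [Nat.card_eq_fintype_card]
    exact FiniteField.X_pow_card_sub_X_ne_zero k hcard
  have hsub : Finset.univ.image (Subtype.val : S → k) ⊆
      (Polynomial.X ^ Nat.card S - Polynomial.X : Polynomial k).roots.toFinset := by
    intro y hy
    obtain ⟨z, -, rfl⟩ := Finset.mem_image.mp hy
    rw [Multiset.mem_toFinset, Polynomial.mem_roots hp]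
    rw [Polynomial.IsRoot, Polynomial.eval_sub, Polynomial.eval_pow, Polynomial.eval_X,
      hpow z.1 z.2, sub_self]
  have heq := Finset.eq_of_subset_of_card_le hsub (by
    refine (Multiset.toFinset_card_le _).trans ((Polynomial.card_roots' _).trans ?_)
    rw [Finset.card_image_of_injective _ Subtype.val_injective, Finset.card_univ,
      Nat.card_eq_fintype_card, FiniteField.X_pow_card_sub_X_natDegree_eq k hcard])
  have hx' : x ∈ (Polynomial.X ^ Nat.card S - Polynomial.X : Polynomial k).roots.toFinset := by
    rw [Multiset.mem_toFinset, Polynomial.mem_roots hp]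
    rw [Polynomial.IsRoot, Polynomial.eval_sub, Polynomial.eval_pow, Polynomial.eval_X, hx,
      sub_self]
  rw [← heq] at hx'
  obtain ⟨z, -, rfl⟩ := Finset.mem_image.mp hx'
  exact z.2

end FiniteSubrings

/-! ### Existence and uniqueness of the unramified quadratic character -/

section Unramified

variable {F Ω : Type*} [Field F] [Field Ω] [Algebra F Ω] {v : Valuation Ω ℝ≥0}
  {ϖ : F} {φ ψ : GalRep F Ω (Equiv.Perm (Fin 2))} {α : Ω}

/-- The image in the residue field of `Ω` of the integers of a subfield. -/
def residueSubring (v : Valuation Ω ℝ≥0) (E : IntermediateField F Ω) :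
    Subring (IsLocalRing.ResidueField v.valuationSubring) :=
  ((E.toSubring ⊓ v.integer).comap v.valuationSubring.toSubring.subtype).map
    (IsLocalRing.residue v.valuationSubring)

theorem residue_eq_iff {x y : v.valuationSubring} :
    IsLocalRing.residue v.valuationSubring x = IsLocalRing.residue v.valuationSubring y ↔
      v ((x : Ω) - y) < 1 := by
  rw [← sub_eq_zero, ← map_sub, IsLocalRing.residue_eq_zero_iff,
    ValuationSubring.valuation_lt_one_iff]
  rw [← (Valuation.isEquiv_valuation_valuationSubring v).lt_one_iff_lt_one]
  rfl

theorem mem_residueSubring {E : IntermediateField F Ω} {z} :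
    z ∈ residueSubring v E ↔ ∃ x : v.valuationSubring, (x : Ω) ∈ E ∧
      IsLocalRing.residue v.valuationSubring x = z := by
  constructor
  · rintro ⟨x, hx, rfl⟩
    exact ⟨x, hx.1, rfl⟩
  · rintro ⟨x, hx, rfl⟩
    exact ⟨x, ⟨hx, x.2⟩, rfl⟩

/-- Realising residue fields inside the residue field of `Ω` allows those of different extensions to
be compared as subrings. -/
theorem card_residueSubring {E : IntermediateField F Ω} {π : E} (Hπ : v.IsLocalOver π) :
    Nat.card (residueSubring v E) = (v.comap (algebraMap E Ω)).residueCard π := by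
  let w := v.comap (algebraMap E Ω)
  let f : w.ball 1 →+ IsLocalRing.ResidueField v.valuationSubring :=
    { toFun := fun x => IsLocalRing.residue v.valuationSubring ⟨(x : E), x.2⟩
      map_zero' := map_zero (IsLocalRing.residue v.valuationSubring)
      map_add' := fun x y => map_add (IsLocalRing.residue v.valuationSubring)
        ⟨(x : E), x.2⟩ ⟨(y : E), y.2⟩ }
  have hker : f.ker = (w.ball (w π)).addSubgroupOf (w.ball 1) := by
    ext x
    rw [AddMonoidHom.mem_ker, AddSubgroup.mem_addSubgroupOf]
    change IsLocalRing.residue v.valuationSubring ⟨(x : E), x.2⟩ = 0 ↔ w x ≤ w π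
    rw [← map_zero (IsLocalRing.residue v.valuationSubring), residue_eq_iff]
    change v (((x : E) : Ω) - 0) < 1 ↔ _
    rw [sub_zero]
    exact Hπ.isLocal.lt_one_iff
  rw [Valuation.residueCard, AddSubgroup.relIndex]
  change _ = ((w.ball (w π)).addSubgroupOf (w.ball 1)).index
  rw [← hker, AddSubgroup.index_ker]
  refine Nat.card_congr (Equiv.setCongr ?_)
  ext z
  rw [SetLike.mem_coe, mem_residueSubring]
  constructor
  · rintro ⟨x, hx, rfl⟩
    exact ⟨⟨⟨x, hx⟩, x.2⟩, rfl⟩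
  · rintro ⟨x, rfl⟩
    exact ⟨⟨(x : E), x.2⟩, (x : E).2, rfl⟩

namespace Valuation.IsLocalOver

open GalRep

variable (H : v.IsLocalOver ϖ)

include H

variable [IsGalois F Ω]

/-- Both fields have the same residue field, the subring with q² elements, so the generator `β` of
one is congruent to some `x` in the other. An automorphism trivial under `φ` fixes `x`, hence moves
`β` by less than 1, hence is trivial under `ψ`. -/
theorem eq_of_isUnram (hφ : φ.IsUnram v) (hψ : ψ.IsUnram v) : φ = ψ := by
  have key : ∀ {φ ψ : GalRep F Ω (Equiv.Perm (Fin 2))}, φ.IsUnram v → ψ.IsUnram v →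
      ∀ σ, φ.toHom σ = 1 → ψ.toHom σ = 1 := by
    intro φ ψ hφ hψ σ hσ
    obtain ⟨Hφ, hcφ⟩ := H.isLocalOver_unram (E := φ.kerField) (fun _ => mem_kerField_iff) hφ
    obtain ⟨Hψ, hcψ⟩ := H.isLocalOver_unram (E := ψ.kerField) (fun _ => mem_kerField_iff) hψ
    have hfin : ∀ S : Subring (IsLocalRing.ResidueField v.valuationSubring),
        Nat.card S = (v.comap (algebraMap F Ω)).residueCard ϖ ^ 2 → Finite S := fun S hS =>
      Nat.finite_of_card_ne_zero (hS ▸ pow_ne_zero _ H.isLocal.card_ne_zero)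
    have h1 := (card_residueSubring Hφ).trans hcφ
    have h2 := (card_residueSubring Hψ).trans hcψ
    have := hfin _ h1
    have := hfin _ h2
    obtain ⟨-, β, hβ, hβ1, hun⟩ := hψ
    have hmem : IsLocalRing.residue v.valuationSubring ⟨β, hβ1⟩ ∈ residueSubring v φ.kerField := by
      rw [Subring.mem_iff_pow_card, h1, ← h2, ← Subring.mem_iff_pow_card, mem_residueSubring]
      exact ⟨_, mem_kerField_iff.mpr hβ.fixes, rfl⟩
    obtain ⟨x, hx, hxβ⟩ := mem_residueSubring.mp hmem
    rw [residue_eq_iff] at hxβ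
    by_contra hne
    have h3 : v (σ β - β) < 1 := by
      have h4 : σ β - β = ((x : Ω) - β) - σ ((x : Ω) - β) := by
        rw [_root_.map_sub, mem_kerField_iff.mp hx σ hσ]
        ring
      rw [h4]
      exact v.map_sub_lt hxβ (by rwa [H.map_gal])
    rw [hun σ hne] at h3
    exact lt_irrefl _ h3
  exact eq_of_forall_eq_one_iff fun σ => ⟨key hφ hψ σ, key hψ hφ σ⟩

/-- The map x ↦ x² + x identifies 0 and -1, so on the finite residue field it is not injective and
therefore not surjective. A value `D` that it misses gives a polynomial X² + X - D without roots in
`F`, in every residue characteristic. -/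
theorem exists_isUnram [IsSepClosed Ω] : ∃ φ : GalRep F Ω (Equiv.Perm (Fin 2)), φ.IsUnram v := by
  have hex : ∃ D : F, v (algebraMap F Ω D) ≤ 1 ∧ ∀ x : F, v (algebraMap F Ω x) ≤ 1 →
      1 ≤ v (algebraMap F Ω (x ^ 2 + x - D)) := by
    by_contra! hall
    have h1 := H.isLocal.injective_residue_of_exists (f := fun x => x ^ 2 + x) (x := 0) (y := -1)
      (fun x hx => (v.comap (algebraMap F Ω)).map_add_le (by
        rw [map_pow]
        exact pow_le_one' hx 2) hx)
      (fun x y hx hy hxy => by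
        have : x ^ 2 + x - (y ^ 2 + y) = (x - y) * (x + y + 1) := by ring
        rw [this, map_mul]
        refine (mul_le_of_le_one_right' ?_).trans_lt hxy
        exact Valuation.map_add_le _ (Valuation.map_add_le _ hx hy) (by simp))
      hall (by simp) (by simp) (by simp)
    simp at h1
  obtain ⟨D, hD, hno⟩ := hex
  have h21 : v (algebraMap F Ω 2) ≤ 1 := by
    rw [← one_add_one_eq_two, map_add, map_one]
    exact v.map_add_le (by simp) (by simp)
  -- If the discriminant were not a unit, 2 would be a unit and -1/2 would be a root modulo the
  -- maximal ideal, against the choice of `D`.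
  have hdisc : v (algebraMap F Ω (1 + 4 * D)) = 1 := by
    have hle : v (algebraMap F Ω (1 + 4 * D)) ≤ 1 := by
      rw [map_add, map_mul]
      refine v.map_add_le (by simp) ?_
      rw [map_mul, show (4 : F) = 2 * 2 by norm_num, map_mul, map_mul]
      exact mul_le_one' (mul_le_one' h21 h21) hD
    refine hle.eq_of_not_lt fun hlt => ?_
    have h2 : v (algebraMap F Ω 2) = 1 := by
      refine h21.eq_of_not_lt fun h2 => ?_
      have h4 : v (algebraMap F Ω (4 * D)) < v 1 := by
        rw [show (4 : F) * D = 2 * (2 * D) by ring, map_mul, map_mul, map_mul, map_mul, map_one]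
        exact (mul_le_of_le_one_right' (mul_le_one' h21 hD)).trans_lt h2
      rw [map_add, map_one, v.map_add_eq_of_lt_left h4, map_one] at hlt
      exact lt_irrefl _ hlt
    have h20 : (2 : F) ≠ 0 := fun h0 => by simp [h0] at h2
    have h3 := hno (-1 / 2) (by simp [h2])
    have h5 : (-1 / 2 : F) ^ 2 + -1 / 2 - D = -(1 + 4 * D) / (2 * 2) := by
      field_simp
      ring
    rw [h5, map_div₀, map_div₀, _root_.map_neg, Valuation.map_neg, map_mul, map_mul, h2] at h3
    simp only [mul_one, div_one] at h3
    exact absurd hlt (not_lt.mpr h3)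
  obtain ⟨z, hz⟩ := exists_root (Ω := Ω) (a := (1 : F)) (b := -D) (fun h0 => by
    rw [show 1 + 4 * D = 1 ^ 2 - 4 * -D by ring, h0] at hdisc
    simp at hdisc)
  have hz2 : (2 * z + algebraMap F Ω 1) ^ 2 = algebraMap F Ω (1 + 4 * D) := by
    simp only [map_one, _root_.map_neg, map_add, map_mul, map_ofNat] at hz ⊢
    linear_combination 4 * hz
  have hv2 : v (2 * z + algebraMap F Ω 1) = 1 := by
    have h1 := congrArg v hz2
    rw [hdisc, map_pow] at h1
    exact (pow_eq_one_iff.mp h1).resolve_right two_ne_zero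
  obtain ⟨φ, hφ⟩ := exists_isGen_of_root hz fun h0 => by
    rw [h0, map_zero] at hv2
    exact zero_ne_one hv2
  have hz1 : v z ≤ 1 := by
    by_contra! h1
    have h2 : z ^ 2 = algebraMap F Ω D - z := by
      simp only [map_one, _root_.map_neg] at hz
      linear_combination hz
    have h3 : v (z ^ 2) ≤ v z := by
      rw [h2]
      exact v.map_sub_le (hD.trans h1.le) le_rfl
    rw [map_pow, pow_two] at h3
    exact absurd h3 (not_le.mpr (lt_mul_of_one_lt_left (zero_lt_one.trans h1) h1))
  refine ⟨φ, ?_, z, hφ, hz1, fun σ hσ => ?_⟩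
  · by_contra! hall
    obtain ⟨x, rfl⟩ := exists_algebraMap_eq (x := z) fun σ => (hφ σ).mp (hall σ)
    have h1 := hno x hz1
    have h2 : algebraMap F Ω (x ^ 2 + x - D) = 0 := by
      simp only [map_one, _root_.map_neg] at hz
      simp only [_root_.map_sub, map_add, map_pow]
      linear_combination hz
    rw [h2, map_zero] at h1
    exact absurd h1 (not_le.mpr zero_lt_one)
  · rcases root_apply hz σ with h1 | h1
    · exact absurd ((hφ σ).mpr h1) hσ
    · rw [h1, ← hv2, ← Valuation.map_neg]
      congr 1
      ring

end Valuation.IsLocalOver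

end Unramified

/-! ### Counting ramified characters by Eisenstein polynomials -/

section Strata

variable {F Ω : Type*} [Field F] [Field Ω] [Algebra F Ω] {v : Valuation Ω ℝ≥0}
  {ϖ : F} {φ ψ : GalRep F Ω (Equiv.Perm (Fin 2))} {α β : Ω}

open GalRep

theorem GalRep.IsGen.conj (hα : φ.IsGen α) (a : F) : φ.IsGen (-algebraMap F Ω a - α) := by
  intro σ
  rw [hα σ, map_sub, map_neg, AlgEquiv.commutes]
  exact ⟨fun h => by rw [h], fun h => by linear_combination -h⟩

theorem GalRep.IsGen.affine (hα : φ.IsGen α) {w u : F} (hw : w ≠ 0) :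
    φ.IsGen (algebraMap F Ω u + algebraMap F Ω w * α) := by
  intro σ
  rw [hα σ, map_add, map_mul, AlgEquiv.commutes, AlgEquiv.commutes, add_right_inj]
  refine ⟨fun h => by rw [h], fun h => mul_left_cancel₀ ?_ h⟩
  simpa using hw

namespace Valuation.IsLocalOver

variable (H : v.IsLocalOver ϖ)

include H

omit H in
theorem sq_disc {a b : F} (hα : α ^ 2 + algebraMap F Ω a * α + algebraMap F Ω b = 0) :
    v (-algebraMap F Ω a - α - α) ^ 2 = v (algebraMap F Ω (a ^ 2 - 4 * b)) := by
  rw [← map_pow]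
  congr 1
  rw [_root_.map_sub, map_mul, map_pow, map_ofNat]
  linear_combination 4 * hα

/-- A form of Krasner's lemma for quadratic characters. -/
theorem eq_of_close {a b b' : F} (hα : φ.IsGen α) (hβ : ψ.IsGen β)
    (hab : α ^ 2 + algebraMap F Ω a * α + algebraMap F Ω b = 0)
    (hab' : β ^ 2 + algebraMap F Ω a * β + algebraMap F Ω b' = 0)
    (hd : v (algebraMap F Ω (a ^ 2 - 4 * b')) = v (algebraMap F Ω (a ^ 2 - 4 * b)))
    (hlt : v (algebraMap F Ω (b - b')) < v (algebraMap F Ω (a ^ 2 - 4 * b))) : φ = ψ := by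
  have key : ∀ {φ ψ : GalRep F Ω (Equiv.Perm (Fin 2))} {α β : Ω} {b b' : F}, φ.IsGen α →
      ψ.IsGen β → β ^ 2 + algebraMap F Ω a * β + algebraMap F Ω b' = 0 →
      v (β - α) ^ 2 < v (algebraMap F Ω (a ^ 2 - 4 * b')) →
      ∀ σ, φ.toHom σ = 1 → ψ.toHom σ = 1 := by
    intro φ ψ α β b b' hα hβ hab' h σ hσ
    rcases root_apply hab' σ with h1 | h1
    · exact (hβ σ).mpr h1
    · exfalso
      have h2 : σ β - β = σ (β - α) - (β - α) := by
        rw [_root_.map_sub, (hα σ).mp hσ]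
        ring
      have h3 : v (σ β - β) ≤ v (β - α) := by
        rw [h2]
        exact v.map_sub_le (H.map_gal _ _).le le_rfl
      rw [h1] at h3
      have h4 := sq_disc (v := v) hab'
      rw [← h4] at h
      exact absurd (pow_le_pow_left₀ zero_le h3 2) (not_le.mpr h)
  have main : ∀ {α : Ω}, φ.IsGen α → α ^ 2 + algebraMap F Ω a * α + algebraMap F Ω b = 0 →
      v (β - α) ^ 2 < v (algebraMap F Ω (a ^ 2 - 4 * b)) → φ = ψ := by
    intro α hα hab h
    refine eq_of_forall_eq_one_iff fun σ => ⟨key (b := b) hα hβ hab' (hd ▸ h) σ,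
      key (b := b') hβ hα hab ?_ σ⟩
    rwa [Valuation.map_sub_swap]
  -- The first polynomial evaluated at `β`. If `β` were far from both of its roots, this product
  -- would be at least as large as the discriminant.
  have hprod : (β - α) * (β - (-algebraMap F Ω a - α)) = algebraMap F Ω (b - b') := by
    rw [_root_.map_sub]
    linear_combination hab' - hab
  by_cases h : v (β - α) ^ 2 < v (algebraMap F Ω (a ^ 2 - 4 * b))
  · exact main hα hab h
  · refine main (hα.conj a) (by linear_combination hab) ?_
    by_contra h'
    rw [not_lt] at h h'
    rw [← hprod, map_mul] at hlt
    have h5 := pow_lt_pow_left₀ hlt zero_le two_ne_zero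
    rw [mul_pow] at h5
    have h6 := mul_le_mul' h h'
    rw [← pow_two] at h6
    exact absurd h5 (not_lt.mpr h6)

theorem lt_of_sq (hα : v α ^ 2 = v (algebraMap F Ω ϖ)) : v (algebraMap F Ω ϖ) < v α := by
  rw [← hα, pow_two]
  exact mul_lt_of_lt_one_left (H.pos_of_sq hα) (H.lt_one_of_sq hα)

/-- If `α` were not larger than `a`, both roots would have value at most v(ϖ), too small for their
product. So the other root, -a - α, has the same value as `α`. -/
theorem eisenstein_root {a b : F} (hα : α ^ 2 + algebraMap F Ω a * α + algebraMap F Ω b = 0)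
    (ha : v (algebraMap F Ω a) < 1) (hb : v (algebraMap F Ω b) = v (algebraMap F Ω ϖ)) :
    v α ^ 2 = v (algebraMap F Ω ϖ) := by
  have ha' : v (algebraMap F Ω a) ≤ v (algebraMap F Ω ϖ) := H.isLocal.le_of_lt _ ha
  have hprod : v α * v (-algebraMap F Ω a - α) = v (algebraMap F Ω ϖ) := by
    rw [← map_mul, ← hb]
    congr 1
    linear_combination -hα
  have hlt : v (algebraMap F Ω a) < v α := by
    by_contra! h
    have h1 : v (-algebraMap F Ω a - α) ≤ v (algebraMap F Ω a) :=
      v.map_sub_le (by rw [Valuation.map_neg]) h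
    have h2 : v α * v (-algebraMap F Ω a - α) ≤ v (algebraMap F Ω ϖ) * v (algebraMap F Ω ϖ) :=
      mul_le_mul' (h.trans ha') (h1.trans ha')
    rw [hprod] at h2
    exact absurd h2 (not_le.mpr (mul_lt_of_lt_one_left H.pos H.lt_one))
  have h3 : v (-algebraMap F Ω a - α) = v α := by
    rw [← neg_add', Valuation.map_neg, v.map_add_eq_of_lt_right hlt]
  rw [h3, ← pow_two] at hprod
  exact hprod

variable [IsGalois F Ω]

theorem isRam_of_root {a b : F} {n : ℕ}
    (hα : α ^ 2 + algebraMap F Ω a * α + algebraMap F Ω b = 0)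
    (ha : v (algebraMap F Ω a) < 1) (hb : v (algebraMap F Ω b) = v (algebraMap F Ω ϖ))
    (hd : v (algebraMap F Ω (a ^ 2 - 4 * b)) = v (algebraMap F Ω ϖ) ^ n) :
    ∃ φ : GalRep F Ω (Equiv.Perm (Fin 2)), φ.IsGen α ∧ φ.IsRam v ϖ n := by
  have hα2 := H.eisenstein_root hα ha hb
  have hsq := sq_disc (v := v) hα
  have hv : v (-algebraMap F Ω a - α - α) = v α ^ n := by
    rw [hd, ← hα2, ← pow_mul, mul_comm, pow_mul] at hsq
    exact (pow_left_inj₀ zero_le zero_le two_ne_zero).mp hsq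
  obtain ⟨φ, hφ⟩ := exists_isGen_of_root hα fun h0 => by
    have h1 : -algebraMap F Ω a - α - α = 0 := by linear_combination -h0
    rw [h1, map_zero] at hv
    exact (pow_pos (H.pos_of_sq hα2) n).ne hv
  refine ⟨φ, hφ, ?_, α, hφ, hα2, fun σ hσ => ?_⟩
  · by_contra! hall
    obtain ⟨x, rfl⟩ := exists_algebraMap_eq (x := α) fun σ => (hφ σ).mp (hall σ)
    exact H.sq_ne hα2
  · rcases root_apply hα σ with h1 | h1
    · exact absurd ((hφ σ).mpr h1) hσ
    · rw [h1, hv]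

omit H [IsGalois F Ω] in
-- If one of two elements at distance exactly `T` is smaller than `T`, the other is at most `T`.
-- This splits a quadratic congruence into two linear ones.
theorem mul_lt_sq_iff_of_sub {x y : Ω} {T : ℝ≥0} (hT : 0 < T) (hxy : v (y - x) = T) :
    v x * v y < T * T ↔ v x < T ∨ v y < T := by
  constructor
  · intro h
    by_contra! h'
    exact absurd h (not_lt.mpr (mul_le_mul' h'.1 h'.2))
  · rintro (h | h)
    · have h1 : v y ≤ T := by
        rw [← sub_add_cancel y x]
        exact v.map_add_le hxy.le h.le
      rw [mul_comm]
      exact mul_lt_mul' h1 h zero_le hT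
    · have h1 : v x ≤ T := by
        rw [← sub_sub_cancel y x]
        exact v.map_sub_le h.le hxy.le
      exact mul_lt_mul' h1 h zero_le hT

/-- The count of the quadratic characters that come from Eisenstein polynomials `x² + ax + b` with
fixed `a`. -/
theorem ncard_isRam_of_family [IsSepClosed Ω] {a m g h : F} {k n : ℕ} {P : Set F}
    (hg : g * m = 2) (hh : h * m = a)
    (hgh : h = 1 ∨ g = 1 ∧ h = 0) (ha : v (algebraMap F Ω a) < 1)
    (hmk : v (algebraMap F Ω m) = v (algebraMap F Ω ϖ) ^ k)
    (hdisc : ∀ b, v (algebraMap F Ω b) = v (algebraMap F Ω ϖ) →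
      v (algebraMap F Ω (a ^ 2 - 4 * b)) = v (algebraMap F Ω ϖ) ^ n)
    (hP : ∀ r, r ∈ P ↔ v (algebraMap F Ω r) ≤ 1 ∧ v (algebraMap F Ω (1 + r * g)) = 1 ∧
      v (algebraMap F Ω (r * h)) < 1)
    (hcov : ∀ φ : GalRep F Ω (Equiv.Perm (Fin 2)), φ.IsRam v ϖ n → ∃ (α : Ω) (b : F),
      φ.IsGen α ∧ α ^ 2 + algebraMap F Ω a * α + algebraMap F Ω b = 0 ∧
        v (algebraMap F Ω b) = v (algebraMap F Ω ϖ)) :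
    ((QuotientAddGroup.mk : F → F ⧸ (v.comap (algebraMap F Ω)).ball
      (v (algebraMap F Ω ϖ) ^ (n + 1))) ''
        {b | v (algebraMap F Ω b) = v (algebraMap F Ω ϖ)}).ncard * 2 =
    ((QuotientAddGroup.mk : F → F ⧸ (v.comap (algebraMap F Ω)).ball
      (v (algebraMap F Ω ϖ) ^ (k + 1))) '' P).ncard *
      {φ : GalRep F Ω (Equiv.Perm (Fin 2)) | φ.IsRam v ϖ n}.ncard := by
  have hL := H.isLocal
  set t := v (algebraMap F Ω ϖ) with ht
  set w := v.comap (algebraMap F Ω) with hw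
  have hwt : w ϖ = t := rfl
  have hlt_iff : ∀ (x : F) (j : ℕ), v (algebraMap F Ω x) < t ^ j ↔
      v (algebraMap F Ω x) ≤ t ^ (j + 1) := fun x j => hL.lt_pow_iff (x := x) (n := j)
  set X : Set F := {b | v (algebraMap F Ω b) = t} with hX
  set mkX : F → F ⧸ w.ball (t ^ (n + 1)) := QuotientAddGroup.mk with hmkX
  set mkP : F → F ⧸ w.ball (t ^ (k + 1)) := QuotientAddGroup.mk with hmkP
  have hmkX' : ∀ b b', mkX b = mkX b' ↔ v (algebraMap F Ω (b - b')) < t ^ n := fun b b' => by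
    rw [hlt_iff]
    exact Valuation.mk_ball_eq
  have hmkP' : ∀ r s, mkP r = mkP s ↔ v (algebraMap F Ω (r - s)) < t ^ k := fun r s => by
    rw [hlt_iff]
    exact Valuation.mk_ball_eq
  have ht0 : 0 < t := H.pos
  have hkpos : 0 < t ^ k := pow_pos ht0 k
  have hm1 : v (algebraMap F Ω m) ≤ 1 := hmk ▸ pow_le_one' H.lt_one.le k
  have hm0 : m ≠ 0 := by
    rintro rfl
    rw [map_zero, map_zero] at hmk
    exact hkpos.ne hmk
  have hfinX : (mkX '' X).Finite := by
    refine (hL.finite_image_ball 1 (n + 1)).subset (Set.image_mono fun b hb => ?_)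
    change w b ≤ w ϖ ^ 1
    rw [pow_one]
    exact le_of_eq hb
  have hfinP : (mkP '' P).Finite := by
    refine (hL.finite_image_ball 0 (k + 1)).subset (Set.image_mono fun r hr => ?_)
    change w r ≤ w ϖ ^ 0
    rw [pow_zero]
    exact ((hP r).mp hr).1
  have hex : ∀ b : F, ∃ (α : Ω) (φ : GalRep F Ω (Equiv.Perm (Fin 2))), b ∈ X →
      α ^ 2 + algebraMap F Ω a * α + algebraMap F Ω b = 0 ∧ φ.IsGen α ∧ φ.IsRam v ϖ n := by
    intro b
    by_cases hb : b ∈ X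
    · obtain ⟨α, hα⟩ := exists_root (Ω := Ω) (a := a) (b := b) (fun h0 => by
        have h1 := hdisc b hb
        rw [h0, map_zero, map_zero] at h1
        exact (pow_pos ht0 n).ne h1)
      obtain ⟨φ, hφ, hram⟩ := H.isRam_of_root hα ha hb (hdisc b hb)
      exact ⟨α, φ, fun _ => ⟨hα, hφ, hram⟩⟩
    · exact ⟨0, ⟨1, @continuous_const _ _ _ ⊥ 1⟩, fun h => absurd h hb⟩
  choose root Φ hΦ using hex
  have hclose : ∀ {b b' : F} {α β : Ω} {φ ψ : GalRep F Ω (Equiv.Perm (Fin 2))}, b ∈ X → b' ∈ X →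
      φ.IsGen α → ψ.IsGen β → α ^ 2 + algebraMap F Ω a * α + algebraMap F Ω b = 0 →
      β ^ 2 + algebraMap F Ω a * β + algebraMap F Ω b' = 0 → mkX b = mkX b' → φ = ψ := by
    intro b b' α β φ ψ hb hb' hα hβ hab hab' hmk
    refine H.eq_of_close hα hβ hab hab' ((hdisc b' hb').trans (hdisc b hb).symm) ?_
    rw [hdisc b hb]
    exact (hmkX' b b').mp hmk
  have himgΦ : Φ '' X = {φ | φ.IsRam v ϖ n} := by
    ext φ
    constructor
    · rintro ⟨b, hb, rfl⟩
      exact (hΦ b hb).2.2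
    · intro hφ
      obtain ⟨α, b, hα, hab, hb⟩ := hcov φ hφ
      exact ⟨b, hb, hclose hb hb (hΦ b hb).2.1 hα (hΦ b hb).1 hab rfl⟩
  -- The norm of the new generator rh + (1 + rg)α. Its trace is still -a because a · rg = 2 · rh, so
  -- it is a root of X² + aX + `tw b r`. Here `m` plays the role of a greatest common divisor of 2
  -- and `a`, with cofactors `g` and `h`.
  let tw : F → F → F := fun b r => b - (h ^ 2 - g ^ 2 * b) * (r * (r + m))
  have htw_mem : ∀ b ∈ X, ∀ r ∈ P, tw b r ∈ X ∧ Φ (tw b r) = Φ b := by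
    intro b hb r hr
    obtain ⟨hα, hgen, -⟩ := hΦ b hb
    obtain ⟨-, hr2, hr3⟩ := (hP r).mp hr
    have hα2 := H.eisenstein_root hα ha hb
    set β := algebraMap F Ω (r * h) + algebraMap F Ω (1 + r * g) * root b with hβ
    have hβgen : (Φ b).IsGen β := hgen.affine (w := 1 + r * g) (u := r * h) (by
      intro h0
      rw [h0, map_zero, map_zero] at hr2
      exact zero_ne_one hr2)
    have hβroot : β ^ 2 + algebraMap F Ω a * β + algebraMap F Ω (tw b r) = 0 := by
      have e1 : (algebraMap F Ω g) * algebraMap F Ω m = 2 := by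
        rw [← map_mul, hg, map_ofNat]
      have e2 : (algebraMap F Ω h) * algebraMap F Ω m = algebraMap F Ω a := by
        rw [← map_mul, hh]
      simp only [hβ, tw, _root_.map_sub, map_add, map_mul, map_pow, map_one]
      rw [← e2] at hα ⊢
      linear_combination (1 + algebraMap F Ω r * algebraMap F Ω g) ^ 2 * hα +
        (algebraMap F Ω r * (algebraMap F Ω b * algebraMap F Ω g - algebraMap F Ω h * root b -
          algebraMap F Ω r * algebraMap F Ω g * algebraMap F Ω h * root b)) * e1
    have hβ2 : v β = v (root b) := by
      have h1 : v (algebraMap F Ω (1 + r * g) * root b) = v (root b) := by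
        rw [map_mul, hr2, one_mul]
      have h2 : v (algebraMap F Ω (r * h)) < v (algebraMap F Ω (1 + r * g) * root b) := by
        rw [h1]
        exact lt_of_le_of_lt (H.isLocal.le_of_lt _ hr3) (H.lt_of_sq hα2)
      rw [hβ, v.map_add_eq_of_lt_right h2, h1]
    have hmem : tw b r ∈ X := by
      have h1 : algebraMap F Ω (tw b r) = β * (-algebraMap F Ω a - β) := by
        linear_combination hβroot
      have h2 : v (-algebraMap F Ω a - β) = v β := by
        have h3 : v (algebraMap F Ω a) < v β := by
          rw [hβ2]
          exact lt_of_le_of_lt (H.isLocal.le_of_lt _ ha) (H.lt_of_sq hα2)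
        rw [← neg_add', Valuation.map_neg, v.map_add_eq_of_lt_right h3]
      change v (algebraMap F Ω (tw b r)) = t
      rw [h1, map_mul, h2, hβ2, ← pow_two, hα2]
    exact ⟨hmem, hclose hmem hmem (hΦ _ hmem).2.1 hβgen (hΦ _ hmem).1 hβroot rfl⟩
  -- Conversely, two roots generating the same field are related by u + cα. Equality of the traces
  -- gives a(c - 1) = 2u, and dividing by `m` leaves h(c - 1) = gu, whose solutions are the
  -- multiples `r` of (g, h).
  have htw_surj : ∀ b ∈ X, ∀ b' ∈ X, Φ b' = Φ b → ∃ r ∈ P, tw b r = b' := by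
    intro b hb b' hb' hbb
    obtain ⟨hα, hgen, ⟨σ, hσ⟩, -⟩ := hΦ b hb
    obtain ⟨hα', hgen', -⟩ := hΦ b' hb'
    rw [hbb] at hgen'
    have hα2 := H.eisenstein_root hα ha hb
    have hα2' := H.eisenstein_root hα' ha hb'
    have hvv : v (root b') = v (root b) :=
      (pow_left_inj₀ zero_le zero_le two_ne_zero).mp (hα2'.trans hα2.symm)
    obtain ⟨u, c, huc⟩ := hgen.exists_coord hσ hgen'.fixes
    obtain ⟨hu, hc⟩ := H.coord_le_of_ram hα2 u c
    rw [← huc, hvv] at hu hc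
    have hu1 : v (algebraMap F Ω u) < 1 := hu.trans_lt (H.lt_one_of_sq hα2)
    have hc1 : v (algebraMap F Ω c) = 1 := by
      have hle : v (algebraMap F Ω c) ≤ 1 := by
        rw [map_mul] at hc
        exact (mul_le_iff_le_one_left (H.pos_of_sq hα2)).mp hc
      refine hle.eq_of_not_lt fun hlt => ?_
      have h1 : v (root b') < v (root b) := by
        rw [huc]
        refine v.map_add_lt (lt_of_le_of_lt (H.isLocal.le_of_lt _ hu1) (H.lt_of_sq hα2)) ?_
        rw [map_mul]
        exact mul_lt_of_lt_one_left (H.pos_of_sq hα2) hlt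
      exact h1.ne hvv
    have hσα : σ (root b) = -algebraMap F Ω a - root b := by
      rcases root_apply hα σ with h1 | h1
      · exact absurd ((hgen σ).mpr h1) hσ
      · exact h1
    have hσα' : σ (root b') = -algebraMap F Ω a - root b' := by
      rcases root_apply hα' σ with h1 | h1
      · exact absurd ((hgen' σ).mpr h1) hσ
      · exact h1
    have htr : a * (c - 1) = 2 * u := by
      apply (algebraMap F Ω).injective
      have h1 := congrArg σ huc
      rw [map_add, map_mul, AlgEquiv.commutes, AlgEquiv.commutes, hσα, hσα', huc] at h1
      simp only [map_mul, _root_.map_sub, map_one, map_ofNat]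
      linear_combination h1
    have hgh' : h * (c - 1) = g * u := by
      apply mul_right_cancel₀ hm0
      linear_combination htr + (c - 1) * hh - u * hg
    have hb'' : b' = u ^ 2 - a * u * c + b * c ^ 2 := by
      apply (algebraMap F Ω).injective
      rw [huc] at hα'
      have htr' := congrArg (algebraMap F Ω) htr
      simp only [map_mul, _root_.map_sub, map_one, map_ofNat, map_add, map_pow] at htr' ⊢
      linear_combination hα' - algebraMap F Ω c ^ 2 * hα +
        (-algebraMap F Ω u - algebraMap F Ω c * root b) * (-htr')
    obtain ⟨r, hr1, hr2, hr3⟩ : ∃ r, v (algebraMap F Ω r) ≤ 1 ∧ c = 1 + r * g ∧ u = r * h := by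
      rcases hgh with h1 | ⟨h1, h2⟩
      · subst h1
        exact ⟨u, hu1.le, by linear_combination hgh', by ring⟩
      · subst h1 h2
        have hu0 : u = 0 := by linear_combination -hgh'
        refine ⟨c - 1, ?_, by ring, by rw [hu0]; ring⟩
        rw [_root_.map_sub]
        exact v.map_sub_le hc1.le (by simp)
    refine ⟨r, (hP r).mpr ⟨hr1, hr2 ▸ hc1, hr3 ▸ hu1⟩, ?_⟩
    rw [hb'', hr2, hr3]
    simp only [tw]
    rw [← hh]
    linear_combination (r * b * g + h ^ 2 * r ^ 2) * hg
  have h2rm : ∀ r ∈ P, v (algebraMap F Ω (2 * r + m)) = t ^ k := by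
    intro r hr
    have h1 : 2 * r + m = m * (1 + r * g) := by linear_combination -r * hg
    rw [h1, map_mul, map_mul, hmk, ((hP r).mp hr).2.1, mul_one]
  -- Two parameters give the same class exactly if they agree or belong to conjugate generators:
  -- replacing `r` by `-m - r` turns β into -a - β. The difference of the constant terms factors
  -- accordingly, and its leading factor times m² is the discriminant.
  have hmkX_tw : ∀ b ∈ X, ∀ r ∈ P, ∀ s ∈ P, mkX (tw b r) = mkX (tw b s) ↔
      (mkP s = mkP r ∨ mkP s = mkP (-m - r)) := by
    intro b hb r hr s hs
    have hκ : v (algebraMap F Ω (h ^ 2 - g ^ 2 * b)) * (t ^ k * t ^ k) = t ^ n := by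
      rw [← hdisc b hb, ← hmk, ← map_mul, ← map_mul, ← map_mul, ← map_mul]
      congr 2
      linear_combination (h * m + a) * hh - b * (g * m + 2) * hg
    have hκ0 : 0 < v (algebraMap F Ω (h ^ 2 - g ^ 2 * b)) := by
      rw [pos_iff_ne_zero]
      rintro h0
      rw [h0, zero_mul] at hκ
      exact (pow_pos ht0 n).ne hκ
    have hfac : tw b r - tw b s = (h ^ 2 - g ^ 2 * b) * ((s - r) * (s - (-m - r))) := by
      simp only [tw]
      ring
    have hxy : v (algebraMap F Ω (s - (-m - r)) - algebraMap F Ω (s - r)) = t ^ k := by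
      rw [← h2rm r hr, ← _root_.map_sub]
      congr 2
      ring
    rw [hmkX', hmkP', hmkP', hfac, map_mul, map_mul, map_mul, map_mul, ← hκ,
      mul_lt_mul_iff_right₀ hκ0]
    refine mul_lt_sq_iff_of_sub hkpos hxy
  have hfib : ∀ b ∈ X, (mkP '' P).ncard = 2 * (mkX '' {b' | b' ∈ X ∧ Φ b' = Φ b}).ncard := by
    intro b hb
    have himg : mkX '' {b' | b' ∈ X ∧ Φ b' = Φ b} = (fun r => mkX (tw b r)) '' P := by
      ext z
      constructor
      · rintro ⟨b', ⟨hb', hbb⟩, rfl⟩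
        obtain ⟨r, hr, rfl⟩ := htw_surj b hb b' hb' hbb
        exact ⟨r, hr, rfl⟩
      · rintro ⟨r, hr, rfl⟩
        exact ⟨_, htw_mem b hb r hr, rfl⟩
    rw [himg]
    refine Set.ncard_image_eq_mul_of_fibers hfinP (fun r hr s hs hrs => ?_) fun r hr => ?_
    · exact (hmkX_tw b hb r hr s hs).mpr (Or.inl hrs.symm)
    · have hr' : -m - r ∈ P := by
        obtain ⟨h1, h2, h3⟩ := (hP r).mp hr
        refine (hP _).mpr ⟨?_, ?_, ?_⟩
        · rw [_root_.map_sub, _root_.map_neg]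
          exact v.map_sub_le (by rwa [Valuation.map_neg]) h1
        · have h4 : 1 + (-m - r) * g = -(1 + r * g) := by linear_combination -hg
          rw [h4, _root_.map_neg, Valuation.map_neg, h2]
        · have h4 : (-m - r) * h = -a - r * h := by linear_combination -hh
          rw [h4, _root_.map_sub, _root_.map_neg]
          exact v.map_sub_lt (by rwa [Valuation.map_neg]) h3
      have hpair : mkP '' {s | s ∈ P ∧ mkX (tw b s) = mkX (tw b r)} = {mkP r, mkP (-m - r)} := by
        ext z
        constructor
        · rintro ⟨s, ⟨hs, hsr⟩, rfl⟩
          exact (hmkX_tw b hb r hr s hs).mp hsr.symm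
        · rintro (rfl | rfl)
          · exact ⟨r, ⟨hr, rfl⟩, rfl⟩
          · exact ⟨-m - r, ⟨hr', ((hmkX_tw b hb r hr _ hr').mpr (Or.inr rfl)).symm⟩, rfl⟩
      rw [hpair]
      -- The two parameters differ by 2r + m, whose value is exactly t^k, so they are distinct
      -- modulo t^(k+1). Each class of constant terms thus comes from two classes in `P`.
      refine Set.ncard_pair fun heq => ?_
      rw [hmkP'] at heq
      refine heq.ne ?_
      rw [← h2rm r hr]
      congr 2
      ring
  have hfin := Set.ncard_image_eq_mul_of_fibers (k := (mkP '' P).ncard / 2) hfinX (g := Φ)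
    (fun b hb b' hb' hbb => hclose hb hb' (hΦ b hb).2.1 (hΦ b' hb').2.1 (hΦ b hb).1
      (hΦ b' hb').1 hbb) (fun b hb => by rw [hfib b hb]; simp)
  -- The division is exact because `ϖ` itself is an admissible constant term.
  have heven : (mkP '' P).ncard / 2 * 2 = (mkP '' P).ncard := by
    have hϖ : ϖ ∈ X := rfl
    rw [hfib ϖ hϖ]
    simp [mul_comm]
  rw [hfin, himgΦ, mul_right_comm, heven]

end Valuation.IsLocalOver

end Strata

/-! ### Exponents of ramified characters and the size of each stratum -/

section MassFormula

variable {F Ω : Type*} [Field F] [Field Ω] [Algebra F Ω] {v : Valuation Ω ℝ≥0}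
  {ϖ : F} {φ ψ : GalRep F Ω (Equiv.Perm (Fin 2))} {α β : Ω}

open GalRep

open Classical in
/-- The conductor exponent of a quadratic character, in terms of the valuation. -/
def GalRep.ramExp (v : Valuation Ω ℝ≥0) (ϖ : F) (φ : GalRep F Ω (Equiv.Perm (Fin 2))) : ℕ :=
  if h : ∃ n, φ.IsRam v ϖ n then h.choose else 0

namespace Valuation.IsLocalOver

variable (H : v.IsLocalOver ϖ)

include H

variable [IsGalois F Ω]

/-- Two generators with the value of a uniformizer are related by β = c + dα with `d` a unit, so σβ
- β and σα - α have the same value. -/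
theorem isRam_inj {m n : ℕ} (hm : φ.IsRam v ϖ m) (hn : φ.IsRam v ϖ n) : m = n := by
  obtain ⟨⟨σ, hσ⟩, α, hα, hα2, hαn⟩ := hm
  obtain ⟨-, β, hβ, hβ2, hβn⟩ := hn
  have hvv : v β = v α := (pow_left_inj₀ zero_le zero_le two_ne_zero).mp (hβ2.trans hα2.symm)
  obtain ⟨c, d, hcd⟩ := hα.exists_coord hσ hβ.fixes
  have hc : v (algebraMap F Ω c) < v α := by
    refine lt_of_le_of_lt (H.isLocal.le_of_lt _ ?_) (H.lt_of_sq hα2)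
    refine lt_of_le_of_lt (H.coord_le_of_ram hα2 c d).1 ?_
    rw [← hcd, hvv]
    exact H.lt_one_of_sq hα2
  have hd : v (algebraMap F Ω d) = 1 := by
    have h1 : algebraMap F Ω d * α = β - algebraMap F Ω c := by rw [hcd]; ring
    have h2 : v (algebraMap F Ω d * α) = v α := by
      rw [h1, v.map_sub_eq_of_lt_left (hvv ▸ hc), hvv]
    rw [map_mul] at h2
    exact (mul_eq_right₀ (H.pos_of_sq hα2).ne').mp h2
  have h3 : σ β - β = algebraMap F Ω d * (σ α - α) := by
    rw [hcd, map_add, map_mul, AlgEquiv.commutes, AlgEquiv.commutes]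
    ring
  have h4 := hβn σ hσ
  rw [h3, map_mul, hd, one_mul, hαn σ hσ, hvv] at h4
  exact (pow_right_inj₀ (H.pos_of_sq hα2) (H.lt_one_of_sq hα2).ne).mp h4

theorem ramExp_eq {n : ℕ} (hn : φ.IsRam v ϖ n) : φ.ramExp v ϖ = n := by
  have h : ∃ n, φ.IsRam v ϖ n := ⟨n, hn⟩
  rw [ramExp, dif_pos h]
  exact H.isRam_inj h.choose_spec hn

omit H [IsGalois F Ω] in
theorem ramExp_eq_zero (h : ¬ ∃ n, φ.IsRam v ϖ n) : φ.ramExp v ϖ = 0 := dif_neg h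

theorem not_isRam_of_isUnram (hφ : φ.IsUnram v) {n : ℕ} : ¬ φ.IsRam v ϖ n := by
  rintro ⟨⟨σ, hσ⟩, β, hβ, hβ2, -⟩
  obtain ⟨-, α, hα, hα1, hσα⟩ := hφ
  obtain ⟨c, d, hcd⟩ := hα.exists_coord hσ hβ.fixes
  have h1 := H.le_of_lt_of_unram hα1 (hσα σ hσ) (c := c) (d := d) (hcd ▸ H.lt_one_of_sq hβ2)
  rw [← hcd] at h1
  exact absurd h1 (not_le.mpr (H.lt_of_sq hβ2))

theorem symmetricCount_eq {R : Type*} [CommRing R] [Algebra R F] [Algebra R Ω]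
    [IsScalarTower R F Ω] (hR : ∀ x : Ω, IsIntegral R x ↔ v x ≤ 1)
    (φ : GalRep F Ω (Equiv.Perm (Fin 2))) : symmetricCount R 2 φ = φ.ramExp v ϖ := by
  by_cases hφ : ∃ σ, φ.toHom σ ≠ 1
  · obtain ⟨σ, hσ⟩ := hφ
    rcases H.isUnram_or_isRam hσ with h | ⟨n, h⟩
    · rw [symmetricCount_unram hR h,
        ramExp_eq_zero fun ⟨n, hn⟩ => H.not_isRam_of_isUnram h hn, Nat.cast_zero]
    · rw [H.symmetricCount_ram hR h, H.ramExp_eq h]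
  · rw [ramExp_eq_zero fun ⟨n, hn⟩ => hφ hn.1, symmetricCount_trivial R (by simpa using hφ),
      Nat.cast_zero]

theorem exists_quadratic_of_isRam {n : ℕ} (hφ : φ.IsRam v ϖ n) :
    ∃ (α : Ω) (a b : F), φ.IsGen α ∧ v α ^ 2 = v (algebraMap F Ω ϖ) ∧
      α ^ 2 + algebraMap F Ω a * α + algebraMap F Ω b = 0 ∧
      v (algebraMap F Ω b) = v (algebraMap F Ω ϖ) ∧
      v (algebraMap F Ω a + 2 * α) = v α ^ n := by
  obtain ⟨⟨σ, hσ⟩, α, hα, hα2, hαn⟩ := hφ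
  obtain ⟨a, b, hab, hσα⟩ := hα.fixes.exists_quadratic hσ
  refine ⟨α, a, b, hα, hα2, hab, ?_, ?_⟩
  · have h1 : algebraMap F Ω b = α * σ α := by
      rw [hσα]
      linear_combination hab
    rw [h1, map_mul, H.map_gal, ← pow_two, hα2]
  · rw [← hαn σ hσ, hσα, ← Valuation.map_neg]
    congr 1
    ring

/-- For n = 2(s+1) the term 2α is smaller than a + 2α, so v(a) = v(ϖ)^(s+1), and scaling α by a unit
of `F` makes `a` equal to ϖ^(s+1). There are (q-1)q^(2s+1) classes of constant terms and q^(s+1)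
classes of parameters. -/
theorem ncard_isRam_even [IsSepClosed Ω] {s : ℕ}
    (hs : v (algebraMap F Ω 2) ≤ v (algebraMap F Ω ϖ) ^ (s + 1)) :
    {φ : GalRep F Ω (Equiv.Perm (Fin 2)) | φ.IsRam v ϖ (2 * (s + 1))}.ncard =
      2 * ((v.comap (algebraMap F Ω)).residueCard ϖ - 1) *
        (v.comap (algebraMap F Ω)).residueCard ϖ ^ s := by
  have hL := H.isLocal
  set t := v (algebraMap F Ω ϖ) with ht
  set w := v.comap (algebraMap F Ω) with hw
  set q := w.residueCard ϖ with hq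
  have hwt : w ϖ = t := rfl
  have ht0 : 0 < t := H.pos
  have hpow : v (algebraMap F Ω (ϖ ^ (s + 1))) = t ^ (s + 1) := by rw [map_pow, map_pow]
  have h0 : ϖ ^ (s + 1) ≠ 0 := pow_ne_zero _ hL.ne_zero
  have hg1 : v (algebraMap F Ω (2 / ϖ ^ (s + 1))) ≤ 1 := by
    rw [map_div₀, map_div₀, hpow]
    exact div_le_one_of_le₀ hs zero_le
  have key := H.ncard_isRam_of_family (a := ϖ ^ (s + 1)) (m := ϖ ^ (s + 1)) (g := 2 / ϖ ^ (s + 1))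
    (h := 1) (k := s + 1) (n := 2 * (s + 1)) (P := w.ball (t ^ 1))
    (by field_simp) (by ring) (Or.inl rfl)
    (by rw [hpow]; exact pow_lt_one₀ zero_le H.lt_one (Nat.succ_ne_zero s)) hpow ?_ ?_ ?_
  · have h1 := hL.ncard_sphere 1 (2 * s + 1)
    have h2 := hL.ncard_ball 1 (s + 1)
    have e1 : 1 + (2 * s + 1 + 1) = 2 * (s + 1) + 1 := by ring
    rw [hwt, e1, pow_one] at h1
    rw [hwt, add_comm 1 (s + 1)] at h2
    have key' : (q - 1) * q ^ (2 * s + 1) * 2 = q ^ (s + 1) *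
        {φ : GalRep F Ω (Equiv.Perm (Fin 2)) | φ.IsRam v ϖ (2 * (s + 1))}.ncard := by
      rw [← h1, ← h2]
      exact key
    have hq0 : 0 < q ^ (s + 1) := pow_pos (Nat.pos_of_ne_zero hL.card_ne_zero) _
    refine Nat.eq_of_mul_eq_mul_left hq0 ?_
    rw [← key']
    ring
  · intro b hb
    have h1 : v (algebraMap F Ω (4 * b)) < v (algebraMap F Ω ((ϖ ^ (s + 1)) ^ 2)) := by
      have e : (4 : F) * b = 2 * 2 * b := by ring
      rw [e, map_mul, map_mul, map_mul, map_mul, hb, map_pow, map_pow, hpow]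
      refine lt_of_le_of_lt (mul_le_mul' (mul_le_mul' hs hs) le_rfl) ?_
      rw [pow_two]
      exact mul_lt_of_lt_one_right (by positivity) H.lt_one
    rw [_root_.map_sub, v.map_sub_eq_of_lt_left h1, map_pow, map_pow, hpow, ← pow_mul, mul_comm]
  · intro r
    rw [SetLike.mem_coe, Valuation.mem_ball, pow_one, mul_one]
    have hrt : w r ≤ t ↔ w r < 1 := hL.lt_one_iff.symm
    rw [hrt]
    refine ⟨fun h => ⟨le_of_lt h, ?_, h⟩, fun h => h.2.2⟩
    rw [map_add, v.map_add_eq_of_lt_left, map_one, map_one]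
    rw [map_one, map_one, map_mul, map_mul]
    exact lt_of_le_of_lt (mul_le_mul' le_rfl hg1) (by rwa [mul_one])
  · intro φ hφ
    obtain ⟨α, a, b, hα, hα2, hab, hb, hn⟩ := H.exists_quadratic_of_isRam hφ
    rw [pow_mul, hα2] at hn
    have h2α : v (2 * α) < t ^ (s + 1) := by
      rw [← map_ofNat (algebraMap F Ω) 2, map_mul]
      refine lt_of_le_of_lt (mul_le_mul' hs le_rfl) ?_
      exact mul_lt_of_lt_one_right (by positivity) (H.lt_one_of_sq hα2)
    have ha : v (algebraMap F Ω a) = t ^ (s + 1) := by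
      rw [← hn, ← add_sub_cancel_right (algebraMap F Ω a) (2 * α), v.map_sub_eq_of_lt_left,
        add_sub_cancel_right]
      rwa [hn]
    have ha0 : a ≠ 0 := by
      rintro rfl
      rw [map_zero, map_zero] at ha
      exact (pow_pos ht0 _).ne ha
    have hu : v (algebraMap F Ω (ϖ ^ (s + 1) / a)) = 1 := by
      rw [map_div₀, map_div₀, hpow, ha, div_self (pow_pos ht0 _).ne']
    have hu0 : ϖ ^ (s + 1) / a ≠ 0 := div_ne_zero h0 ha0
    have hgen := hα.affine (w := ϖ ^ (s + 1) / a) (u := 0) hu0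
    rw [map_zero, zero_add] at hgen
    refine ⟨_, (ϖ ^ (s + 1) / a) ^ 2 * b, hgen, ?_, ?_⟩
    · have hua : algebraMap F Ω (ϖ ^ (s + 1)) =
          algebraMap F Ω (ϖ ^ (s + 1) / a) * algebraMap F Ω a := by
        rw [← map_mul, div_mul_cancel₀ _ ha0]
      rw [map_mul, map_pow _ (_ / _), hua]
      linear_combination algebraMap F Ω (ϖ ^ (s + 1) / a) ^ 2 * hab
    · rw [map_mul, map_mul, map_pow, map_pow, hu, one_pow, one_mul, hb]

/-- For n = 2e+1 the square can be completed without leaving the uniformizers, so a = 0. There are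
(q-1)q^(2e) classes of constant terms, and (q-1)q^e classes of parameters `r`, those with 1 + r a
unit. -/
theorem ncard_isRam_odd [IsSepClosed Ω] {e : ℕ}
    (he : v (algebraMap F Ω 2) = v (algebraMap F Ω ϖ) ^ e) :
    {φ : GalRep F Ω (Equiv.Perm (Fin 2)) | φ.IsRam v ϖ (2 * e + 1)}.ncard =
      2 * (v.comap (algebraMap F Ω)).residueCard ϖ ^ e := by
  have hL := H.isLocal
  set t := v (algebraMap F Ω ϖ) with ht
  set w := v.comap (algebraMap F Ω) with hw
  set q := w.residueCard ϖ with hq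
  have hwt : w ϖ = t := rfl
  have ht0 : 0 < t := H.pos
  have h20 : (2 : F) ≠ 0 := by
    intro h0
    rw [h0, map_zero, map_zero] at he
    exact (pow_pos ht0 e).ne he
  have key := H.ncard_isRam_of_family (a := 0) (m := 2) (g := 1)
    (h := 0) (k := e) (n := 2 * e + 1) (P := {r | w (r + 1) = w ϖ ^ 0})
    (by ring) (by ring) (Or.inr ⟨rfl, rfl⟩) (by simp) he ?_ ?_ ?_
  · have h1 := hL.ncard_sphere 1 (2 * e)
    have h2 := hL.ncard_sphere 0 e
    have e1 : 1 + (2 * e + 1) = 2 * e + 1 + 1 := by ring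
    rw [hwt, e1, pow_one] at h1
    rw [zero_add, hwt] at h2
    -- The parameter set is the unit sphere translated by -1.
    have h3 : (QuotientAddGroup.mk : F → F ⧸ w.ball (t ^ (e + 1))) ''
        {r | w (r + 1) = t ^ 0} = (fun z => z + QuotientAddGroup.mk (-1)) ''
          ((QuotientAddGroup.mk : F → F ⧸ w.ball (t ^ (e + 1))) '' {r | w r = t ^ 0}) := by
      rw [Set.image_image]
      ext z
      constructor
      · rintro ⟨r, hr, rfl⟩
        refine ⟨r + 1, hr, ?_⟩
        change ((r + 1 : F) : F ⧸ w.ball (t ^ (e + 1))) + ((-1 : F) : F ⧸ w.ball (t ^ (e + 1))) = _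
        rw [← QuotientAddGroup.mk_add]
        congr 1
        ring
      · rintro ⟨r, hr, rfl⟩
        refine ⟨r - 1, ?_, ?_⟩
        · simpa using hr
        · rw [sub_eq_add_neg, QuotientAddGroup.mk_add]
    have h4 := congrArg Set.ncard h3
    rw [Set.ncard_image_of_injective _ (add_left_injective _), h2] at h4
    have key' : (q - 1) * q ^ (2 * e) * 2 = (q - 1) * q ^ e *
        {φ : GalRep F Ω (Equiv.Perm (Fin 2)) | φ.IsRam v ϖ (2 * e + 1)}.ncard := by
      rw [← h1, ← h4]
      exact key
    have hq1 : 0 < q - 1 := Nat.sub_pos_of_lt hL.one_lt_card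
    have hq0 : 0 < (q - 1) * q ^ e :=
      Nat.mul_pos hq1 (pow_pos (Nat.pos_of_ne_zero hL.card_ne_zero) _)
    refine Nat.eq_of_mul_eq_mul_left hq0 ?_
    rw [← key']
    ring
  · intro b hb
    have e1 : (0 : F) ^ 2 - 4 * b = -(2 * 2 * b) := by ring
    rw [e1, _root_.map_neg, Valuation.map_neg, map_mul, map_mul, map_mul, map_mul, he, hb]
    ring
  · intro r
    rw [Set.mem_ofPred_eq, pow_zero, mul_one, mul_zero, map_zero, map_zero, add_comm r 1]
    refine ⟨fun h => ⟨?_, h, one_pos⟩, fun h => h.2.1⟩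
    have h1 : r = (1 + r) - 1 := by ring
    change w r ≤ 1
    rw [h1]
    exact w.map_sub_le h.le (by simp)
  · intro φ hφ
    obtain ⟨α, a, b, hα, hα2, hab, hb, hn⟩ := H.exists_quadratic_of_isRam hφ
    have h2 : v (2 : Ω) = t ^ e := by rw [← he, map_ofNat (algebraMap F Ω)]
    have h20' : (2 : Ω) ≠ 0 := by
      rw [← map_ofNat (algebraMap F Ω) 2]
      simpa using h20
    have hα0 := H.pos_of_sq hα2
    have h3 : v (algebraMap F Ω a) ≤ t ^ e * v α := by
      have h4 : v (algebraMap F Ω a + 2 * α) = t ^ e * v α := by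
        rw [hn, pow_succ, pow_mul, hα2]
      have h5 : v (2 * α) = t ^ e * v α := by rw [map_mul, h2]
      rw [← add_sub_cancel_right (algebraMap F Ω a) (2 * α)]
      exact v.map_sub_le h4.le h5.le
    have h4 : v (algebraMap F Ω (a / 2)) < v α := by
      refine lt_of_le_of_ne ?_ fun h => H.sq_ne (a := a / 2) (by rw [h, hα2])
      rw [map_div₀, map_div₀, he, div_le_iff₀ (pow_pos ht0 e), mul_comm]
      exact h3
    have hgen := hα.affine (w := 1) (u := a / 2) one_ne_zero
    rw [map_one, one_mul] at hgen
    have ha2 : 2 * algebraMap F Ω (a / 2) = algebraMap F Ω a := by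
      rw [← map_ofNat (algebraMap F Ω) 2, ← map_mul, mul_div_cancel₀ _ h20]
    have hroot : (algebraMap F Ω (a / 2) + α) ^ 2 + algebraMap F Ω 0 * (algebraMap F Ω (a / 2) + α) +
        algebraMap F Ω (b - (a / 2) ^ 2) = 0 := by
      rw [map_zero, _root_.map_sub, map_pow]
      linear_combination hab + α * ha2
    refine ⟨_, b - (a / 2) ^ 2, hgen, hroot, ?_⟩
    have h5 : algebraMap F Ω (b - (a / 2) ^ 2) = -(algebraMap F Ω (a / 2) + α) ^ 2 := by
      rw [map_zero] at hroot
      linear_combination hroot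
    rw [h5, Valuation.map_neg, map_pow, v.map_add_eq_of_lt_right h4, hα2]

/-- In v(a + 2α) = v(α)^n, nonzero terms `a` and 2α have an even and an odd exponent respectively,
so the larger one decides. If `a` dominates, n is even and 2 is small; if 2α dominates, n = 2e+1
with v(2) = v(ϖ)^e. -/
theorem exponent_of_isRam {n : ℕ} (hφ : φ.IsRam v ϖ n) :
    (∃ s, n = 2 * (s + 1) ∧ v (algebraMap F Ω 2) ≤ v (algebraMap F Ω ϖ) ^ (s + 1)) ∨
      ∃ e, n = 2 * e + 1 ∧ v (algebraMap F Ω 2) = v (algebraMap F Ω ϖ) ^ e := by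
  have hL := H.isLocal
  obtain ⟨α, a, b, hα, hα2, hab, hb, hn⟩ := H.exists_quadratic_of_isRam hφ
  have hα0 := H.pos_of_sq hα2
  have hα1 := H.lt_one_of_sq hα2
  have hinj : ∀ {i j : ℕ}, v α ^ i = v α ^ j → i = j := fun h =>
    (pow_right_inj₀ hα0 hα1.ne).mp h
  have h21 : v (algebraMap F Ω 2) ≤ 1 := by
    rw [map_ofNat, ← one_add_one_eq_two]
    exact v.map_add_le (by simp) (by simp)
  have heven : v (algebraMap F Ω a + 2 * α) = v (algebraMap F Ω a) →
      v (2 * α) < v (algebraMap F Ω a) →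
      (∃ s, n = 2 * (s + 1) ∧ v (algebraMap F Ω 2) ≤ v (algebraMap F Ω ϖ) ^ (s + 1)) := by
    intro h hlt
    have ha0 : a ≠ 0 := by
      rintro rfl
      rw [map_zero, map_zero] at hlt
      exact not_lt_zero hlt
    have ha1 : v (algebraMap F Ω a) < 1 := by
      by_contra! h1
      have h2 : v α < v (algebraMap F Ω a) := hα1.trans_le h1
      have h3 : v (α * (-algebraMap F Ω a - α)) = v (algebraMap F Ω b) := by
        congr 1
        linear_combination -hab
      rw [map_mul, ← neg_add', Valuation.map_neg, v.map_add_eq_of_lt_left h2, hb, ← hα2,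
        pow_two] at h3
      exact h2.ne' (mul_left_cancel₀ hα0.ne' h3)
    obtain ⟨k, hk⟩ := hL.exists_pow ha0 ha1.le
    simp only [Valuation.comap_apply] at hk
    have hnk : n = 2 * k := by
      apply hinj
      rw [← hn, h, hk, ← hα2, pow_mul]
    have hk0 : k ≠ 0 := by
      rintro rfl
      rw [pow_zero] at hk
      exact ha1.ne hk
    obtain ⟨s, rfl⟩ := Nat.exists_eq_succ_of_ne_zero hk0
    refine ⟨s, hnk, ?_⟩
    rcases eq_or_ne (2 : F) 0 with h0 | h0
    · rw [h0, map_zero, map_zero]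
      exact zero_le
    · obtain ⟨e, he⟩ := hL.exists_pow h0 h21
      simp only [Valuation.comap_apply] at he
      rw [he]
      refine hL.pow_le_pow_iff.mpr ?_
      rw [← map_ofNat (algebraMap F Ω) 2, map_mul, he, hk, ← hα2, ← pow_mul, ← pow_mul,
        ← pow_succ] at hlt
      have := (pow_lt_pow_iff_right_of_lt_one₀ hα0 hα1).mp hlt
      omega
  rcases eq_or_ne (2 : F) 0 with h0 | h0
  · have h0' : (2 : Ω) = 0 := by rw [← map_ofNat (algebraMap F Ω) 2, h0, map_zero]
    left
    refine heven (by rw [h0', zero_mul, add_zero]) ?_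
    rw [h0', zero_mul, map_zero, pos_iff_ne_zero]
    intro h1
    rw [h0', zero_mul, add_zero, h1] at hn
    exact (pow_pos hα0 n).ne hn
  · have h2 : (2 : Ω) = algebraMap F Ω 2 := (map_ofNat (algebraMap F Ω) 2).symm
    rcases lt_or_gt_of_ne (H.sq_mul_ne (a := a) h0 hα2) with h | h
    · right
      obtain ⟨e, he⟩ := hL.exists_pow h0 h21
      simp only [Valuation.comap_apply] at he
      refine ⟨e, hinj ?_, he⟩
      rw [← hn, h2, v.map_add_eq_of_lt_right h, map_mul, he, pow_succ, pow_mul, hα2]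
    · left
      rw [← h2] at h
      exact heven (v.map_add_eq_of_lt_left h) h

end Valuation.IsLocalOver

end MassFormula

/-! ### Geometric sums -/

section GeometricSums

open scoped ENNReal

/-- With x = 1/q and y = 1 - 1/q this is the mass in characteristic two, where all positive even
exponents occur. -/
theorem ENNReal.tsum_geometric_complement {x y : ℝ≥0∞} (hxy : x + y = 1) (hx : x ≠ 1) :
    ∑' s : ℕ, 2 * y * x ^ (s + 1) = 2 * x := by
  have hx1 : x ≤ 1 := hxy ▸ le_self_add
  have hy : 1 - x = y := by
    rw [← hxy, ENNReal.add_sub_cancel_left (hx1.trans_lt one_lt_top).ne]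
  have hy0 : y ≠ 0 := by
    rintro rfl
    exact hx (by simpa using hxy)
  have hyt : y ≠ ⊤ := by
    rintro rfl
    simp at hxy
  simp_rw [pow_succ', ← mul_assoc]
  rw [ENNReal.tsum_mul_left, ENNReal.tsum_geometric, hy, mul_right_comm,
    mul_assoc 2 y, ENNReal.mul_inv_cancel hy0 hyt, mul_one]

/-- A telescoping sum, since multiplying by `y` amounts to multiplying by 1 - x. The extra term is
the mass of the single odd exponent 2e+1. -/
theorem ENNReal.sum_geometric_complement {x y : ℝ≥0∞} (hxy : x + y = 1) (e : ℕ) :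
    ∑ s ∈ Finset.range e, 2 * y * x ^ (s + 1) + 2 * x ^ (e + 1) = 2 * x := by
  induction e with
  | zero => simp
  | succ e ih =>
    rw [Finset.sum_range_succ, add_assoc, ← ih]
    congr 1
    calc 2 * y * x ^ (e + 1) + 2 * x ^ (e + 1 + 1) = 2 * x ^ (e + 1) * (x + y) := by ring
      _ = 2 * x ^ (e + 1) := by rw [hxy, mul_one]

end GeometricSums

/-! ### The mass formula for quadratic characters -/

section MassFormula

open scoped ENNReal

variable {F Ω : Type*} [Field F] [Field Ω] [Algebra F Ω] {v : Valuation Ω ℝ≥0} {ϖ : F}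

open GalRep

namespace Valuation.IsLocalOver

variable [IsGalois F Ω]

variable (H : v.IsLocalOver ϖ)

include H

theorem encard_mul_pow_even [IsSepClosed Ω] {s : ℕ}
    (hs : v (algebraMap F Ω 2) ≤ v (algebraMap F Ω ϖ) ^ (s + 1)) {x : ℝ≥0∞}
    (hx : ((v.comap (algebraMap F Ω)).residueCard ϖ : ℝ≥0∞) * x = 1) :
    ({φ : GalRep F Ω (Equiv.Perm (Fin 2)) | φ.IsRam v ϖ (2 * (s + 1))}.encard : ℝ≥0∞) *
      x ^ (2 * (s + 1)) =
        2 * (((v.comap (algebraMap F Ω)).residueCard ϖ - 1 : ℕ) * x) * x ^ (s + 1) := by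
  have hL := H.isLocal
  have hcard := H.ncard_isRam_even hs
  set q := (v.comap (algebraMap F Ω)).residueCard ϖ
  have h0 : 2 * (q - 1) * q ^ s ≠ 0 := by
    have h1 : 0 < q - 1 := Nat.sub_pos_of_lt hL.one_lt_card
    have h2 : 0 < q := Nat.pos_of_ne_zero hL.card_ne_zero
    positivity
  have hfin := Set.finite_of_ncard_ne_zero (hcard ▸ h0)
  rw [← hfin.cast_ncard_eq, hcard]
  push_cast
  have e1 : (q : ℝ≥0∞) ^ s * x ^ (2 * (s + 1)) = x * x ^ (s + 1) := by
    have e2 : 2 * (s + 1) = s + (s + 2) := by ring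
    rw [e2, pow_add x s, ← mul_assoc, ← mul_pow, hx, one_pow, one_mul]
    ring
  rw [mul_assoc, e1]
  ring

theorem encard_mul_pow_odd [IsSepClosed Ω] {e : ℕ}
    (he : v (algebraMap F Ω 2) = v (algebraMap F Ω ϖ) ^ e) {x : ℝ≥0∞}
    (hx : ((v.comap (algebraMap F Ω)).residueCard ϖ : ℝ≥0∞) * x = 1) :
    ({φ : GalRep F Ω (Equiv.Perm (Fin 2)) | φ.IsRam v ϖ (2 * e + 1)}.encard : ℝ≥0∞) *
      x ^ (2 * e + 1) = 2 * x ^ (e + 1) := by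
  have hL := H.isLocal
  have hcard := H.ncard_isRam_odd he
  set q := (v.comap (algebraMap F Ω)).residueCard ϖ
  have h0 : 2 * q ^ e ≠ 0 := by
    have h2 : 0 < q := Nat.pos_of_ne_zero hL.card_ne_zero
    positivity
  have hfin := Set.finite_of_ncard_ne_zero (hcard ▸ h0)
  rw [← hfin.cast_ncard_eq, hcard]
  push_cast
  have e1 : (q : ℝ≥0∞) ^ e * x ^ (2 * e + 1) = x ^ (e + 1) := by
    have e2 : 2 * e + 1 = e + (e + 1) := by ring
    rw [e2, pow_add x e, ← mul_assoc, ← mul_pow, hx, one_pow, one_mul]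
  rw [mul_assoc, e1]

/-- If 2 = 0 in `F`, the strata are the even exponents 2(s+1) for all s. Otherwise they are those
with s < e and the odd exponent 2e+1, where v(2) = v(ϖ)^e. Both give geometric sums with the same
value. -/
theorem tsum_encard_isRam [IsSepClosed Ω] {x : ℝ≥0∞}
    (hx : ((v.comap (algebraMap F Ω)).residueCard ϖ : ℝ≥0∞) * x = 1) :
    ∑' n : ℕ, ({φ : GalRep F Ω (Equiv.Perm (Fin 2)) | φ.IsRam v ϖ n}.encard : ℝ≥0∞) * x ^ n =
      2 * x := by
  have hL := H.isLocal
  set A : ℕ → ℝ≥0∞ := fun n =>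
    ({φ : GalRep F Ω (Equiv.Perm (Fin 2)) | φ.IsRam v ϖ n}.encard : ℝ≥0∞) * x ^ n with hA
  set q := (v.comap (algebraMap F Ω)).residueCard ϖ with hq
  set y : ℝ≥0∞ := ((q - 1 : ℕ) : ℝ≥0∞) * x with hy
  have hxy : x + y = 1 := by
    rw [← hx, hy]
    nth_rewrite 1 [← one_mul x]
    rw [← add_mul, ← Nat.cast_one, ← Nat.cast_add, Nat.add_sub_cancel' hL.one_lt_card.le]
  have hx1 : x ≠ 1 := by
    rintro rfl
    rw [mul_one, Nat.cast_eq_one] at hx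
    exact hL.one_lt_card.ne' hx
  have hzero : ∀ n, (¬ ∃ φ : GalRep F Ω (Equiv.Perm (Fin 2)), φ.IsRam v ϖ n) → A n = 0 := by
    intro n hn
    have h1 : {φ : GalRep F Ω (Equiv.Perm (Fin 2)) | φ.IsRam v ϖ n} = ∅ :=
      Set.eq_empty_of_forall_notMem fun φ hφ => hn ⟨φ, hφ⟩
    rw [hA]
    simp [h1]
  have h20 : v (algebraMap F Ω 2) ≤ 1 := by
    rw [map_ofNat (algebraMap F Ω), ← one_add_one_eq_two]
    exact v.map_add_le (by simp) (by simp)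
  have hsplit : ∑' n, A n = ∑' s, A (2 * (s + 1)) + ∑' s, A (2 * s + 1) := by
    rw [← tsum_even_add_odd ENNReal.summable ENNReal.summable]
    congr 1
    -- The exponent 0 does not occur, which allows the shift to 2(s+1).
    rw [tsum_eq_zero_add' ENNReal.summable, mul_zero, hzero 0, zero_add]
    rintro ⟨φ, hφ⟩
    rcases H.exponent_of_isRam hφ with ⟨s, hs, -⟩ | ⟨e, he, -⟩ <;> omega
  rw [hsplit]
  rcases eq_or_ne (2 : F) 0 with h0 | h0
  · have h2 : v (algebraMap F Ω 2) = 0 := by rw [h0, map_zero, map_zero]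
    have hodd : ∀ s, A (2 * s + 1) = 0 := by
      intro s
      refine hzero _ ?_
      rintro ⟨φ, hφ⟩
      rcases H.exponent_of_isRam hφ with ⟨s, hs, -⟩ | ⟨e, -, he⟩
      · omega
      · rw [h2] at he
        exact (pow_pos H.pos e).ne he
    have heven : ∀ s, A (2 * (s + 1)) = 2 * y * x ^ (s + 1) := fun s =>
      H.encard_mul_pow_even (by rw [h2]; exact zero_le) hx
    simp_rw [hodd, heven, tsum_zero, add_zero]
    exact ENNReal.tsum_geometric_complement hxy hx1
  · obtain ⟨e, he⟩ := hL.exists_pow h0 h20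
    simp only [Valuation.comap_apply] at he
    have hodd : ∀ s, s ≠ e → A (2 * s + 1) = 0 := by
      intro s hse
      refine hzero _ ?_
      rintro ⟨φ, hφ⟩
      rcases H.exponent_of_isRam hφ with ⟨s, hs, -⟩ | ⟨e', hs', he'⟩
      · omega
      · rw [he] at he'
        have := hL.pow_inj.mp he'
        omega
    have heven : ∀ s, s ∉ Finset.range e → A (2 * (s + 1)) = 0 := by
      intro s hse
      refine hzero _ ?_
      rintro ⟨φ, hφ⟩
      rw [Finset.mem_range] at hse
      rcases H.exponent_of_isRam hφ with ⟨s', hs', he'⟩ | ⟨e', hs', -⟩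
      · rw [he] at he'
        have := hL.pow_le_pow_iff.mp he'
        omega
      · omega
    rw [tsum_eq_single e hodd, tsum_eq_sum heven, ← ENNReal.sum_geometric_complement hxy e]
    congr 1
    · refine Finset.sum_congr rfl fun s hs => H.encard_mul_pow_even ?_ hx
      rw [he]
      exact hL.pow_le_pow_iff.mpr (Finset.mem_range.mp hs)
    · exact H.encard_mul_pow_odd he hx

/-- There is one trivial and one unramified character, and the ramified ones have total mass 2x. The
values `a`, `b`, `c` are left free so that the lemma also applies to the masses of the fibres over
the quotient character of a wreath representation. -/
theorem tsum_of_cases [IsSepClosed Ω] {x : ℝ≥0∞}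
    (hx : ((v.comap (algebraMap F Ω)).residueCard ϖ : ℝ≥0∞) * x = 1)
    {f : GalRep F Ω (Equiv.Perm (Fin 2)) → ℝ≥0∞} {a b c : ℝ≥0∞}
    (ha : ∀ φ, (∀ σ, φ.toHom σ = 1) → f φ = a) (hb : ∀ φ, φ.IsUnram v → f φ = b)
    (hc : ∀ φ n, φ.IsRam v ϖ n → f φ = x ^ n * c) :
    ∑' φ, f φ = a + b + 2 * x * c := by
  classical
  obtain ⟨u, hu⟩ := H.exists_isUnram
  let φ₀ : GalRep F Ω (Equiv.Perm (Fin 2)) := ⟨1, @continuous_const _ _ _ ⊥ 1⟩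
  have hφ₀ : ∀ σ, φ₀.toHom σ = 1 := fun σ => rfl
  have hu0 : u ≠ φ₀ := by
    rintro rfl
    obtain ⟨⟨σ, hσ⟩, -⟩ := hu
    exact hσ rfl
  -- The inner sum has at most one nonzero term; written this way, the sums over characters and
  -- exponents can be exchanged.
  have hsplit : ∀ φ : GalRep F Ω (Equiv.Perm (Fin 2)), f φ =
      ((if φ = φ₀ then a else 0) + if φ = u then b else 0) +
        (∑' n : ℕ, if φ.IsRam v ϖ n then x ^ n else 0) * c := by
    intro φ
    by_cases hram : ∃ n, φ.IsRam v ϖ n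
    · obtain ⟨n, hn⟩ := hram
      have h1 : φ ≠ φ₀ := by
        rintro rfl
        obtain ⟨⟨σ, hσ⟩, -⟩ := hn
        exact hσ rfl
      have h2 : φ ≠ u := by
        rintro rfl
        exact H.not_isRam_of_isUnram hu hn
      rw [if_neg h1, if_neg h2, hc φ n hn, tsum_eq_single n fun m hm =>
        if_neg fun h => hm (H.isRam_inj h hn), if_pos hn, add_zero, zero_add]
    · have h1 : ∀ n, (if φ.IsRam v ϖ n then x ^ n else 0) = 0 := fun n =>
        if_neg fun h => hram ⟨n, h⟩
      simp_rw [h1, tsum_zero, zero_mul, add_zero]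
      by_cases hφ : ∃ σ, φ.toHom σ ≠ 1
      · obtain ⟨σ, hσ⟩ := hφ
        rcases H.isUnram_or_isRam hσ with h | h
        · rw [H.eq_of_isUnram h hu, if_neg hu0, if_pos rfl, zero_add, hb u hu]
        · exact absurd h hram
      · push Not at hφ
        have h2 : φ = φ₀ := eq_of_forall_eq_one_iff fun σ => by rw [hφ, hφ₀]
        rw [h2, if_pos rfl, if_neg hu0.symm, add_zero, ha φ₀ hφ₀]
  simp_rw [hsplit]
  rw [ENNReal.tsum_add, ENNReal.tsum_add, tsum_ite_eq, tsum_ite_eq, ENNReal.tsum_mul_right,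
    ENNReal.tsum_comm, ← H.tsum_encard_isRam hx]
  congr 2
  refine tsum_congr fun n => ?_
  rw [← ENNReal.tsum_set_const, tsum_subtype {φ : GalRep F Ω (Equiv.Perm (Fin 2)) |
    φ.IsRam v ϖ n} fun _ => x ^ n]
  exact tsum_congr fun φ => by simp [Set.indicator]

/-- Serre's mass formula for quadratic characters, including the unramified ones. -/
theorem tsum_ramExp [IsSepClosed Ω] {x : ℝ≥0∞}
    (hx : ((v.comap (algebraMap F Ω)).residueCard ϖ : ℝ≥0∞) * x = 1) :
    ∑' φ : GalRep F Ω (Equiv.Perm (Fin 2)), x ^ φ.ramExp v ϖ = 2 + 2 * x := by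
  rw [H.tsum_of_cases hx (a := 1) (b := 1) (c := 1), one_add_one_eq_two, mul_one]
  · intro φ hφ
    rw [ramExp_eq_zero fun ⟨n, ⟨σ, hσ⟩, _⟩ => hσ (hφ σ), pow_zero]
  · intro φ hφ
    rw [ramExp_eq_zero fun ⟨n, hn⟩ => H.not_isRam_of_isUnram hφ hn, pow_zero]
  · intro φ n hn
    rw [H.ramExp_eq hn, mul_one]

end Valuation.IsLocalOver

end MassFormula

/-! ### Inertia and its orbits on the blocks -/

section Inertia

open scoped Pointwise

variable {F Ω : Type*} [Field F] [Field Ω] [Algebra F Ω] {v : Valuation Ω ℝ≥0}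
  {ϖ : F} {φ ψ : GalRep F Ω (Equiv.Perm (Fin 2))} {α β : Ω}

open GalRep

namespace Valuation.IsLocalOver

/-- The action of the Galois group on the integers of `Ω`. -/
abbrev galAction (H : v.IsLocalOver ϖ) : MulSemiringAction Gal(Ω/F) v.valuationSubring where
  smul σ x := ⟨σ x, (H.map_gal σ x).trans_le x.2⟩
  one_smul _ := rfl
  mul_smul _ _ _ := rfl
  smul_zero σ := Subtype.ext (map_zero σ)
  smul_add σ _ _ := Subtype.ext (map_add σ _ _)
  smul_one σ := Subtype.ext (map_one σ)
  smul_mul σ _ _ := Subtype.ext (map_mul σ _ _)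

variable [IsGalois F Ω]

/-- An element σ with φ(σ) ≠ 1 acts trivially on the residues of the integers fixed by the kernel of
`φ`. That kernel surjects onto the automorphisms of the residue field of `Ω` over these residues, so
σ can be corrected by an element of the kernel to act trivially on all residues. -/
theorem exists_inertia (H : v.IsLocalOver ϖ) {n : ℕ} (hφ : φ.IsRam v ϖ n) :
    ∃ τ : Gal(Ω/F), φ.toHom τ ≠ 1 ∧ ∀ x, v x ≤ 1 → v (τ x - x) < 1 := by
  -- A positive exponent is what makes v(σα - α) = v(α)^n less than 1.
  have hn : n ≠ 0 := by
    rcases H.exponent_of_isRam hφ with ⟨s, rfl, -⟩ | ⟨e, rfl, -⟩ <;> simp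
  obtain ⟨⟨σ, hσ⟩, α, hα, hα2, hαn⟩ := hφ
  have hsmall : ∀ x, φ.Fixes x → v x ≤ 1 → v (σ x - x) < 1 := by
    intro x hx hx1
    obtain ⟨c, d, rfl⟩ := hα.exists_coord hσ hx
    have h1 := H.le_one_of_mul_le_one hα2 ((H.coord_le_of_ram hα2 c d).2.trans hx1)
    have h2 : σ (algebraMap F Ω c + algebraMap F Ω d * α) -
        (algebraMap F Ω c + algebraMap F Ω d * α) = algebraMap F Ω d * (σ α - α) := by
      rw [map_add, map_mul, AlgEquiv.commutes, AlgEquiv.commutes]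
      ring
    rw [h2, map_mul, hαn σ hσ]
    exact mul_lt_one_of_nonneg_of_lt_one_right h1 zero_le
      (pow_lt_one₀ zero_le (H.lt_one_of_sq hα2) hn)
  let B := v.valuationSubring
  let _ : MulSemiringAction Gal(Ω/F) B := H.galAction
  let _ : TopologicalSpace B := ⊥
  have : DiscreteTopology B := ⟨rfl⟩
  let G := φ.toHom.ker
  let A := FixedPoints.subalgebra ℤ B G
  let Q := IsLocalRing.maximalIdeal B
  have hmk : ∀ x y : B, Ideal.Quotient.mk Q x = Ideal.Quotient.mk Q y ↔ v ((x : Ω) - y) < 1 :=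
    fun x y => residue_eq_iff
  have hGclosed : IsClosed (G : Set Gal(Ω/F)) :=
    Subgroup.isClosed_of_isOpen _ (φ.isOpen_preimage {1})
  have : CompactSpace G := isCompact_iff_compactSpace.mp hGclosed.isCompact
  have : ContinuousSMul Gal(Ω/F) B := by
    refine continuousSMul_iff_stabilizer_isOpen.mpr fun x => ?_
    convert stabilizer_isOpen_of_isIntegral (K := F) (x : Ω) using 1
    ext τ
    exact Subtype.ext_iff
  have : Algebra.IsInvariant A B G := ⟨fun b hb => ⟨⟨b, hb⟩, rfl⟩⟩
  have hQ : Q = Q.map (MulSemiringAction.toRingEquiv Gal(Ω/F) B σ : B →+* B) :=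
    (IsLocalRing.eq_maximalIdeal
      (Ideal.map_isMaximal_of_equiv (MulSemiringAction.toRingEquiv Gal(Ω/F) B σ))).symm
  let e : (B ⧸ Q) ≃+* (B ⧸ Q) := Ideal.quotientEquiv Q Q (MulSemiringAction.toRingEquiv _ B σ) hQ
  let e' : (B ⧸ Q) ≃ₐ[A ⧸ Q.under A] (B ⧸ Q) := AlgEquiv.ofRingEquiv (f := e) fun r => by
    obtain ⟨a, rfl⟩ := Ideal.Quotient.mk_surjective r
    refine (hmk (σ • (a : B)) a).mpr ?_
    exact hsmall _ (fun τ hτ => congrArg Subtype.val (a.2 ⟨τ, hτ⟩)) a.1.2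
  obtain ⟨τ, hτ⟩ := Ideal.Quotient.stabilizerHom_surjective_of_profinite (G := G) (Q.under A) Q e'
  refine ⟨(τ : G)⁻¹ * σ, ?_, fun x hx => ?_⟩
  · rw [Ne, map_mul_eq_one_iff]
    simp only [hσ, iff_false, not_not]
    exact (map_inv_eq_one_iff _ _).mpr τ.1.2
  · have h1 : Ideal.Quotient.mk Q ((σ : Gal(Ω/F)) • (⟨x, hx⟩ : B)) =
        Ideal.Quotient.mk Q ((τ : G) • (⟨x, hx⟩ : B)) :=
      (DFunLike.congr_fun hτ (Ideal.Quotient.mk Q ⟨x, hx⟩)).symm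
    have h2 : v (σ x - (τ : G).1 x) < 1 := (hmk _ _).mp h1
    rw [← H.map_gal ((τ : G).1)⁻¹, _root_.map_sub] at h2
    simpa using h2

variable {R : Type*} [CommRing R] [Algebra R F] [Algebra R Ω] [IsScalarTower R F Ω]

omit [IsGalois F Ω] in
theorem mem_inertiaGroup_iff (hR : ∀ x : Ω, IsIntegral R x ↔ v x ≤ 1) {σ : Gal(Ω/F)} :
    σ ∈ inertiaGroup R F Ω ↔ ∀ x, v x ≤ 1 → v (σ x - x) < 1 := by
  constructor
  · intro h x hx
    obtain ⟨y, hy, hyx⟩ := h ⟨x, (hR x).mpr hx⟩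
    rw [zero_add, pow_one, mem_primeIdeal_iff hR] at hy
    rw [← hyx]
    exact hy
  · intro h x
    have hx := h x (intRing_le_one hR x)
    refine ⟨⟨σ x - x, (hR _).mpr hx.le⟩, ?_, rfl⟩
    rw [zero_add, pow_one, mem_primeIdeal_iff hR]
    exact hx

omit [IsGalois F Ω] in
theorem inertiaOrbits_of_trivial (hφ : ∀ σ, φ.toHom σ = 1) (j : Fin 2) :
    φ.inertiaOrbits R j = 1 := by
  rw [inertiaOrbits]
  simp_rw [hφ, one_smul]
  rw [Set.range_const, Set.ncard_singleton]

theorem inertiaOrbits_ram (H : v.IsLocalOver ϖ) (hR : ∀ x : Ω, IsIntegral R x ↔ v x ≤ 1) {n : ℕ}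
    (hφ : φ.IsRam v ϖ n) (j : Fin 2) : φ.inertiaOrbits R j = 1 := by
  obtain ⟨τ, hτ, hτ'⟩ := H.exists_inertia hφ
  have hmem : φ.toHom τ ∈ (inertiaGroup R F Ω).map φ.toHom :=
    ⟨τ, (mem_inertiaGroup_iff hR).mpr hτ', rfl⟩
  have horb : ∀ x : Fin 2, MulAction.orbit ((inertiaGroup R F Ω).map φ.toHom) x = Set.univ := by
    intro x
    refine Set.eq_univ_of_forall fun y => ?_
    by_cases hxy : y = x
    · rw [hxy]
      exact MulAction.mem_orbit_self x
    · refine ⟨⟨_, hmem⟩, ?_⟩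
      change φ.toHom τ x = y
      have h1 : φ.toHom τ x ≠ x := fun h => hτ ((Equiv.Perm.apply_eq_self_iff_two _ _).mp h)
      omega
  rw [inertiaOrbits]
  simp_rw [horb]
  rw [Set.range_const, Set.ncard_singleton]

omit [IsGalois F Ω] in
-- Inertia moves every integer by less than 1, while an element with nontrivial image moves `α` by
-- exactly 1. So inertia fixes both blocks.
theorem inertiaOrbits_unram (hR : ∀ x : Ω, IsIntegral R x ↔ v x ≤ 1)
    (hφ : φ.IsUnram v) (j : Fin 2) : φ.inertiaOrbits R j = 2 := by
  obtain ⟨⟨σ, hσ⟩, α, hα, hα1, hσα⟩ := hφ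
  have horb : ∀ x : Fin 2, MulAction.orbit ((inertiaGroup R F Ω).map φ.toHom) x = {x} := by
    intro x
    refine Set.eq_singleton_iff_unique_mem.mpr ⟨MulAction.mem_orbit_self x, ?_⟩
    rintro _ ⟨⟨_, τ, hτ, rfl⟩, rfl⟩
    have h1 : φ.toHom τ = 1 := by
      by_contra h
      exact ((mem_inertiaGroup_iff hR).mp hτ α hα1).ne (hσα τ h)
    change φ.toHom τ x = x
    rw [h1, Equiv.Perm.one_apply]
  rw [inertiaOrbits]
  simp_rw [horb]
  have hrange : (Set.range fun τ : Gal(Ω/F) => ({φ.toHom τ • j} : Set (Fin 2))) =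
      {{j}, {φ.toHom σ • j}} := by
    ext s
    constructor
    · rintro ⟨τ, rfl⟩
      by_cases h : φ.toHom τ = 1
      · left
        simp [h]
      · right
        simp [Equiv.Perm.eq_of_ne_one_two h hσ]
    · rintro (rfl | rfl)
      · exact ⟨1, by simp⟩
      · exact ⟨σ, rfl⟩
  rw [hrange, Set.ncard_pair]
  intro h
  exact hσ ((Equiv.Perm.apply_eq_self_iff_two _ j).mp (Set.singleton_injective h).symm)

end Valuation.IsLocalOver

end Inertia

/-! ### Wreath product representations with a given quotient -/

section WreathFibers

namespace GalRep

variable {K Ω A B 𝓑 : Type*} [Field K] [Field Ω] [Algebra K Ω] [Group A] [Group B]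
  [MulAction B 𝓑] {β : GalRep K Ω B} {j : 𝓑}

/-- The stabilizer of `j` acts on `Ω` over the fixed field of the stabilizer. -/
def stabLift (β : GalRep K Ω B) (j : 𝓑) : β.stab j →* Gal(Ω/β.pointField j) :=
  (IntermediateField.fixingSubgroupEquiv (β.pointField j)).toMonoidHom.comp
    (Subgroup.inclusion fun σ hσ => by
      rw [IntermediateField.mem_fixingSubgroup_iff]
      exact fun x hx => hx ⟨σ, hσ⟩)

/-- A representation of `Gal(Ω/L)`, where `L` is the fixed field of the stabilizer of `j`,
considered as a homomorphism on the stabilizer of `j`. -/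
def stabHom (φ : GalRep (β.pointField j) Ω A) : β.stab j →* A := φ.toHom.comp (β.stabLift j)

variable [IsGalois K Ω]

theorem toHom_eq_stabHom (φ : GalRep (β.pointField j) Ω A) (σ : Gal(Ω/β.pointField j)) :
    φ.toHom σ = stabHom φ ⟨σ.restrictScalars K, β.restrictScalars_mem_stab j σ⟩ := rfl

theorem stabHom_injective {φ ψ : GalRep (β.pointField j) Ω A} (h : stabHom φ = stabHom ψ) :
    φ = ψ := by
  ext σ
  rw [toHom_eq_stabHom, h, ← toHom_eq_stabHom]

/-- The group of `Ω` over the fixed field is closed-embedded in the full Galois group, by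
compactness. So the open kernel of `φ` is cut out by an open set `V`, which is then intersected with
the open stabilizer. -/
theorem isOpen_stabHom (φ : GalRep (β.pointField j) Ω A) :
    IsOpen {σ : Gal(Ω/K) | ∃ h : σ ∈ β.stab j, stabHom φ ⟨σ, h⟩ = 1} := by
  have hcont := continuous_restrictScalars (F := K) (β.pointField j)
  have hinj : Function.Injective
      (AlgEquiv.restrictScalarsHom K : Gal(Ω/β.pointField j) →* Gal(Ω/K)) :=
    AlgEquiv.restrictScalars_injective K
  obtain ⟨V, hV, hVφ⟩ := (hcont.isClosedEmbedding hinj).isInducing.isOpen_iff.mp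
    (φ.isOpen_preimage {1})
  have hstab : IsOpen (β.stab j : Set Gal(Ω/K)) :=
    β.isOpen_preimage (MulAction.stabilizer B j : Set B)
  convert hV.inter hstab using 1
  ext σ
  have key : ∀ h : σ ∈ β.stab j, σ ∈ V ↔ stabHom φ ⟨σ, h⟩ = 1 := fun h =>
    Set.ext_iff.mp hVφ (β.stabLift j ⟨σ, h⟩)
  exact ⟨fun ⟨h, h'⟩ => ⟨(key h).mpr h', h⟩, fun ⟨h, h'⟩ => ⟨h', (key h').mp h⟩⟩

/-- The `j`-th block of `ρ`, if `β` is the quotient of `ρ`. -/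
def blockOf {ρ : GalRep K Ω (PermWreath A B 𝓑)} (h : ρ.quot = β) (j : 𝓑) :
    GalRep (β.pointField j) Ω A :=
  h ▸ ρ.block j

/-- The type of a block depends on the quotient, so blocks of different ρ are comparable only after
transport to a fixed `β`. On the stabilizer that transport disappears. -/
theorem stabHom_blockOf {ρ : GalRep K Ω (PermWreath A B 𝓑)} (h : ρ.quot = β) (σ : β.stab j) :
    stabHom (blockOf h j) σ = (ρ.toHom σ).left j := by
  subst h
  rfl

omit [IsGalois K Ω] in
theorem right_eq {ρ : GalRep K Ω (PermWreath A B 𝓑)} (h : ρ.quot = β) (σ : Gal(Ω/K)) :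
    (ρ.toHom σ).right = β.toHom σ := by
  subst h
  rfl

omit [IsGalois K Ω] in
theorem mul_left_apply (g h : PermWreath A B 𝓑) (j : 𝓑) :
    (g * h).left j = g.left j * h.left (g.right⁻¹ • j) := rfl

omit [IsGalois K Ω] in
/-- A representation in a wreath product is given by its quotient and a cocycle. -/
theorem exists_of_cocycle (c : Gal(Ω/K) → 𝓑 → A)
    (hc : ∀ σ τ j, c (σ * τ) j = c σ j * c τ ((β.toHom σ)⁻¹ • j))
    {U : Set Gal(Ω/K)} (hU : IsOpen U) (h1 : 1 ∈ U) (hUc : ∀ σ ∈ U, ∀ j, c σ j = 1) :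
    ∃ ρ : GalRep K Ω (PermWreath A B 𝓑), ρ.quot = β ∧ ∀ σ j, (ρ.toHom σ).left j = c σ j := by
  let f : Gal(Ω/K) →* PermWreath A B 𝓑 :=
    { toFun := fun σ => ⟨c σ, β.toHom σ⟩
      map_one' := SemidirectProduct.ext (funext fun j => hUc 1 h1 j) (map_one _)
      map_mul' := fun σ τ => SemidirectProduct.ext (funext fun j => hc σ τ j) (map_mul _ _ _) }
  refine ⟨⟨f, continuous_of_isOpen_ker f (Subgroup.isOpen_of_mem_nhds _ (g := 1) ?_)⟩, rfl,
    fun _ _ => rfl⟩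
  filter_upwards [hU.mem_nhds h1, (β.isOpen_preimage {1}).mem_nhds (map_one _)] with σ hσ hσ'
  exact SemidirectProduct.ext (funext fun j => hUc σ hσ j) hσ'

/-- If the quotient `β` is trivial, then a representation is given by its blocks. -/
theorem bijective_blocks [Finite 𝓑] (hβ : ∀ σ, β.toHom σ = 1) :
    Function.Bijective (fun (ρ : {ρ : GalRep K Ω (PermWreath A B 𝓑) // ρ.quot = β}) (j : 𝓑) =>
      blockOf ρ.2 j) := by
  have hmem : ∀ (σ : Gal(Ω/K)) (j : 𝓑), σ ∈ β.stab j := fun σ j => by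
    change β.toHom σ • j = j
    rw [hβ, one_smul]
  constructor
  · rintro ⟨ρ, hρ⟩ ⟨ρ', hρ'⟩ h
    refine Subtype.ext (GalRep.ext (MonoidHom.ext fun σ =>
      SemidirectProduct.ext (funext fun j => ?_) ?_))
    · rw [← stabHom_blockOf hρ ⟨σ, hmem σ j⟩, ← stabHom_blockOf hρ' ⟨σ, hmem σ j⟩]
      exact congrArg (fun φ => stabHom φ _) (congrFun h j)
    · rw [right_eq hρ, right_eq hρ']
  · intro φ
    obtain ⟨ρ, hρ, hρφ⟩ := exists_of_cocycle (β := β)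
      (fun σ j => stabHom (φ j) ⟨σ, hmem σ j⟩)
      (fun σ τ j => by
        have h1 : (β.toHom σ)⁻¹ • j = j := by rw [hβ, inv_one, one_smul]
        rw [h1]
        exact map_mul (stabHom (φ j)) ⟨σ, hmem σ j⟩ ⟨τ, hmem τ j⟩)
      (isOpen_iInter_of_finite fun j => (isOpen_stabHom (φ j)))
      (Set.mem_iInter.mpr fun j => ⟨hmem 1 j, map_one (stabHom (φ j))⟩)
      (fun σ hσ j => (Set.mem_iInter.mp hσ j).2)
    refine ⟨⟨ρ, hρ⟩, funext fun j => stabHom_injective (MonoidHom.ext fun σ => ?_)⟩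
    rw [stabHom_blockOf]
    exact hρφ σ j

end GalRep

namespace GalRep

variable {K Ω A : Type*} [Field K] [Field Ω] [Algebra K Ω] [Group A] [IsGalois K Ω]
  {β : GalRep K Ω (Equiv.Perm (Fin 2))}

/-- If the quotient `β` is transitive, then a representation is given by its block `0` and an
element of `A`. -/
theorem bijective_block_zero {s : Gal(Ω/K)} (hs : β.toHom s ≠ 1) :
    Function.Bijective
      (fun ρ : {ρ : GalRep K Ω (PermWreath A (Equiv.Perm (Fin 2)) (Fin 2)) // ρ.quot = β} =>
        (blockOf ρ.2 0, (ρ.1.toHom s).left 0)) := by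
  have hsj : ∀ j : Fin 2, (β.toHom s)⁻¹ • j ≠ j := fun j h => by
    have h1 := (Equiv.Perm.apply_eq_self_iff_two _ j).mp h
    exact hs (inv_eq_one.mp h1)
  have hs0 : (β.toHom s)⁻¹ • (0 : Fin 2) = 1 := by
    have := hsj 0
    omega
  have hmem : ∀ σ, β.toHom σ = 1 → σ ∈ β.stab (0 : Fin 2) := fun σ h => mem_stab_iff.mpr h
  have hmem' : ∀ σ, β.toHom σ ≠ 1 → σ * s⁻¹ ∈ β.stab (0 : Fin 2) := fun σ h =>
    mem_stab_iff.mpr ((map_mul_eq_one_iff _ _ _).mpr (by rw [map_inv_eq_one_iff]; simp [h, hs]))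
  constructor
  · rintro ⟨ρ, hρ⟩ ⟨ρ', hρ'⟩ h
    obtain ⟨h1, h2⟩ := Prod.mk.inj h
    -- Outside the stabilizer, σ is written as (σs⁻¹)s, which reduces component 0 to the block and
    -- the value at `s`.
    have key : ∀ σ, (ρ.toHom σ).left 0 = (ρ'.toHom σ).left 0 := by
      have key1 : ∀ σ, β.toHom σ = 1 → (ρ.toHom σ).left 0 = (ρ'.toHom σ).left 0 := fun σ hσ => by
        rw [← stabHom_blockOf hρ ⟨σ, hmem σ hσ⟩, ← stabHom_blockOf hρ' ⟨σ, hmem σ hσ⟩]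
        exact congrArg (fun φ => stabHom φ _) h1
      intro σ
      by_cases hσ : β.toHom σ = 1
      · exact key1 σ hσ
      · have hσs : β.toHom (σ * s⁻¹) = 1 := mem_stab_iff.mp (hmem' σ hσ)
        rw [← inv_mul_cancel_right σ s, map_mul _ (σ * s⁻¹), map_mul _ (σ * s⁻¹), mul_left_apply,
          mul_left_apply, right_eq hρ, right_eq hρ', hσs, inv_one, one_smul, h2, key1 _ hσs]
    refine Subtype.ext (GalRep.ext (MonoidHom.ext fun σ =>
      SemidirectProduct.ext (funext fun j => ?_) ?_))
    · fin_cases j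
      · exact key σ
      · have h3 := key (s * σ)
        rw [map_mul, map_mul, mul_left_apply, mul_left_apply, right_eq hρ, right_eq hρ', h2,
          hs0] at h3
        exact mul_left_cancel h3
    · rw [right_eq hρ, right_eq hρ']
  · rintro ⟨φ, x⟩
    classical
    -- The prospective component 0, extended from the stabilizer to its other coset by prescribing
    -- the value `x` at `s`.
    let d : Gal(Ω/K) → A := fun σ =>
      if h : β.toHom σ = 1 then stabHom φ ⟨σ, hmem σ h⟩ else stabHom φ ⟨_, hmem' σ h⟩ * x
    have hd1 : ∀ σ (h : β.toHom σ = 1), d σ = stabHom φ ⟨σ, hmem σ h⟩ := fun σ h => dif_pos h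
    have hds : d s = x := by
      have h1 : (⟨_, hmem' s hs⟩ : β.stab (0 : Fin 2)) = 1 := Subtype.ext (mul_inv_cancel s)
      simp only [d]
      rw [dif_neg hs, h1, map_one, one_mul]
    have hdmul : ∀ σ τ, β.toHom σ = 1 → d (σ * τ) = d σ * d τ := by
      intro σ τ hσ
      rw [hd1 σ hσ]
      by_cases hτ : β.toHom τ = 1
      · have hστ : β.toHom (σ * τ) = 1 := by rw [map_mul, hσ, hτ, one_mul]
        rw [hd1 τ hτ, hd1 _ hστ, ← map_mul]
        rfl
      · have hστ : β.toHom (σ * τ) ≠ 1 := by rwa [map_mul, hσ, one_mul]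
        simp only [d]
        rw [dif_neg hτ, dif_neg hστ, ← mul_assoc, ← map_mul]
        rfl
    -- Component 1 is forced by the cocycle relation for the product sσ at block 0, which reads
    -- d(sσ) = x · c(σ)(1).
    let c : Gal(Ω/K) → Fin 2 → A := fun σ j => if j = 0 then d σ else x⁻¹ * d (s * σ)
    have hc0 : ∀ σ, c σ 0 = d σ := fun σ => if_pos rfl
    have hc1 : ∀ σ, c σ 1 = x⁻¹ * d (s * σ) := fun σ => if_neg one_ne_zero
    have hcoc0 : ∀ σ τ, d (σ * τ) = d σ * c τ ((β.toHom σ)⁻¹ • 0) := by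
      intro σ τ
      by_cases hσ : β.toHom σ = 1
      · rw [hσ, inv_one, one_smul, hc0, hdmul σ τ hσ]
      · have h1 : β.toHom σ = β.toHom s := Equiv.Perm.eq_of_ne_one_two hσ hs
        have hσs : β.toHom (σ * s⁻¹) = 1 := mem_stab_iff.mp (hmem' σ hσ)
        have h2 : d σ = d (σ * s⁻¹) * x := by
          rw [← hds, ← hdmul _ _ hσs, inv_mul_cancel_right]
        have h3 : σ * τ = (σ * s⁻¹) * (s * τ) := by group
        rw [h1, hs0, hc1, h2, h3, hdmul _ _ hσs]
        simp only [mul_assoc, mul_inv_cancel_left]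
    obtain ⟨ρ, hρ, hρc⟩ := exists_of_cocycle (β := β) c (fun σ τ j => by
        fin_cases j
        · exact hcoc0 σ τ
        · have h1 : (β.toHom σ)⁻¹ • (1 : Fin 2) = (β.toHom (s * σ))⁻¹ • (0 : Fin 2) := by
            rw [map_mul, mul_inv_rev, mul_smul, hs0]
          change c (σ * τ) 1 = c σ 1 * c τ ((β.toHom σ)⁻¹ • 1)
          rw [hc1, hc1, ← mul_assoc s, hcoc0, h1, mul_assoc])
      -- Component 1 at σ is the conjugate by x⁻¹ of the value of `φ` at sσs⁻¹, so both σ and sσs⁻¹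
      -- must lie in the kernel of `φ`.
      (U := {σ | ∃ h, stabHom φ ⟨σ, h⟩ = 1} ∩
        (fun σ => s * σ * s⁻¹) ⁻¹' {σ | ∃ h, stabHom φ ⟨σ, h⟩ = 1})
      ((isOpen_stabHom φ).inter ((isOpen_stabHom φ).preimage (by fun_prop)))
      ⟨⟨one_mem _, map_one (stabHom φ)⟩, by
        simp only [Set.mem_preimage, mul_one, mul_inv_cancel]
        exact ⟨one_mem _, map_one (stabHom φ)⟩⟩
      (fun σ hσ j => by
        obtain ⟨⟨h1, h1'⟩, h2, h2'⟩ := hσ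
        fin_cases j
        · change c σ 0 = 1
          rw [hc0, hd1 σ (mem_stab_iff.mp h1), h1']
        · change c σ 1 = 1
          have h3 := mem_stab_iff.mp h2
          rw [hc1, ← inv_mul_cancel_right (s * σ) s, hdmul _ _ h3, hds, hd1 _ h3, h2', one_mul,
            inv_mul_cancel])
    refine ⟨⟨ρ, hρ⟩, Prod.ext (stabHom_injective (MonoidHom.ext fun σ => ?_)) ?_⟩
    · rw [stabHom_blockOf, hρc, hc0, hd1 _ (mem_stab_iff.mp σ.2)]
    · exact (hρc s 0).trans ((hc0 s).trans hds)

end GalRep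

end WreathFibers

/-! ### The mass of the wreath product -/

section WreathMass

open scoped ENNReal

open GalRep

variable {R K Ω : Type*} [CommRing R] [Field K] [Field Ω] [Algebra R K] [Algebra R Ω]
  [Algebra K Ω] [IsScalarTower R K Ω] [IsGalois K Ω] {v : Valuation Ω ℝ≥0} {ϖ : K}
  {β : GalRep K Ω (Equiv.Perm (Fin 2))} {ρ : GalRep K Ω S2WrS2}

variable (R) in
/-- The wreath counting function for `S₂ ≀ S₂`. -/
abbrev quarticCount (ρ : GalRep K Ω S2WrS2) : ℚ :=
  wreathCount R (symmetricCount R 2) (fun _ => symmetricCount R 2) ρ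

omit [IsGalois K Ω] in
open Classical in
theorem filter_least_of_trivial (hβ : ∀ σ, β.toHom σ = 1) :
    ({i | ∀ σ, i ≤ β.toHom σ • i} : Finset (Fin 2)) = {0, 1} := by
  ext i
  fin_cases i <;> simp [hβ]

omit [IsGalois K Ω] in
open Classical in
theorem filter_least_of_ne_one {s : Gal(Ω/K)} (hs : β.toHom s ≠ 1) :
    ({i | ∀ σ, i ≤ β.toHom σ • i} : Finset (Fin 2)) = {0} := by
  ext i
  simp only [Finset.mem_filter, Finset.mem_univ, true_and, Finset.mem_singleton]
  constructor
  · intro h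
    have h1 := h s
    have h2 : β.toHom s • i ≠ i := fun h3 => hs ((Equiv.Perm.apply_eq_self_iff_two _ i).mp h3)
    omega
  · rintro rfl σ
    exact Fin.zero_le _

open Classical in
theorem quarticCount_eq (h : ρ.quot = β) : quarticCount R ρ = symmetricCount R 2 β +
    ∑ i : Fin 2 with ∀ σ, i ≤ β.toHom σ • i,
      (β.inertiaOrbits R i : ℚ) * symmetricCount R 2 (blockOf h i) := by
  subst h
  rfl

theorem quarticCount_trivial (hβ : ∀ σ, β.toHom σ = 1) (h : ρ.quot = β) :
    quarticCount R ρ = symmetricCount R 2 (blockOf h 0) + symmetricCount R 2 (blockOf h 1) := by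
  classical
  rw [quarticCount_eq h, Valuation.IsLocalOver.symmetricCount_trivial R hβ,
    filter_least_of_trivial hβ, Finset.sum_pair zero_ne_one,
    Valuation.IsLocalOver.inertiaOrbits_of_trivial hβ,
    Valuation.IsLocalOver.inertiaOrbits_of_trivial hβ]
  simp

theorem quarticCount_unram (hR : ∀ x : Ω, IsIntegral R x ↔ v x ≤ 1) (hβ : β.IsUnram v)
    (h : ρ.quot = β) : quarticCount R ρ = 2 * symmetricCount R 2 (blockOf h 0) := by
  classical
  obtain ⟨s, hs⟩ := hβ.1
  rw [quarticCount_eq h, Valuation.IsLocalOver.symmetricCount_unram hR hβ,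
    filter_least_of_ne_one hs, Finset.sum_singleton,
    Valuation.IsLocalOver.inertiaOrbits_unram hR hβ]
  simp

theorem quarticCount_ram (H : v.IsLocalOver ϖ) (hR : ∀ x : Ω, IsIntegral R x ↔ v x ≤ 1) {n : ℕ}
    (hβ : β.IsRam v ϖ n) (h : ρ.quot = β) :
    quarticCount R ρ = n + symmetricCount R 2 (blockOf h 0) := by
  classical
  obtain ⟨s, hs⟩ := hβ.1
  rw [quarticCount_eq h, H.symmetricCount_ram hR hβ,
    filter_least_of_ne_one hs, Finset.sum_singleton, H.inertiaOrbits_ram hR hβ]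
  simp

namespace Valuation.IsLocalOver

variable (H : v.IsLocalOver ϖ)

include H

theorem isLocalOver_pointField_trivial (hβ : ∀ σ, β.toHom σ = 1) (j : Fin 2) :
    v.IsLocalOver (algebraMap K (β.pointField j) ϖ) ∧
      (v.comap (algebraMap (β.pointField j) Ω)).residueCard (algebraMap K (β.pointField j) ϖ) =
        (v.comap (algebraMap K Ω)).residueCard ϖ :=
  H.isLocalOver_trivial fun _ hx => exists_algebraMap_eq fun σ => mem_pointField_iff.mp hx σ (hβ σ)

theorem tsum_quarticCount_trivial [IsSepClosed Ω] (hR : ∀ x : Ω, IsIntegral R x ↔ v x ≤ 1)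
    {x : ℝ≥0∞} (hx : ((v.comap (algebraMap K Ω)).residueCard ϖ : ℝ≥0∞) * x = 1)
    (hβ : ∀ σ, β.toHom σ = 1) :
    ∑' ρ : {ρ : GalRep K Ω S2WrS2 // ρ.quot = β}, x ^ (quarticCount R ρ.1).num.toNat =
      (2 + 2 * x) ^ 2 := by
  obtain ⟨H0, hq0⟩ := H.isLocalOver_pointField_trivial hβ 0
  obtain ⟨H1, hq1⟩ := H.isLocalOver_pointField_trivial hβ 1
  let e := (Equiv.ofBijective _ (bijective_blocks (A := Equiv.Perm (Fin 2)) hβ)).trans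
    (piFinTwoEquiv _)
  let g : GalRep (β.pointField (0 : Fin 2)) Ω (Equiv.Perm (Fin 2)) ×
      GalRep (β.pointField (1 : Fin 2)) Ω (Equiv.Perm (Fin 2)) → ℝ≥0∞ := fun p =>
    x ^ p.1.ramExp v (algebraMap K (β.pointField (0 : Fin 2)) ϖ) *
      x ^ p.2.ramExp v (algebraMap K (β.pointField (1 : Fin 2)) ϖ)
  have h1 : ∀ ρ : {ρ : GalRep K Ω S2WrS2 // ρ.quot = β}, x ^ (quarticCount R ρ.1).num.toNat =
      g (e ρ) := by
    intro ρ
    rw [quarticCount_trivial hβ ρ.2, H0.symmetricCount_eq hR, H1.symmetricCount_eq hR,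
      ← Nat.cast_add, Rat.num_natCast, Int.toNat_natCast, pow_add]
    rfl
  refine (tsum_congr h1).trans ((e.tsum_eq g).trans ?_)
  rw [ENNReal.tsum_prod']
  simp_rw [g, ENNReal.tsum_mul_left, ENNReal.tsum_mul_right]
  rw [H0.tsum_ramExp (hq0 ▸ hx), H1.tsum_ramExp (hq1 ▸ hx), pow_two]

omit H in
-- The factor 2 is the order of S₂: by `bijective_block_zero`, each block extends to ρ in as many
-- ways.
theorem tsum_of_block_zero {s : Gal(Ω/K)} (hs : β.toHom s ≠ 1)
    (f : GalRep (β.pointField (0 : Fin 2)) Ω (Equiv.Perm (Fin 2)) → ℝ≥0∞) :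
    ∑' ρ : {ρ : GalRep K Ω S2WrS2 // ρ.quot = β}, f (blockOf ρ.2 0) = 2 * ∑' φ, f φ := by
  let e := Equiv.ofBijective _ (bijective_block_zero (A := Equiv.Perm (Fin 2)) hs)
  have h1 : ∀ ρ : {ρ : GalRep K Ω S2WrS2 // ρ.quot = β}, f (blockOf ρ.2 0) =
      f (e ρ).1 := fun ρ => rfl
  refine (tsum_congr h1).trans ((e.tsum_eq fun p => f p.1).trans ?_)
  rw [ENNReal.tsum_prod', ← ENNReal.tsum_mul_left]
  refine tsum_congr fun φ => ?_
  rw [tsum_fintype]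
  simp [Fintype.card_perm]

/-- The mass formula for `S₂ ≀ S₂`. -/
theorem tsum_quarticCount [IsSepClosed Ω] (hR : ∀ x : Ω, IsIntegral R x ↔ v x ≤ 1)
    {x : ℝ≥0∞} (hx : ((v.comap (algebraMap K Ω)).residueCard ϖ : ℝ≥0∞) * x = 1) :
    ∑' ρ : GalRep K Ω S2WrS2, x ^ (quarticCount R ρ).num.toNat = 8 + 16 * x + 16 * x ^ 2 := by
  rw [← (Equiv.sigmaFiberEquiv (fun ρ : GalRep K Ω S2WrS2 => ρ.quot)).tsum_eq, ENNReal.tsum_sigma']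
  change ∑' β : GalRep K Ω (Equiv.Perm (Fin 2)),
    ∑' ρ : {ρ : GalRep K Ω S2WrS2 // ρ.quot = β}, x ^ (quarticCount R ρ.1).num.toNat = _
  -- The constants are the masses of the fibres over a trivial, an unramified and a ramified
  -- quotient, the last one without the factor x^n.
  rw [H.tsum_of_cases hx (a := (2 + 2 * x) ^ 2) (b := 2 * (2 + 2 * x ^ 2)) (c := 2 * (2 + 2 * x))]
  · ring
  · intro β hβ
    exact H.tsum_quarticCount_trivial hR hx hβ
  · intro β hβ
    obtain ⟨s, hs⟩ := hβ.1
    obtain ⟨H0, hq0⟩ := H.isLocalOver_unram (E := β.pointField (0 : Fin 2))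
      (fun x => mem_pointField_iff) hβ
    -- Over the unramified extension the residue field has q² elements, and the doubled conductor is
    -- exactly what turns the weight x into x².
    rw [← H0.tsum_ramExp (x := x ^ 2) (by rw [hq0, Nat.cast_pow, ← mul_pow, hx, one_pow]),
      ← tsum_of_block_zero hs]
    refine tsum_congr fun ρ => ?_
    rw [quarticCount_unram hR hβ ρ.2, H0.symmetricCount_eq hR, ← pow_mul]
    norm_cast
  · intro β n hβ
    obtain ⟨s, hs⟩ := hβ.1
    obtain ⟨π, H0, -, hq0⟩ := H.isLocalOver_ram (E := β.pointField (0 : Fin 2))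
      (fun x => mem_pointField_iff) hβ
    rw [← H0.tsum_ramExp (x := x) (by rw [hq0, hx]), ← tsum_of_block_zero hs,
      ← ENNReal.tsum_mul_left]
    refine tsum_congr fun ρ => ?_
    rw [quarticCount_ram H hR hβ ρ.2, H0.symmetricCount_eq hR, ← Nat.cast_add, Rat.num_natCast,
      Int.toNat_natCast, pow_add]

theorem exists_quarticCount_eq (hR : ∀ x : Ω, IsIntegral R x ↔ v x ≤ 1)
    (ρ : GalRep K Ω S2WrS2) : ∃ n : ℕ, quarticCount R ρ = n := by
  by_cases hβ : ∃ s, ρ.quot.toHom s ≠ 1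
  · obtain ⟨s, hs⟩ := hβ
    rcases H.isUnram_or_isRam hs with h | ⟨n, h⟩
    · obtain ⟨H0, -⟩ := H.isLocalOver_unram (E := ρ.quot.pointField (0 : Fin 2))
        (fun x => mem_pointField_iff) h
      rw [quarticCount_unram hR h rfl, H0.symmetricCount_eq hR]
      exact ⟨_, by norm_cast⟩
    · obtain ⟨π, H0, -⟩ := H.isLocalOver_ram (E := ρ.quot.pointField (0 : Fin 2))
        (fun x => mem_pointField_iff) h
      rw [quarticCount_ram H hR h rfl, H0.symmetricCount_eq hR]
      exact ⟨_, by norm_cast⟩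
  · push Not at hβ
    obtain ⟨H0, -⟩ := H.isLocalOver_pointField_trivial hβ 0
    obtain ⟨H1, -⟩ := H.isLocalOver_pointField_trivial hβ 1
    rw [quarticCount_trivial hβ rfl, H0.symmetricCount_eq hR, H1.symmetricCount_eq hR]
    exact ⟨_, by norm_cast⟩

end Valuation.IsLocalOver

end WreathMass

/-! ### The wreath count as a discriminant exponent -/

section WreathDiscriminant

open GalRep

variable {R K Ω : Type*} [CommRing R] [Field K] [Field Ω] [Algebra R K] [Algebra R Ω]
  [Algebra K Ω] [IsScalarTower R K Ω] [IsGalois K Ω] {v : Valuation Ω ℝ≥0} {ϖ : K}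
  {ρ : GalRep K Ω S2WrS2} {s : Gal(Ω/K)} {i j : Fin 2}

omit [IsGalois K Ω] in
/-- Blocks in the same orbit are conjugate. -/
theorem GalRep.left_conj_eq_one_iff (hs : ρ.quot.toHom s • j = i) {σ : Gal(Ω/K)}
    (hσ : ρ.quot.toHom σ • j = j) :
    (ρ.toHom (s * σ * s⁻¹)).left i = 1 ↔ (ρ.toHom σ).left j = 1 := by
  have hs' : (ρ.toHom s).right⁻¹ • i = j := inv_smul_eq_iff.mpr hs.symm
  have hσ' : (ρ.toHom σ).right⁻¹ • j = j := inv_smul_eq_iff.mpr hσ.symm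
  have h1 : (ρ.toHom (s * s⁻¹)).left i = 1 := by
    rw [mul_inv_cancel, map_one]
    rfl
  rw [map_mul, mul_left_apply, hs'] at h1
  rw [mul_assoc, map_mul, mul_left_apply, hs', map_mul, mul_left_apply, hσ',
    eq_inv_of_mul_eq_one_right h1, ← mul_assoc, mul_inv_eq_one, mul_eq_left]

/-- Conjugation by `s` identifies the stabilizers of the two blocks and their actions, so generators
and the sizes of their differences are carried along. -/
theorem GalRep.IsGen.conj_block (hs : ρ.quot.toHom s • j = i) {α : Ω}
    (hα : (ρ.block i).IsGen α) : (ρ.block j).IsGen (s⁻¹ α) ∧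
      ∀ σ, (ρ.block j).toHom σ ≠ 1 → ∃ τ, (ρ.block i).toHom τ ≠ 1 ∧
        τ α - α = s (σ (s⁻¹ α) - s⁻¹ α) := by
  have key : ∀ σ : Gal(Ω/ρ.quot.pointField j), ∃ τ : Gal(Ω/ρ.quot.pointField i),
      ((ρ.block i).toHom τ = 1 ↔ (ρ.block j).toHom σ = 1) ∧
        τ α - α = s (σ (s⁻¹ α) - s⁻¹ α) := by
    intro σ
    have hσ := ρ.quot.restrictScalars_mem_stab j σ
    have hmem : s * σ.restrictScalars K * s⁻¹ ∈ ρ.quot.stab i := by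
      change ρ.quot.toHom (s * σ.restrictScalars K * s⁻¹) • i = i
      have hσ' : ρ.quot.toHom (σ.restrictScalars K) • j = j := hσ
      rw [map_mul, map_mul, map_inv, mul_smul, mul_smul, inv_smul_eq_iff.mpr hs.symm, hσ', hs]
    refine ⟨ρ.quot.stabLift i ⟨_, hmem⟩, left_conj_eq_one_iff hs hσ, ?_⟩
    have hss : s (s⁻¹ α) = α := by rw [← AlgEquiv.mul_apply, mul_inv_cancel, AlgEquiv.one_apply]
    rw [map_sub, hss]
    rfl
  constructor
  · intro σ
    obtain ⟨τ, hτ, hτ'⟩ := key σ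
    rw [← hτ, hα τ, ← sub_eq_zero, hτ', map_eq_zero, sub_eq_zero]
  · intro σ hσ
    obtain ⟨τ, hτ, hτ'⟩ := key σ
    exact ⟨τ, fun h => hσ (hτ.mp h), hτ'⟩

theorem GalRep.exists_block_ne_one (hs : ρ.quot.toHom s • j = i)
    (h : ∃ σ, (ρ.block i).toHom σ ≠ 1) : ∃ σ, (ρ.block j).toHom σ ≠ 1 := by
  obtain ⟨σ, hσ⟩ := h
  have hs' : ρ.quot.toHom s⁻¹ • i = j := by rw [map_inv, inv_smul_eq_iff, hs]
  have hσ' := ρ.quot.restrictScalars_mem_stab i σ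
  have hmem : s⁻¹ * σ.restrictScalars K * s⁻¹⁻¹ ∈ ρ.quot.stab j := by
    change ρ.quot.toHom (s⁻¹ * σ.restrictScalars K * s⁻¹⁻¹) • j = j
    have hσ'' : ρ.quot.toHom (σ.restrictScalars K) • i = i := hσ'
    rw [map_mul, map_mul, map_inv _ s⁻¹, mul_smul, mul_smul, inv_smul_eq_iff.mpr hs'.symm, hσ'', hs']
  exact ⟨ρ.quot.stabLift j ⟨_, hmem⟩, fun h => hσ ((left_conj_eq_one_iff hs' hσ').mp h)⟩

namespace Valuation.IsLocalOver

variable (H : v.IsLocalOver ϖ)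

include H

theorem isUnram_block (hs : ρ.quot.toHom s • j = i) (h : (ρ.block i).IsUnram v) :
    (ρ.block j).IsUnram v := by
  obtain ⟨hne, α, hα, hα1, hσα⟩ := h
  obtain ⟨h1, h2⟩ := hα.conj_block hs
  refine ⟨exists_block_ne_one hs hne, s⁻¹ α, h1, (H.map_gal _ α).trans_le hα1, fun σ hσ => ?_⟩
  obtain ⟨τ, hτ, hτ'⟩ := h2 σ hσ
  rw [← H.map_gal s, ← hτ', hσα τ hτ]

theorem isRam_block (hs : ρ.quot.toHom s • j = i) {π : ρ.quot.pointField i}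
    {π' : ρ.quot.pointField j} (hπ : v (π' : Ω) = v π) {n : ℕ} (h : (ρ.block i).IsRam v π n) :
    (ρ.block j).IsRam v π' n := by
  obtain ⟨hne, α, hα, hα1, hσα⟩ := h
  obtain ⟨h1, h2⟩ := hα.conj_block hs
  refine ⟨exists_block_ne_one hs hne, s⁻¹ α, h1, ?_, fun σ hσ => ?_⟩
  · rw [H.map_gal, hα1]
    exact hπ.symm
  · obtain ⟨τ, hτ, hτ'⟩ := h2 σ hσ
    rw [← H.map_gal s, ← hτ', hσα τ hτ, H.map_gal]

/-- The count refers to block 0 only, while the tower is built on any block `j`; conjugation gives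
the upper extension the same exponent m. Then n = a + f · m, with `a` the discriminant exponent of
the lower extension and `f` its residue degree. -/
theorem primeIdeal_pow_eq_of_quot (hR : ∀ x : Ω, IsIntegral R x ↔ v x ≤ 1)
    (hs : ρ.quot.toHom s ≠ 1) (hne : ∃ σ, (ρ.block 0).toHom σ ≠ 1)
    {π : ∀ j, ρ.quot.pointField j} (Hπ : ∀ j : Fin 2, v.IsLocalOver (π j)) {a f n : ℕ}
    (hf : ∀ j, v (π j : Ω) ^ 2 = v (algebraMap K Ω ϖ) ^ f)
    (ha : ∀ j : Fin 2, discIdeal R K (ρ.quot.pointField j) = primeIdeal R K ^ a)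
    (hn : (n : ℚ) = a + f * symmetricCount R 2 (ρ.block 0)) (j x : Fin 2) :
    Module.finrank (ρ.quot.pointField j) ((ρ.block j).pointField x) = 2 ∧
      primeIdeal R K ^ n = discIdeal R K (ρ.quot.pointField j) * normIdeal R K
        (discIdeal R (ρ.quot.pointField j) ((ρ.block j).pointField x)) := by
  obtain ⟨τ, hτ⟩ : ∃ τ, ρ.quot.toHom τ • j = 0 := by
    by_cases hj : j = 0
    · exact ⟨1, by rw [map_one, one_smul, hj]⟩
    · refine ⟨s, ?_⟩
      have h1 : ρ.quot.toHom s • j ≠ j := fun h => hs ((Equiv.Perm.apply_eq_self_iff_two _ j).mp h)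
      omega
  have hππ : v (π j : Ω) = v (π 0 : Ω) :=
    (pow_left_inj₀ zero_le zero_le two_ne_zero).mp ((hf j).trans (hf 0).symm)
  have hdisc : ∃ m : ℕ, symmetricCount R 2 (ρ.block 0) = m ∧
      discIdeal R (ρ.quot.pointField j) ((ρ.block j).pointField x) =
        primeIdeal R (ρ.quot.pointField j) ^ m := by
    obtain ⟨σ, hσ⟩ := hne
    rcases (Hπ 0).isUnram_or_isRam hσ with h | ⟨m, h⟩
    · exact ⟨0, by rw [symmetricCount_unram hR h, Nat.cast_zero],
        (Hπ j).discIdeal_unram hR (fun x => mem_pointField_iff) (H.isUnram_block hτ h)⟩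
    · exact ⟨m, (Hπ 0).symmetricCount_ram hR h,
        (Hπ j).discIdeal_ram hR (fun x => mem_pointField_iff) (H.isRam_block hτ hππ h)⟩
  obtain ⟨m, hm, hdisc⟩ := hdisc
  obtain ⟨σ, hσ⟩ := exists_block_ne_one hτ hne
  obtain ⟨α, hα⟩ := exists_isGen hσ
  refine ⟨hα.finrank_eq_two hσ fun x => mem_pointField_iff, ?_⟩
  have hnm : n = a + f * m := by
    rw [hm] at hn
    exact_mod_cast hn
  rw [hdisc, H.normIdeal_primeIdeal_pow hR (fun x => mem_pointField_iff) hs (Hπ j) (hf j), ha,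
    ← pow_add, hnm]

/-- The wreath count of a transitive representation is the exponent of the discriminant of the
corresponding tower of quadratic extensions. -/
theorem primeIdeal_pow_eq (hR : ∀ x : Ω, IsIntegral R x ↔ v x ≤ 1)
    (htrans : ∀ p p' : Fin 2 × Fin 2, ∃ σ, ρ.toHom σ • p = p') {n : ℕ}
    (hn : quarticCount R ρ = n) (j x : Fin 2) :
    Module.finrank K (ρ.quot.pointField j) = 2 ∧
      Module.finrank (ρ.quot.pointField j) ((ρ.block j).pointField x) = 2 ∧
      primeIdeal R K ^ n = discIdeal R K (ρ.quot.pointField j) * normIdeal R K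
        (discIdeal R (ρ.quot.pointField j) ((ρ.block j).pointField x)) := by
  obtain ⟨s, hs⟩ : ∃ s, ρ.quot.toHom s ≠ 1 := by
    obtain ⟨s, hs⟩ := htrans (0, 0) (1, 0)
    refine ⟨s, fun h => ?_⟩
    have h1 : ρ.quot.toHom s • (0 : Fin 2) = 1 := congrArg Prod.fst hs
    rw [h, one_smul] at h1
    exact zero_ne_one h1
  have hne : ∃ σ, (ρ.block 0).toHom σ ≠ 1 := by
    obtain ⟨σ, hσ⟩ := htrans (0, 0) (0, 1)
    have h1 : ρ.quot.toHom σ • (0 : Fin 2) = 0 := congrArg Prod.fst hσ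
    have h2 : (ρ.toHom σ).left (ρ.quot.toHom σ • (0 : Fin 2)) • (0 : Fin 2) = 1 :=
      congrArg Prod.snd hσ
    rw [h1] at h2
    refine ⟨ρ.quot.stabLift 0 ⟨σ, h1⟩, fun h => ?_⟩
    have h3 : (ρ.toHom σ).left 0 = 1 := h
    rw [h3, one_smul] at h2
    exact zero_ne_one h2
  obtain ⟨α, hα⟩ := exists_isGen hs
  refine ⟨hα.finrank_eq_two hs fun x => mem_pointField_iff, ?_⟩
  rcases H.isUnram_or_isRam hs with h | ⟨m, h⟩
  · refine H.primeIdeal_pow_eq_of_quot hR hs hne (a := 0) (f := 2)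
      (fun j => (H.isLocalOver_unram (E := ρ.quot.pointField j)
        (fun x => mem_pointField_iff) h).1) (fun j => rfl)
      (fun j => H.discIdeal_unram hR (fun x => mem_pointField_iff) h) ?_ j x
    rw [← hn, quarticCount_unram hR h rfl]
    simp [blockOf]
  · have hex : ∀ j : Fin 2, ∃ π : ρ.quot.pointField j, v.IsLocalOver π ∧
        v (π : Ω) ^ 2 = v (algebraMap K Ω ϖ) := fun j => by
      obtain ⟨π, h1, h2, -⟩ := H.isLocalOver_ram (E := ρ.quot.pointField j)
        (fun x => mem_pointField_iff) h
      exact ⟨π, h1, h2⟩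
    choose π hπ hπ2 using hex
    refine H.primeIdeal_pow_eq_of_quot hR hs hne (a := m) (f := 1) hπ
      (fun j => by rw [hπ2, pow_one])
      (fun j => H.discIdeal_ram hR (fun x => mem_pointField_iff) h) ?_ j x
    rw [← hn, quarticCount_ram H hR h rfl]
    simp [blockOf]

end Valuation.IsLocalOver

end WreathDiscriminant

/-! ### Extending the valuation to the separable closure -/

section SpectralValuation

/-- The extension of the absolute value to an algebraic extension, as a valuation. -/
def spectralValuation (K Ω : Type*) [NontriviallyNormedField K] [IsUltrametricDist K]
    [CompleteSpace K] [Field Ω] [Algebra K Ω] [Algebra.IsAlgebraic K Ω] : Valuation Ω ℝ≥0 where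
  toFun x := ⟨spectralMulAlgNorm K Ω x, apply_nonneg _ x⟩
  map_zero' := Subtype.ext (map_zero (spectralMulAlgNorm K Ω))
  map_one' := Subtype.ext (map_one (spectralMulAlgNorm K Ω))
  map_mul' x y := Subtype.ext (map_mul (spectralMulAlgNorm K Ω) x y)
  map_add_le_max' x y := isNonarchimedean_spectralNorm (K := K) (L := Ω) x y

/-- The spectral norm depends only on the minimal polynomial, hence is Galois invariant, and it is
at most 1 exactly when the coefficients of that polynomial are integral. Multiplicativity uses that
`K` is complete. -/
theorem exists_valuation (K Ω : Type*) [Field K] [ValuativeRel K] [TopologicalSpace K]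
    [IsNonarchimedeanLocalField K] [Field Ω] [Algebra K Ω] [Algebra.IsAlgebraic K Ω] :
    ∃ v : Valuation Ω ℝ≥0, (∀ (σ : Gal(Ω/K)) x, v (σ x) = v x) ∧
      (∀ x : K, v (algebraMap K Ω x) ≤ 1 ↔ x ∈ 𝒪[K]) ∧
      ∀ x : Ω, v x ≤ 1 → ∀ n, (minpoly K x).coeff n ∈ 𝒪[K] := by
  let _ := IsTopologicalAddGroup.rightUniformSpace K
  have := isUniformAddGroup_of_addCommGroup (G := K)
  -- A real embedding of the value group turns `K` into a normed field.
  let _ : (Valued.v (R := K)).RankOne :=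
    { hom' := (ValuativeRel.IsRankLeOne.nonempty (R := K)).some.emb.comp
        MonoidWithZeroHom.ValueGroup₀.embedding
      strictMono' := (ValuativeRel.IsRankLeOne.nonempty (R := K)).some.strictMono.comp
        MonoidWithZeroHom.ValueGroup₀.embedding_strictMono }
  open scoped Valued in
  have hle : ∀ x : K, ‖x‖ ≤ 1 ↔ x ∈ Valuation.integer (ValuativeRel.valuation K) := fun x => Valued.toNormedField.norm_le_one_iff
  open scoped Valued in
  refine ⟨spectralValuation K Ω, fun σ x => Subtype.ext (spectralNorm_eq_of_equiv σ x).symm,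
    fun x => ?_, fun x hx n => ?_⟩
  · rw [← hle, ← spectralNorm_extends (L := Ω) x]
    rfl
  · rw [← hle]
    exact (spectralValue_le_one_iff (minpoly.monic (Algebra.IsIntegral.isIntegral x))).mp hx n

end SpectralValuation

/-! ### Integers, uniformizer and residue field of the local field -/

section LocalField

variable {K Ω : Type*} [Field K] [ValuativeRel K] [TopologicalSpace K]
  [IsNonarchimedeanLocalField K] [Field Ω] [Algebra K Ω] [Algebra.IsAlgebraic K Ω]
  {v : Valuation Ω ℝ≥0}

omit [TopologicalSpace K] [IsNonarchimedeanLocalField K] in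
theorem isIntegral_iff_le_one (hK : ∀ x : K, v (algebraMap K Ω x) ≤ 1 ↔ x ∈ 𝒪[K])
    (hc : ∀ x : Ω, v x ≤ 1 → ∀ n, (minpoly K x).coeff n ∈ 𝒪[K]) (x : Ω) :
    IsIntegral 𝒪[K] x ↔ v x ≤ 1 := by
  constructor
  · intro hx
    let f : 𝒪[K] →+* v.integer := ((algebraMap K Ω).comp 𝒪[K].subtype).codRestrict v.integer
      fun y => (hK y).mpr y.2
    exact (Valuation.integer.integers v).mem_of_integral
      (hx.map_of_comp_eq f (RingHom.id Ω) (RingHom.ext fun _ => rfl))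
  · intro hx
    have hlift : minpoly K x ∈ Polynomial.lifts (algebraMap 𝒪[K] K) := by
      rw [Polynomial.lifts_iff_coeff_lifts]
      exact fun n => ⟨⟨_, hc x hx n⟩, rfl⟩
    obtain ⟨q, hq, -, hqm⟩ := Polynomial.lifts_and_natDegree_eq_and_monic hlift
      (minpoly.monic (Algebra.IsIntegral.isIntegral x))
    refine ⟨q, hqm, ?_⟩
    rw [← Polynomial.aeval_def, ← Polynomial.aeval_map_algebraMap K, hq, minpoly.aeval]

omit [Algebra.IsAlgebraic K Ω] in
-- Only the unit ball of `v` on `K` is known, so the uniformizer is an irreducible element of the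
-- discrete valuation ring, and the remaining data follow from divisibility there.
theorem exists_isLocalOver (hg : ∀ (σ : Gal(Ω/K)) x, v (σ x) = v x)
    (hK : ∀ x : K, v (algebraMap K Ω x) ≤ 1 ↔ x ∈ 𝒪[K]) :
    ∃ ϖ : K, v.IsLocalOver ϖ ∧ (v.comap (algebraMap K Ω)).residueCard ϖ = Nat.card 𝓀[K] := by
  obtain ⟨p, hp⟩ := IsDiscreteValuationRing.exists_irreducible 𝒪[K]
  set w := v.comap (algebraMap K Ω) with hw
  have hK' : ∀ x : K, w x ≤ 1 ↔ x ∈ 𝒪[K] := hK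
  have hp0 : (p : K) ≠ 0 := fun h => hp.ne_zero (Subtype.ext h)
  have hunit : ∀ x : 𝒪[K], w x = 1 → IsUnit x := by
    intro x hx
    have h0 : (x : K) ≠ 0 := by
      intro h
      rw [h, map_zero] at hx
      exact zero_ne_one hx
    refine IsUnit.of_mul_eq_one ⟨(x : K)⁻¹, (hK' _).mp ?_⟩ (Subtype.ext (mul_inv_cancel₀ h0))
    rw [map_inv₀, hx, inv_one]
  have hp1 : w p < 1 := ((hK' p).mpr p.2).lt_of_ne fun h => hp.not_isUnit (hunit p h)
  have hdvd : ∀ x : K, w x < 1 → ∃ y : 𝒪[K], x = p * y := by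
    intro x hx
    have hmem : (⟨x, (hK' x).mp hx.le⟩ : 𝒪[K]) ∈ 𝓂[K] := by
      rw [IsLocalRing.mem_maximalIdeal, mem_nonunits_iff]
      intro hu
      obtain ⟨y, hy⟩ := hu.exists_right_inv
      have h1 : w x * w y = 1 := by
        rw [← map_mul, show x * (y : K) = 1 from congrArg Subtype.val hy, map_one]
      exact absurd h1 (mul_lt_one_of_lt_of_le hx ((hK' y).mpr y.2)).ne
    rw [hp.maximalIdeal_eq, Ideal.mem_span_singleton] at hmem
    obtain ⟨y, hy⟩ := hmem
    exact ⟨y, congrArg Subtype.val hy⟩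
  have hle : ∀ x : K, w x < 1 → w x ≤ w p := by
    intro x hx
    obtain ⟨y, rfl⟩ := hdvd x hx
    rw [map_mul]
    exact mul_le_of_le_one_right zero_le ((hK' y).mpr y.2)
  have hcard : w.residueCard p = Nat.card 𝓀[K] := by
    let i : 𝒪[K] →+ K := 𝒪[K].subtype.toAddMonoidHom
    have h1 : i.range = w.ball 1 := by
      ext x
      rw [Valuation.mem_ball, hK']
      exact ⟨fun ⟨y, hy⟩ => hy ▸ y.2, fun hx => ⟨⟨x, hx⟩, rfl⟩⟩
    have h2 : (w.ball (w p)).comap i = 𝓂[K].toAddSubgroup := by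
      ext x
      rw [AddSubgroup.mem_comap, Valuation.mem_ball, Submodule.mem_toAddSubgroup,
        hp.maximalIdeal_eq, Ideal.mem_span_singleton]
      constructor
      · intro hx
        obtain ⟨y, hy⟩ := hdvd x (lt_of_le_of_lt hx hp1)
        exact ⟨y, Subtype.ext hy⟩
      · rintro ⟨y, rfl⟩
        change w ((p : K) * y) ≤ w p
        rw [map_mul]
        exact mul_le_of_le_one_right zero_le ((hK' y).mpr y.2)
    rw [Valuation.residueCard, ← h1, ← AddSubgroup.index_comap, h2]
    rfl
  exact ⟨p, ⟨hg, hp0, hp1, hle, hcard ▸ Nat.card_pos.ne'⟩, hcard⟩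

end LocalField

/-! ### The dihedral group as a wreath product -/

section Dihedral

theorem nonempty_dihedralGroup_four_mulEquiv : Nonempty (DihedralGroup 4 ≃* S2WrS2) := by
  -- A 4-cycle on the four points, followed by the exchange of the blocks; they act as rotation and
  -- reflection.
  let g : S2WrS2 := ⟨![Equiv.swap 0 1, 1], Equiv.swap 0 1⟩
  let h : S2WrS2 := ⟨1, Equiv.swap 0 1⟩
  have hh : h * h = 1 := by
    rw [SemidirectProduct.ext_iff]
    decide
  have hgh : ∀ i j : ZMod 4, g ^ i.val * g ^ j.val = g ^ (i + j).val ∧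
      g ^ i.val * (h * g ^ j.val) = h * g ^ (j - i).val := by
    simp only [SemidirectProduct.ext_iff]
    decide
  have hinj1 : ∀ i j : ZMod 4, (g ^ i.val = g ^ j.val → i = j) ∧ g ^ i.val ≠ h * g ^ j.val := by
    simp only [SemidirectProduct.ext_iff, Ne]
    decide
  let f : DihedralGroup 4 →* S2WrS2 :=
    { toFun := fun x => match x with
        | .r i => g ^ i.val
        | .sr i => h * g ^ i.val
      map_one' := pow_zero g
      map_mul' := by
        rintro (i | i) (j | j)
        · exact (hgh i j).1.symm
        · exact (hgh i j).2.symm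
        · change h * g ^ (i + j).val = h * g ^ i.val * g ^ j.val
          rw [mul_assoc, (hgh i j).1]
        · change g ^ (j - i).val = h * g ^ i.val * (h * g ^ j.val)
          rw [mul_assoc, (hgh i j).2, ← mul_assoc, hh, one_mul] }
  have hinj : Function.Injective f := by
    rintro (i | i) (j | j) hij
    · rw [(hinj1 i j).1 hij]
    · exact absurd hij (hinj1 i j).2
    · exact absurd hij.symm (hinj1 j i).2
    · rw [(hinj1 i j).1 (mul_left_cancel hij)]
  have : Finite S2WrS2 := Finite.of_equiv _ SemidirectProduct.equivProd.symm
  have hcard : Nat.card (DihedralGroup 4) = Nat.card S2WrS2 := by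
    rw [DihedralGroup.nat_card, SemidirectProduct.card]
    simp [Fintype.card_perm]
  exact ⟨MulEquiv.ofBijective f ((Nat.bijective_iff_injective_and_card f).mpr ⟨hinj, hcard⟩)⟩

/-- Transport of representations along an isomorphism of groups. -/
def GalRep.congr {F Ω Γ Γ' : Type*} [Field F] [Field Ω] [Algebra F Ω] [Group Γ] [Group Γ']
    (e : Γ ≃* Γ') : GalRep F Ω Γ ≃ GalRep F Ω Γ' where
  toFun := comp e.toMonoidHom
  invFun := comp e.symm.toMonoidHom
  left_inv ρ := GalRep.ext (MonoidHom.ext fun σ => e.symm_apply_apply (ρ.toHom σ))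
  right_inv ρ := GalRep.ext (MonoidHom.ext fun σ => e.apply_symm_apply (ρ.toHom σ))

end Dihedral

/-! ### From extended nonnegative sums to real sums -/

section RealSums

open scoped ENNReal

/-- The mass is computed in the extended nonnegative reals, where rearrangement is free; finiteness
of the total then gives convergence over the reals. -/
theorem hasSum_rpow_of_tsum {X : Type*} {c : X → ℚ} (hc : ∀ x, ∃ n : ℕ, c x = n) {q : ℕ}
    {S : ℝ≥0∞} (hS : S ≠ ⊤) (h : ∑' x, (q : ℝ≥0∞)⁻¹ ^ (c x).num.toNat = S) :
    HasSum (fun x => (q : ℝ) ^ (-(c x : ℝ))) S.toReal := by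
  have h1 : HasSum (fun x => ((q : ℝ≥0∞)⁻¹ ^ (c x).num.toNat).toReal) _ :=
    ENNReal.hasSum_toReal (h.trans_ne hS)
  have hfin : ∀ x, (q : ℝ≥0∞)⁻¹ ^ (c x).num.toNat ≠ ⊤ := fun x =>
    ne_top_of_le_ne_top (h.trans_ne hS) (ENNReal.le_tsum x)
  rw [← ENNReal.tsum_toReal_eq hfin, h] at h1
  convert h1 using 2 with x
  obtain ⟨n, hn⟩ := hc x
  rw [hn, Rat.num_natCast, Int.toNat_natCast, Rat.cast_natCast, Real.rpow_neg (Nat.cast_nonneg q),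
    Real.rpow_natCast, ENNReal.toReal_pow, ENNReal.toReal_inv, ENNReal.toReal_natCast, inv_pow]

end RealSums

end

theorem mainTheorem7 (K : Type*) [Field K] [ValuativeRel K] [TopologicalSpace K]
    [IsNonarchimedeanLocalField K] :
    Nonempty (DihedralGroup 4 ≃* S2WrS2) ∧
    (∀ e : DihedralGroup 4 ≃* S2WrS2,
      HasSum
        (fun ρ : GalRep K (SeparableClosure K) (DihedralGroup 4) =>
          (Nat.card 𝓀[K] : ℝ) ^ (-(countS2WrS2 K (ρ.comp e.toMonoidHom) : ℝ)))
        (8 + 16 / (Nat.card 𝓀[K] : ℝ) + 16 / (Nat.card 𝓀[K] : ℝ) ^ 2)) ∧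
    ∀ ρ : GalRep K (SeparableClosure K) S2WrS2, ∃ n : ℕ, countS2WrS2 K ρ = n ∧
      ((∀ p p' : Fin 2 × Fin 2, ∃ σ, ρ.toHom σ • p = p') →
        ∀ j x : Fin 2,
          Module.finrank K (ρ.quot.pointField j) = 2 ∧
          Module.finrank (ρ.quot.pointField j) ((ρ.block j).pointField x) = 2 ∧
          primeIdeal 𝒪[K] K ^ n =
            discIdeal 𝒪[K] K (ρ.quot.pointField j) *
              normIdeal 𝒪[K] K
                (discIdeal 𝒪[K] (ρ.quot.pointField j) ((ρ.block j).pointField x))) := by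
  obtain ⟨v, hg, hK, hc⟩ := exists_valuation K (SeparableClosure K)
  have hR := isIntegral_iff_le_one hK hc
  obtain ⟨ϖ, H, hq⟩ := exists_isLocalOver hg hK
  refine ⟨nonempty_dihedralGroup_four_mulEquiv, fun e => ?_, fun ρ => ?_⟩
  · have hq0 : (Nat.card 𝓀[K] : ENNReal) ≠ 0 := by
      rw [Nat.cast_ne_zero]
      exact Nat.card_pos.ne'
    have hx : (Nat.card 𝓀[K] : ENNReal)⁻¹ ≠ ⊤ := ENNReal.inv_ne_top.mpr hq0
    -- Composition with `e` permutes the terms of the sum bijectively, so the choice of isomorphism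
    -- does not matter.
    have h1 := (GalRep.congr e).hasSum_iff.mpr (hasSum_rpow_of_tsum (c := countS2WrS2 K)
      (H.exists_quarticCount_eq hR) (by finiteness)
      (H.tsum_quarticCount hR (x := (Nat.card 𝓀[K] : ENNReal)⁻¹)
        (by rw [hq, ENNReal.mul_inv_cancel hq0 (ENNReal.natCast_ne_top _)])))
    rw [ENNReal.toReal_add (by finiteness) (by finiteness),
      ENNReal.toReal_add (by finiteness) (by finiteness)] at h1
    convert h1 using 1
    · rfl
    · simp [div_eq_mul_inv]
  · obtain ⟨n, hn⟩ := H.exists_quarticCount_eq (R := 𝒪[K]) hR ρ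
    exact ⟨n, hn, fun htrans => H.primeIdeal_pow_eq hR htrans hn⟩
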